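/- Let $k$ be a field of characteristic $0$ and let $V$ be a finite-dimensional $\mathbb Z$-graded vector space over $k$ with a homogeneous basis $(e_\alpha)$. Signs are Koszul signs; $|x|$ is the degree of $x$, and for a subset $S$ of indices $b_S$ is the family $(b_i)_{i\in S}$ in increasing order and $|b_S|=\sum_{i\in S}|b_i|$. **$\mathrm{Gerst}_\infty$-algebra structures.** A $\mathrm{Gerst}_\infty$-algebra structure on $V$ consists of linear maps $\nu_n:\odot^nV\to V$ ($n\ge1$) of degree $3-2n$ and $\mu_{n;p}:(\otimes^nV)\otimes(\odot^pV)\to V$ ($n\ge2$, $p\ge0$) of degree $2-n-2p$ ($\odot$ is the graded symmetric power) such that, for all homogeneous $a_i,b_i\in V$, $$\sum_{S_1\sqcup S_2=\{1,\dots,N\}}(-1)^{\sigma}\,\nu_{|S_2|+1}\bigl(\nu_{|S_1|}(b_{S_1}),b_{S_2}\bigr)=0\qquad(N\ge1),$$ and, for $n\ge2$, $N\ge0$, $$\sum_{S_1\sqcup S_2}(-1)^{\sigma}\Bigl\{\nu_{|S_2|+1}\bigl(\mu_{n;|S_1|}(a_1,\dots,a_n;b_{S_1}),b_{S_2}\bigr)-(-1)^{|a_1|+\dots+|a_n|-n}\mu_{n;|S_2|+1}\bigl(a_1,\dots,a_n;\nu_{|S_1|}(b_{S_1}),b_{S_2}\bigr)$$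 $$-\sum_{j=1}^n(-1)^{|a_1|+\dots+|a_{j-1}|+(|a_{j+1}|+\dots+|a_n|)|b_{S_1}|-n}\mu_{n;|S_2|}\bigl(a_1,\dots,a_{j-1},\nu_{|S_1|+1}(a_j,b_{S_1}),a_{j+1},\dots,a_n;b_{S_2}\bigr)\Bigr\}$$ $$=\sum_{\substack{q+l=n+1\\ q,l\ge2}}\sum_{j=0}^{q-1}\sum_{S_1\sqcup S_2}(-1)^{\sigma+r}\mu_{q;|S_2|}\bigl(a_1,\dots,a_j,\mu_{l;|S_1|}(a_{j+1},\dots,a_{j+l};b_{S_1}),a_{j+l+1},\dots,a_n;b_{S_2}\bigr),$$ where $(-1)^\sigma$ is the Koszul sign of $b_1\otimes\dots\otimes b_N\mapsto b_{S_1}\otimes b_{S_2}$, $r=j+l(n-j-l)+l(|a_1|+\dots+|a_j|)+(|a_{j+l+1}|+\dots+|a_n|)|b_{S_1}|$, and $\nu_0=0$. **Geometric $A_\infty$-structures.** Let $\mathcal M=(V[2],0)$ be the pointed affine formal graded manifold with coordinates $t^\alpha$ dual to $e_\alpha$, $|t^\alpha|=2-|e_\alpha|$. Its functions $\mathcal O$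 are the formal power series in the graded commuting $t^\alpha$ (finite sums of homogeneous ones), and its vector fields $\mathcal T$ form the free $\mathcal O$-module with basis $\partial_\alpha=\partial/\partial t^\alpha$, $|\partial_\alpha|=|e_\alpha|-2$. A geometric $A_\infty$-structure on $\mathcal M$ is a pair $(\vec\nu,\mu_\bullet)$ of * a vector field $\vec\nu$ of degree $1$ with $[\vec\nu,\vec\nu]=0$ and $\vec\nu|_0=0$; * $k$-multilinear operations $\mu_n$ of $n\ge1$ arguments on $\mathcal T$ making $\mathcal T[-2]$ (that is, $\mathcal T$ with $\partial_\alpha$ placed in degree $|e_\alpha|$) an $A_\infty$-algebra: $\mu_n$ has degree $2-n$ and, for all $n\ge1$ and homogeneous $X_i$, $$\sum_{\substack{q+l=n+1\\ q,l\ge1}}\sum_{j=0}^{q-1}(-1)^{j+l(n-j-l)+l(|X_1|+\dots+|X_j|)}\mu_q(X_1,\dots,X_j,\mu_l(X_{j+1},\dots,X_{j+l}),X_{j+l+1},\dots,X_n)=0;$$ such that $\mu_1=\mathrm{Lie}_{\vec\nu}=[\vec\nu,\,\cdot\,]$ and, for $n\ge2$, $\mu_n$ is a tensor, i.e. $\mathcal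 O$-multilinear in the graded sense: $\mu_n(X_1,\dots,fX_i,\dots,X_n)=(-1)^{|f|(2-n+|X_1|+\dots+|X_{i-1}|)}f\mu_n(X_1,\dots,X_n)$. **Theorem 3.8.2.** There is a one-to-one correspondence between $\mathrm{Gerst}_\infty$-algebra structures on $V$ and geometric $A_\infty$-structures on the pointed affine formal manifold $(V[2],0)$. With $t=\sum_\alpha t^\alpha e_\alpha$ and with $e_\alpha$ identified with $\partial_\alpha$ it is given by $$\vec\nu=\sum_{n\ge1}\frac1{n!}\nu_n(t,\dots,t),\qquad \mu_n(\partial_{\alpha_1},\dots,\partial_{\alpha_n})=\sum_{p\ge0}\frac1{p!}\mu_{n;p}(e_{\alpha_1},\dots,e_{\alpha_n};t,\dots,t)\quad(n\ge2),$$ where the operations are extended to $\mathcal O\otimes V$ by $\mathcal O$-linearity with Koszul signs. -/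

import Mathlib

namespace GerstInf

open Finset

/-- The sequence `a` in which the block of the `l` consecutive entries `a j, …, a (j + l - 1)`
is replaced by the single entry `x`. -/
def splice {A : Type*} (a : ℕ → A) (j l : ℕ) (x : A) : ℕ → A :=
  fun i => if i < j then a i else if i = j then x else a (i - 1 + l)

/-! ### `A_∞`-structures on a graded vector space -/

/-- An `A_∞`-structure on the graded vector space `A` with homogeneous components `𝒜 d`:
operations `μ n`, `n ≥ 1`, of degree `2 - n` satisfying the Stasheff identities
`∑ (-1) ^ (j + l (n - j - l)) μ_k ∘ (1^{⊗ j} ⊗ μ_l ⊗ 1^{⊗ (n - j - l)}) = 0`,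
evaluated on homogeneous elements by the Koszul rule. Arguments are written as sequences
`a 0, a 1, …` of which only the first `n` entries are used. -/
@[ext]
structure AInfinityStructure {k A : Type*} [Field k] [AddCommGroup A] [Module k A]
    (𝒜 : ℤ → Submodule k A) where
  μ : (n : ℕ) → MultilinearMap k (fun _ : Fin n => A) A
  μ_zero : μ 0 = 0
  μ_mem : ∀ (n : ℕ) (a : Fin n → A) (d : Fin n → ℤ), (∀ i, a i ∈ 𝒜 (d i)) →
    μ n a ∈ 𝒜 (∑ i, d i + 2 - n)
  stasheff : ∀ (n : ℕ) (a : ℕ → A) (d : ℕ → ℤ), 1 ≤ n → (∀ i, a i ∈ 𝒜 (d i)) →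
    ∑ p ∈ HasAntidiagonal.antidiagonal (n + 1) with 1 ≤ p.1 ∧ 1 ≤ p.2, ∑ j ∈ range p.1,
      Int.negOnePow (j + p.2 * (n - j - p.2) + p.2 * ∑ i ∈ range j, d i) •
        μ p.1 (fun i => splice a j p.2 (μ p.2 (fun i => a (j + i))) i) = 0

/-! ### `Gerst_∞`-structures on a graded vector space -/

/-- The subfamily `b_S` of `b`, in increasing order of the indices in `S`. -/
def sub {A : Type*} {N : ℕ} (b : Fin N → A) (S : Finset (Fin N)) : Fin S.card → A :=
  fun i => b (S.orderEmbOfFin rfl i)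

/-- The exponent of the Koszul sign of the unshuffle
`b_1 ⊗ ⋯ ⊗ b_N ↦ b_S ⊗ b_{Sᶜ}` for elements `b_i` of degree `d i`. -/
def unshuffle {N : ℕ} (d : Fin N → ℤ) (S : Finset (Fin N)) : ℤ :=
  ∑ i ∈ S, ∑ j ∈ Sᶜ with j < i, d i * d j

/-- A `Gerst_∞`-algebra structure on the graded vector space `V` with homogeneous components
`𝒱 d`: operations `ν n : ⊙ⁿ V → V`, `n ≥ 1`, of degree `3 - 2n`, and
`μ n p : (⊗ⁿ V) ⊗ (⊙ᵖ V) → V`, `n ≥ 2`, `p ≥ 0`, of degree `2 - n - 2p`, subject to two families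
of quadratic identities. `⊙` is the graded symmetric power. -/
@[ext]
structure GerstInfinityStructure {k V : Type*} [Field k] [AddCommGroup V] [Module k V]
    (𝒱 : ℤ → Submodule k V) where
  ν : (n : ℕ) → MultilinearMap k (fun _ : Fin n => V) V
  μ : (n p : ℕ) → MultilinearMap k (fun _ : Fin n ⊕ Fin p => V) V
  ν_zero : ν 0 = 0
  μ_low : ∀ n p : ℕ, n < 2 → μ n p = 0
  ν_mem : ∀ (n : ℕ) (b : Fin n → V) (d : Fin n → ℤ), (∀ i, b i ∈ 𝒱 (d i)) →
    ν n b ∈ 𝒱 (∑ i, d i + 3 - 2 * n)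
  μ_mem : ∀ (n p : ℕ) (a : Fin n → V) (b : Fin p → V) (c : Fin n → ℤ) (d : Fin p → ℤ),
    (∀ i, a i ∈ 𝒱 (c i)) → (∀ i, b i ∈ 𝒱 (d i)) →
    μ n p (Sum.elim a b) ∈ 𝒱 (∑ i, c i + ∑ i, d i + 2 - n - 2 * p)
  ν_symm : ∀ (n : ℕ) (b : Fin n → V) (d : Fin n → ℤ), (∀ i, b i ∈ 𝒱 (d i)) →
    ∀ i j : Fin n, (j : ℕ) = i + 1 →
      ν n (b ∘ Equiv.swap i j) = Int.negOnePow (d i * d j) • ν n b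
  μ_symm : ∀ (n p : ℕ) (a : Fin n → V) (b : Fin p → V) (d : Fin p → ℤ),
    (∀ i, b i ∈ 𝒱 (d i)) → ∀ i j : Fin p, (j : ℕ) = i + 1 →
      μ n p (Sum.elim a (b ∘ Equiv.swap i j)) =
        Int.negOnePow (d i * d j) • μ n p (Sum.elim a b)
  ν_ν : ∀ (N : ℕ) (b : Fin N → V) (d : Fin N → ℤ), 1 ≤ N → (∀ i, b i ∈ 𝒱 (d i)) →
    ∑ S : Finset (Fin N), Int.negOnePow (unshuffle d S) •
      ν (Sᶜ.card + 1) (Fin.cons (ν S.card (sub b S)) (sub b Sᶜ)) = 0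
  ν_μ : ∀ (n N : ℕ) (a : ℕ → V) (b : Fin N → V) (c : ℕ → ℤ) (d : Fin N → ℤ), 2 ≤ n →
    (∀ i, a i ∈ 𝒱 (c i)) → (∀ i, b i ∈ 𝒱 (d i)) →
    ∑ S : Finset (Fin N), Int.negOnePow (unshuffle d S) •
      (ν (Sᶜ.card + 1)
          (Fin.cons (μ n S.card (Sum.elim (fun i => a i) (sub b S))) (sub b Sᶜ))
        - Int.negOnePow (∑ i ∈ range n, c i - n) •
            μ n (Sᶜ.card + 1)
              (Sum.elim (fun i => a i) (Fin.cons (ν S.card (sub b S)) (sub b Sᶜ)))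
        - ∑ j ∈ range n,
            Int.negOnePow (∑ i ∈ range j, c i
                + (∑ i ∈ Ico (j + 1) n, c i) * (∑ i ∈ S, d i) - n) •
              μ n Sᶜ.card
                (Sum.elim (fun i => splice a j 1 (ν (S.card + 1) (Fin.cons (a j) (sub b S))) i)
                  (sub b Sᶜ))) =
    ∑ p ∈ HasAntidiagonal.antidiagonal (n + 1) with 2 ≤ p.1 ∧ 2 ≤ p.2, ∑ j ∈ range p.1,
      ∑ S : Finset (Fin N), Int.negOnePow (unshuffle d S) •
        Int.negOnePow (j + p.2 * (n - j - p.2) + p.2 * ∑ i ∈ range j, c i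
            + (∑ i ∈ Ico (j + p.2) n, c i) * (∑ i ∈ S, d i)) •
          μ p.1 Sᶜ.card
            (Sum.elim
              (fun i => splice a j p.2
                (μ p.2 S.card (Sum.elim (fun i => a (j + i)) (sub b S))) i)
              (sub b Sᶜ))

/-! ### Functions on the formal graded manifold `V[2]`

`deg α` is the degree of the basis vector `e_α` of `V`; the coordinate `t^α` on `V[2]` has degree
`2 - deg α`, hence the parity of `deg α`. -/

section Functions

variable {ι : Type*} {k : Type*} [Field k] {deg : ι → ℤ}

/-- The monomial `t^m` is nonzero: odd coordinates square to zero. -/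
def IsMon (deg : ι → ℤ) (m : ι →₀ ℕ) : Prop := ∀ α, Odd (deg α) → m α ≤ 1

theorem IsMon.of_add {a b : ι →₀ ℕ} (h : IsMon deg (a + b)) : IsMon deg a ∧ IsMon deg b := by
  refine ⟨fun α hα => ?_, fun α hα => ?_⟩ <;>
  · have := h α hα
    rw [Finsupp.add_apply] at this
    omega

variable [Fintype ι]

/-- The degree of the monomial `t^m`. -/
def monDeg (deg : ι → ℤ) (m : ι →₀ ℕ) : ℤ := ∑ α, m α * (2 - deg α)

theorem monDeg_add (a b : ι →₀ ℕ) : monDeg deg (a + b) = monDeg deg a + monDeg deg b := by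
  simp only [monDeg, ← Finset.sum_add_distrib]
  refine Finset.sum_congr rfl fun α _ => ?_
  simp only [Finsupp.add_apply]
  push_cast
  ring

/-- The degrees of the monomials that occur in the series with coefficients `f`. -/
def degrees (deg : ι → ℤ) (f : (ι →₀ ℕ) → k) : Set ℤ := {d | ∃ m, f m ≠ 0 ∧ monDeg deg m = d}

/-- The graded space of functions on the formal manifold `V[2]`: formal power series `∑ f_m t^m` in
the graded commuting coordinates `t^α`, where the factors of `t^m` are written in increasing
order of the indices, which are finite sums of homogeneous series (a series is homogeneous of
degree `d` if all its monomials have degree `d`). -/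
def functionSpace (k : Type*) [Field k] (deg : ι → ℤ) : Submodule k ((ι →₀ ℕ) → k) where
  carrier := {f | (∀ m, ¬ IsMon deg m → f m = 0) ∧ (degrees deg f).Finite}
  zero_mem' := ⟨fun _ _ => rfl, Set.finite_empty.subset fun _ ⟨_, h, _⟩ => h rfl⟩
  add_mem' {f g} hf hg := by
    refine ⟨fun m hm => by rw [Pi.add_apply, hf.1 m hm, hg.1 m hm, add_zero],
      (hf.2.union hg.2).subset ?_⟩
    rintro d ⟨m, hm, rfl⟩
    by_cases h : f m = 0
    · refine Or.inr ⟨m, fun h' => hm ?_, rfl⟩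
      rw [Pi.add_apply, h, h', add_zero]
    · exact Or.inl ⟨m, h, rfl⟩
  smul_mem' c f hf := by
    refine ⟨fun m hm => by rw [Pi.smul_apply, hf.1 m hm, smul_zero], hf.2.subset ?_⟩
    rintro d ⟨m, hm, rfl⟩
    exact ⟨m, fun h => hm (by rw [Pi.smul_apply, h, smul_zero]), rfl⟩

/-- The functions on the formal manifold `V[2]`. -/
abbrev Functions (k : Type*) [Field k] (deg : ι → ℤ) : Type _ := functionSpace k deg

/-- The coefficient of `f` at `t^m`. -/
def coeff (f : Functions k deg) (m : ι →₀ ℕ) : k := f.1 m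

/-- The homogeneous functions of degree `d`. -/
def functionsOfDegree (k : Type*) [Field k] (deg : ι → ℤ) (d : ℤ) :
    Submodule k (Functions k deg) where
  carrier := {f | ∀ m, coeff f m ≠ 0 → monDeg deg m = d}
  zero_mem' _ hm := absurd rfl hm
  add_mem' {f g} hf hg m hm := by
    by_cases h : coeff f m = 0
    · refine hg m fun h' => hm ?_
      change coeff f m + coeff g m = 0
      rw [h, h', add_zero]
    · exact hf m h
  smul_mem' c f hf m hm := hf m fun h => hm (by
    change c * coeff f m = 0
    rw [h, mul_zero])

theorem Functions.ext' {f g : Functions k deg} (h : ∀ m, IsMon deg m → coeff f m = coeff g m) :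
    f = g := by
  refine Subtype.ext (funext fun m => ?_)
  by_cases hm : IsMon deg m
  · exact h m hm
  · rw [f.2.1 m hm, g.2.1 m hm]

theorem coeff_add (f g : Functions k deg) (m : ι →₀ ℕ) :
    coeff (f + g) m = coeff f m + coeff g m := rfl

theorem coeff_smul (c : k) (f : Functions k deg) (m : ι →₀ ℕ) :
    coeff (c • f) m = c * coeff f m := rfl

theorem coeff_zero (m : ι →₀ ℕ) : coeff (0 : Functions k deg) m = 0 := rfl

open Classical in
/-- The monomial `t^m` (zero if an odd coordinate has exponent at least two). -/
noncomputable def monomial (k : Type*) [Field k] (deg : ι → ℤ) (m : ι →₀ ℕ) :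
    Functions k deg :=
  ⟨fun m' => if m' = m ∧ IsMon deg m then 1 else 0, by
    refine ⟨fun m' hm' => if_neg fun (h : m' = m ∧ IsMon deg m) => hm' (h.1 ▸ h.2),
      (Set.finite_singleton (monDeg deg m)).subset ?_⟩
    rintro d ⟨m', hm', rfl⟩
    by_contra hne
    exact hm' (if_neg fun (h : m' = m ∧ IsMon deg m) => hne (by rw [h.1]; rfl))⟩

/-- The coordinate function `t^α`. -/
noncomputable def coord (k : Type*) [Field k] (deg : ι → ℤ) (α : ι) : Functions k deg :=
  monomial k deg (Finsupp.single α 1)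

variable [LinearOrder ι]

/-- The exponent of the sign in `t^a t^b = ± t^(a + b)`. -/
def monSign (deg : ι → ℤ) (a b : ι →₀ ℕ) : ℤ :=
  ∑ α, ∑ β with β < α, (a α * deg α) * (b β * deg β)

theorem monSign_add_left (a b c : ι →₀ ℕ) :
    monSign deg (a + b) c = monSign deg a c + monSign deg b c := by
  simp only [monSign, ← Finset.sum_add_distrib]
  refine Finset.sum_congr rfl fun α _ => Finset.sum_congr rfl fun β _ => ?_
  simp only [Finsupp.add_apply]
  push_cast
  ring

theorem monSign_add_right (a b c : ι →₀ ℕ) :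
    monSign deg a (b + c) = monSign deg a b + monSign deg a c := by
  simp only [monSign, ← Finset.sum_add_distrib]
  refine Finset.sum_congr rfl fun α _ => Finset.sum_congr rfl fun β _ => ?_
  simp only [Finsupp.add_apply]
  push_cast
  ring

open Classical in
/-- The product of functions: the bilinear and continuous extension of `t^a t^b = ± t^(a + b)`. -/
noncomputable instance : Mul (Functions k deg) where
  mul f g := ⟨fun m => if IsMon deg m then
      ∑ p ∈ HasAntidiagonal.antidiagonal m,
        Int.negOnePow (monSign deg p.1 p.2) • (coeff f p.1 * coeff g p.2)
      else 0, by
    refine ⟨fun m hm => if_neg hm, (Set.Finite.add f.2.2 g.2.2).subset ?_⟩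
    rintro d ⟨m, hm, rfl⟩
    rw [ne_eq, ite_eq_right_iff, Classical.not_imp] at hm
    obtain ⟨p, hp, hne⟩ := Finset.exists_ne_zero_of_sum_ne_zero hm.2
    have h0 : coeff f p.1 * coeff g p.2 ≠ 0 := fun h0 => hne (by rw [h0, smul_zero])
    rw [← HasAntidiagonal.mem_antidiagonal.1 hp, monDeg_add]
    exact Set.add_mem_add ⟨_, left_ne_zero_of_mul h0, rfl⟩ ⟨_, right_ne_zero_of_mul h0, rfl⟩⟩

noncomputable instance : One (Functions k deg) where
  one := monomial k deg 0

theorem coeff_one (m : ι →₀ ℕ) :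
    coeff (1 : Functions k deg) m = if m = 0 then 1 else 0 := by
  have h : IsMon deg 0 := fun α _ => Nat.zero_le _
  change coeff (monomial k deg 0) m = _
  simp [coeff, monomial, h]

theorem coeff_mul (f g : Functions k deg) {m : ι →₀ ℕ} (h : IsMon deg m) :
    coeff (f * g) m = ∑ p ∈ HasAntidiagonal.antidiagonal m,
      Int.negOnePow (monSign deg p.1 p.2) • (coeff f p.1 * coeff g p.2) := if_pos h

theorem Functions.mul_assoc' (f g h : Functions k deg) : f * g * h = f * (g * h) := by
  refine Functions.ext' fun m hm => ?_
  rw [coeff_mul _ _ hm, coeff_mul _ _ hm]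
  have hl : ∀ p ∈ HasAntidiagonal.antidiagonal m,
      Int.negOnePow (monSign deg p.1 p.2) • (coeff (f * g) p.1 * coeff h p.2) =
        ∑ q ∈ HasAntidiagonal.antidiagonal p.1,
          Int.negOnePow (monSign deg p.1 p.2 + monSign deg q.1 q.2) •
            (coeff f q.1 * coeff g q.2 * coeff h p.2) := by
    intro p hp
    rw [← HasAntidiagonal.mem_antidiagonal.1 hp] at hm
    rw [coeff_mul f g hm.of_add.1, Finset.sum_mul, Finset.smul_sum]
    refine Finset.sum_congr rfl fun q _ => ?_
    rw [Int.negOnePow_add, mul_smul, smul_mul_assoc]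
  have hr : ∀ p ∈ HasAntidiagonal.antidiagonal m,
      Int.negOnePow (monSign deg p.1 p.2) • (coeff f p.1 * coeff (g * h) p.2) =
        ∑ q ∈ HasAntidiagonal.antidiagonal p.2,
          Int.negOnePow (monSign deg p.1 p.2 + monSign deg q.1 q.2) •
            (coeff f p.1 * coeff g q.1 * coeff h q.2) := by
    intro p hp
    rw [← HasAntidiagonal.mem_antidiagonal.1 hp] at hm
    rw [coeff_mul g h hm.of_add.2, Finset.mul_sum, Finset.smul_sum]
    refine Finset.sum_congr rfl fun q _ => ?_
    rw [Int.negOnePow_add, mul_smul, mul_smul_comm, mul_assoc]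
  rw [Finset.sum_congr rfl hl, Finset.sum_congr rfl hr, Finset.sum_sigma', Finset.sum_sigma']
  refine Finset.sum_nbij' (fun x => ⟨(x.2.1, x.2.2 + x.1.2), (x.2.2, x.1.2)⟩)
    (fun x => ⟨(x.1.1 + x.2.1, x.2.2), (x.1.1, x.2.1)⟩) ?_ ?_ ?_ ?_ ?_
  · rintro ⟨⟨i, j⟩, ⟨a, b⟩⟩ hx
    simp only [Finset.mem_sigma, HasAntidiagonal.mem_antidiagonal] at hx ⊢
    exact ⟨by rw [← hx.1, ← hx.2, add_assoc], trivial⟩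
  · rintro ⟨⟨i, j⟩, ⟨a, b⟩⟩ hx
    simp only [Finset.mem_sigma, HasAntidiagonal.mem_antidiagonal] at hx ⊢
    exact ⟨by rw [← hx.1, ← hx.2, add_assoc], trivial⟩
  · rintro ⟨⟨i, j⟩, ⟨a, b⟩⟩ hx
    simp only [Finset.mem_sigma, HasAntidiagonal.mem_antidiagonal] at hx
    obtain ⟨-, rfl⟩ := hx
    rfl
  · rintro ⟨⟨i, j⟩, ⟨a, b⟩⟩ hx
    simp only [Finset.mem_sigma, HasAntidiagonal.mem_antidiagonal] at hx
    obtain ⟨-, rfl⟩ := hx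
    rfl
  · rintro ⟨⟨i, j⟩, ⟨a, b⟩⟩ hx
    simp only [Finset.mem_sigma, HasAntidiagonal.mem_antidiagonal] at hx
    obtain ⟨-, rfl⟩ := hx
    simp only [monSign_add_left, monSign_add_right]
    congr 2
    ring

noncomputable instance : Ring (Functions k deg) where
  __ := (inferInstance : AddCommGroup (Functions k deg))
  mul := (· * ·)
  one := 1
  mul_assoc := Functions.mul_assoc'
  one_mul f := by
    refine Functions.ext' fun m hm => ?_
    rw [coeff_mul _ _ hm, Finset.sum_eq_single (0, m)]
    · simp [coeff_one, monSign]
    · rintro ⟨a, b⟩ hab hne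
      have : a ≠ 0 := by
        rintro rfl
        apply hne
        simpa using HasAntidiagonal.mem_antidiagonal.1 hab
      simp [coeff_one, this]
    · simp
  mul_one f := by
    refine Functions.ext' fun m hm => ?_
    rw [coeff_mul _ _ hm, Finset.sum_eq_single (m, 0)]
    · simp [coeff_one, monSign]
    · rintro ⟨a, b⟩ hab hne
      have : b ≠ 0 := by
        rintro rfl
        apply hne
        simpa using HasAntidiagonal.mem_antidiagonal.1 hab
      simp [coeff_one, this]
    · simp
  zero_mul f := Functions.ext' fun m hm => by simp [coeff_mul _ _ hm, coeff_zero]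
  mul_zero f := Functions.ext' fun m hm => by simp [coeff_mul _ _ hm, coeff_zero]
  left_distrib f g h := Functions.ext' fun m hm => by
    simp only [coeff_mul _ _ hm, coeff_add, mul_add, smul_add, Finset.sum_add_distrib]
  right_distrib f g h := Functions.ext' fun m hm => by
    simp only [coeff_mul _ _ hm, coeff_add, add_mul, smul_add, Finset.sum_add_distrib]

open Classical in
/-- The left partial derivative `∂/∂t^α`. -/
noncomputable def partialDeriv (α : ι) (f : Functions k deg) : Functions k deg :=
  ⟨fun m => if IsMon deg m then
      Int.negOnePow (deg α * ∑ β with β < α, m β * deg β) •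
        ((m α + 1 : k) * coeff f (m + Finsupp.single α 1))
      else 0, by
    refine ⟨fun m hm => if_neg hm,
      (Set.Finite.image (fun d => d - monDeg deg (Finsupp.single α 1)) f.2.2).subset ?_⟩
    rintro d ⟨m, hm, rfl⟩
    rw [ne_eq, ite_eq_right_iff, Classical.not_imp] at hm
    refine ⟨_, ⟨m + Finsupp.single α 1, fun h0 => hm.2 ?_, rfl⟩, ?_⟩
    · change _ • (_ * f.1 _) = (0 : k)
      rw [h0, mul_zero, smul_zero]
    · simp [monDeg_add]⟩

/-! ### Vector fields on the formal graded manifold `V[2]` -/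

/-- A vector field `∑ X^α ∂/∂t^α`, given by its components: the tangent sheaf of the formal
manifold is the free (left) module over the functions with basis `∂/∂t^α`. -/
abbrev VectorField (k : Type*) [Field k] (deg : ι → ℤ) : Type _ := ι → Functions k deg

/-- The vector fields of degree `d`, where `∂/∂t^α` has degree `deg α - 2`. -/
def vectorFieldsOfDegree (k : Type*) [Field k] (deg : ι → ℤ) (d : ℤ) :
    Submodule k (VectorField k deg) :=
  Submodule.pi Set.univ fun α => functionsOfDegree k deg (d - (deg α - 2))

/-- The coordinate vector field `∂/∂t^α`. -/
noncomputable def coordField (k : Type*) [Field k] (deg : ι → ℤ) (α : ι) : VectorField k deg :=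
  Pi.single α 1

/-- The derivative `X f` of the function `f` along the vector field `X`. -/
noncomputable def VectorField.act (X : VectorField k deg) (f : Functions k deg) :
    Functions k deg :=
  ∑ α, X α * partialDeriv α f

/-- The graded commutator `[X, Y] = X Y - (-1) ^ (p q) Y X` of vector fields `X` of degree `p` and
`Y` of degree `q`. -/
noncomputable def bracket (p q : ℤ) (X Y : VectorField k deg) : VectorField k deg :=
  fun α => X.act (Y α) - Int.negOnePow (p * q) • Y.act (X α)

/-- A geometric `A_∞`-structure on the pointed formal manifold `(V[2], 0)`: a homological vector
field `Q` vanishing at the distinguished point, and an `A_∞`-structure on the vector fields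
whose unary operation is the Lie derivative along `Q` and whose higher operations are
tensors, i.e. multilinear over the functions. The `A_∞`-structure lives on `T[-2]`, in which
`∂/∂t^α` has the degree `deg α` of `e_α`. -/
@[ext]
structure GeometricAInfinityStructure (k : Type*) [Field k] (deg : ι → ℤ) extends
    AInfinityStructure (fun d : ℤ => vectorFieldsOfDegree k deg (d - 2)) where
  Q : VectorField k deg
  Q_mem : Q ∈ vectorFieldsOfDegree k deg 1
  Q_homological : bracket 1 1 Q Q = 0
  Q_origin : ∀ α, coeff (Q α) 0 = 0
  μ_one : ∀ (d : ℤ) (X : VectorField k deg), X ∈ vectorFieldsOfDegree k deg d →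
    μ 1 (fun _ => X) = bracket 1 d Q X
  μ_tensor : ∀ (n : ℕ) (X : Fin n → VectorField k deg) (d : Fin n → ℤ) (f : Functions k deg)
    (p : ℤ), 2 ≤ n → (∀ i, X i ∈ vectorFieldsOfDegree k deg (d i)) →
    f ∈ functionsOfDegree k deg p → ∀ i,
      μ n (Function.update X i (f • X i)) =
        Int.negOnePow (p * (2 - n + ∑ j with j < i, d j)) • f • μ n X

/-! ### The Taylor series of a `Gerst_∞`-structure -/

/-- The monomial `t^{β_1} ⋯ t^{β_n}`. -/
noncomputable def coordProd (k : Type*) [Field k] (deg : ι → ℤ) {n : ℕ} (β : Fin n → ι) :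
    Functions k deg :=
  (List.ofFn fun i => coord k deg (β i)).prod

/-- The exponent of the sign in
`F(t^{β_1} e_{β_1}, …, t^{β_n} e_{β_n}) = ± t^{β_1} ⋯ t^{β_n} F(e_{β_1}, …, e_{β_n})` if the
coordinates have to pass, besides the basis vectors, an operator of degree `r` in front. -/
def pullSign (deg : ι → ℤ) {n : ℕ} (r : ℤ) (β : Fin n → ι) : ℤ :=
  r * ∑ i, deg (β i) + ∑ i, ∑ j with j < i, deg (β i) * deg (β j)

variable {V : Type*} [AddCommGroup V] [Module k V] {𝒱 : ℤ → Submodule k V}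

/-- The vector field `(1 / n!) ν_n(t, …, t)`, where `t = ∑ t^α e_α` and `e_α` is
identified with `∂/∂t^α`. -/
noncomputable def GerstInfinityStructure.fieldTerm (G : GerstInfinityStructure 𝒱)
    (e : Module.Basis ι k V) (deg : ι → ℤ) (n : ℕ) : VectorField k deg := fun α =>
  (n.factorial : k)⁻¹ • ∑ β : Fin n → ι, Int.negOnePow (pullSign deg (3 - 2 * n) β) •
    e.repr (G.ν n fun i => e (β i)) α • coordProd k deg β

/-- The vector field `(1 / p!) μ_{n;p}(e_{a_1}, …, e_{a_n}; t, …, t)`, where `t = ∑ t^α e_α`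
and `e_α` is identified with `∂/∂t^α`. -/
noncomputable def GerstInfinityStructure.tensorTerm (G : GerstInfinityStructure 𝒱)
    (e : Module.Basis ι k V) (deg : ι → ℤ) (n : ℕ) (a : Fin n → ι) (p : ℕ) :
    VectorField k deg := fun α =>
  (p.factorial : k)⁻¹ • ∑ β : Fin p → ι,
    Int.negOnePow (pullSign deg (2 - n - 2 * p + ∑ i, deg (a i)) β) •
      e.repr (G.μ n p (Sum.elim (fun i => e (a i)) fun i => e (β i))) α • coordProd k deg β

/-- `X` is the sum of the formal series `∑ Y_n` of vector fields in which the components of `Y_n` are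
homogeneous polynomials of order `n` in the coordinates. -/
def IsTaylorSum (X : VectorField k deg) (Y : ℕ → VectorField k deg) : Prop :=
  ∀ (α : ι) (m : ι →₀ ℕ), coeff (X α) m = coeff (∑ n ∈ range (m.degree + 1), Y n α) m

end Functions

end GerstInf

namespace GerstInf

set_option linter.unusedSectionVars false

open Finset

/-! Both kinds of structure are the same data, related by Taylor expansion at the origin. In
characteristic 0 a homogeneous vector field on `V[2]` amounts to a sequence of graded symmetric
multilinear maps on `V` of the right degrees (`VectorField.ext_taylor`, `exists_taylor_eq`). For `Q`
these maps are the ν_n, and for the fields μ_n(∂_{α_1}, …, ∂_{α_n}) they are the μ_{n;p}. A tensor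
is determined by its values on coordinate fields, which can be prescribed freely in the right
degrees (`μ_ext_coordField`, `tensorExt`), and μ_1 is determined by `Q`. So the data correspond, and
the quadratic identities remain to be matched.

The Leibniz rule for iterated derivatives (`iterDeriv_mul`) distributes b_1, …, b_N over the two
factors of a product: this is the sum over S ⊔ Sᶜ with its unshuffle sign. Evaluated at the origin,
it expresses the Taylor coefficients of Y(Z^α), and of a tensor with a field inserted, by inserting
Taylor coefficients into each other (`taylor_act`, `taylor_μ_update`). Hence the Taylor coefficients
of [Q, Q] = 2 Q∘Q are, up to the factor -2, the sums in the ν-identities. For n ≥ 2 those of the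
Stasheff sum on constant fields are the difference of the two sides of the mixed identities
(`taylor_stasheffSum`).

A geometric structure therefore yields a `Gerst_∞`-structure at once. Conversely, the Stasheff
identities must hold on all fields, not only on constant ones. For n = 1 the identity is [Q, [Q, X]]
= 0, a consequence of [Q, Q] = 0. For n ≥ 2 the Stasheff sum is itself a tensor
(`stasheffSum_smul`): pulling f out of the outer Lie derivative and out of the inner one produces
the same Q(f)-term with opposite signs. So it vanishes as soon as it vanishes on coordinate fields
(`eq_zero_of_coordField`). -/

/-- The sign `(-1) ^ n` in the field `k`. -/
def sgn (k : Type*) [Field k] (n : ℤ) : k := ((Int.negOnePow n : ℤˣ) : ℤ)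

/-! ### Signs as scalars -/

section Sign

variable {k : Type*} [Field k]

theorem negOnePow_smul {M : Type*} [AddCommGroup M] [Module k M] (n : ℤ) (x : M) :
    Int.negOnePow n • x = sgn k n • x := by
  rw [Units.smul_def, sgn, Int.cast_smul_eq_zsmul]

theorem sgn_add (a b : ℤ) : sgn k (a + b) = sgn k a * sgn k b := by
  simp [sgn, Int.negOnePow_add]

@[simp] theorem sgn_zero : sgn k 0 = 1 := by simp [sgn]

theorem sgn_one : sgn k 1 = -1 := by simp [sgn]

/-- Sign comparisons are reduced by this to identities of exponents in `ZMod 2`, which `ring`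
settles or, once the atoms are generalized, `decide`. -/
theorem sgn_congr {a b : ℤ} (h : (a : ZMod 2) = b) : sgn k a = sgn k b := by
  have h2 : a ≡ b [ZMOD 2] := (ZMod.intCast_eq_intCast_iff a b 2).1 h
  have : Even (a - b) := by
    rw [Int.even_iff]
    have := h2
    unfold Int.ModEq at this
    omega
  rw [sgn, sgn, (Int.negOnePow_eq_iff a b).2 this]

theorem sgn_eq_neg {a b : ℤ} (h : (a : ZMod 2) = b + 1) : sgn k a = -sgn k b := by
  rw [sgn_congr (b := b + 1) (by simpa using h), sgn_add, sgn_one, mul_neg_one]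

theorem sgn_mul_self (a : ℤ) : sgn k a * sgn k a = 1 := by
  rw [← sgn_add, sgn_congr (b := 0), sgn_zero]
  push_cast
  generalize (a : ZMod 2) = x
  revert x
  decide

theorem sgn_ne_zero (a : ℤ) : sgn k a ≠ 0 := fun h => by
  have := sgn_mul_self (k := k) a
  simp [h] at this

end Sign

/-! ### Graded calculus of functions: twists, commutativity, partial derivatives -/

section Functions

variable {ι : Type*} {k : Type*} [Field k] {deg : ι → ℤ} [Fintype ι]

theorem coeff_of_not_isMon (f : Functions k deg) {m : ι →₀ ℕ} (h : ¬ IsMon deg m) :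
    coeff f m = 0 := f.2.1 m h

theorem coeff_sum {κ : Type*} (s : Finset κ) (f : κ → Functions k deg) (m : ι →₀ ℕ) :
    coeff (∑ i ∈ s, f i) m = ∑ i ∈ s, coeff (f i) m := by
  classical
  induction s using Finset.induction_on with
  | empty => rfl
  | insert i s hi ih => rw [sum_insert hi, sum_insert hi, coeff_add, ih]

theorem monDeg_single (α : ι) : monDeg deg (Finsupp.single α 1) = 2 - deg α := by
  classical
  simp [monDeg, Finsupp.single_apply]

/-- The twist `f ↦ (-1) ^ (r |f|) f` of a function. -/
def twist (k : Type*) [Field k] (deg : ι → ℤ) (r : ℤ) : Functions k deg →ₗ[k] Functions k deg where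
  toFun f := ⟨fun m => sgn k (r * monDeg deg m) * coeff f m, by
    refine ⟨fun m hm => (congrArg _ (coeff_of_not_isMon f hm)).trans (mul_zero _), f.2.2.subset ?_⟩
    rintro d ⟨m, hm, rfl⟩
    exact ⟨m, right_ne_zero_of_mul hm, rfl⟩⟩
  map_add' f g := Functions.ext' fun m _ => mul_add _ _ _
  map_smul' c f := Functions.ext' fun m _ => mul_left_comm _ _ _

theorem coeff_twist (r : ℤ) (f : Functions k deg) (m : ι →₀ ℕ) :
    coeff (twist k deg r f) m = sgn k (r * monDeg deg m) * coeff f m := rfl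

theorem twist_of_mem {p : ℤ} {f : Functions k deg} (hf : f ∈ functionsOfDegree k deg p) (r : ℤ) :
    twist k deg r f = sgn k (r * p) • f := by
  refine Functions.ext' fun m _ => ?_
  rw [coeff_twist, coeff_smul]
  by_cases h : coeff f m = 0
  · simp [h]
  · rw [hf m h]

variable [LinearOrder ι]

theorem smul_mul' (c : k) (f g : Functions k deg) : (c • f) * g = c • (f * g) := by
  refine Functions.ext' fun m hm => ?_
  simp only [coeff_smul, coeff_mul _ _ hm, mul_sum, negOnePow_smul (k := k), smul_eq_mul]
  exact sum_congr rfl fun p _ => by ring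

theorem mul_smul' (c : k) (f g : Functions k deg) : f * (c • g) = c • (f * g) := by
  refine Functions.ext' fun m hm => ?_
  simp only [coeff_smul, coeff_mul _ _ hm, mul_sum, negOnePow_smul (k := k), smul_eq_mul]
  exact sum_congr rfl fun p _ => by ring

instance : SMulCommClass k (Functions k deg) (Functions k deg) :=
  ⟨fun c f g => (mul_smul' c f g).symm⟩

theorem coeff_zero_mul (f g : Functions k deg) :
    coeff (f * g) 0 = coeff f 0 * coeff g 0 := by
  rw [coeff_mul _ _ (fun α _ => Nat.zero_le _)]
  simp [monSign]

theorem mul_mem_functionsOfDegree {p q : ℤ} {f g : Functions k deg}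
    (hf : f ∈ functionsOfDegree k deg p) (hg : g ∈ functionsOfDegree k deg q) :
    f * g ∈ functionsOfDegree k deg (p + q) := by
  intro m hm
  by_cases h : IsMon deg m
  · rw [coeff_mul _ _ h] at hm
    obtain ⟨x, hx, hne⟩ := exists_ne_zero_of_sum_ne_zero hm
    have h0 : coeff f x.1 * coeff g x.2 ≠ 0 := fun h0 => hne (by rw [h0, smul_zero])
    rw [← HasAntidiagonal.mem_antidiagonal.1 hx, monDeg_add, hf _ (left_ne_zero_of_mul h0),
      hg _ (right_ne_zero_of_mul h0)]
  · exact absurd (coeff_of_not_isMon _ h) hm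

theorem one_mem_functionsOfDegree : (1 : Functions k deg) ∈ functionsOfDegree k deg 0 := by
  intro m hm
  rw [coeff_one] at hm
  have : m = 0 := by
    by_contra h
    simp [h] at hm
  simp [this, monDeg]

theorem twist_mul (r : ℤ) (f g : Functions k deg) :
    twist k deg r (f * g) = twist k deg r f * twist k deg r g := by
  refine Functions.ext' fun m hm => ?_
  rw [coeff_twist, coeff_mul _ _ hm, coeff_mul _ _ hm, mul_sum]
  refine sum_congr rfl fun x hx => ?_
  rw [← HasAntidiagonal.mem_antidiagonal.1 hx, monDeg_add, coeff_twist, coeff_twist, mul_add,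
    sgn_add, negOnePow_smul (k := k), negOnePow_smul (k := k), smul_eq_mul, smul_eq_mul]
  ring

theorem twist_one (r : ℤ) : twist k deg r 1 = 1 := by
  rw [twist_of_mem one_mem_functionsOfDegree]
  simp

/-- The product of the two sums splits into the pairs β < α, the pairs α < β and the diagonal. -/
theorem monSign_swap (a b : ι →₀ ℕ) :
    monSign deg a b + monSign deg b a + ∑ α, (a α * deg α) * (b α * deg α) =
      (∑ α, a α * deg α) * (∑ α, b α * deg α) := by
  have h2 : monSign deg b a = ∑ α, ∑ β with α < β, (a α * deg α) * (b β * deg β) := by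
    simp only [monSign, sum_filter]
    rw [sum_comm]
    refine sum_congr rfl fun α _ => sum_congr rfl fun β _ => ?_
    split_ifs <;> ring
  rw [h2, monSign, ← sum_add_distrib, ← sum_add_distrib, sum_mul]
  refine sum_congr rfl fun α _ => ?_
  rw [mul_sum]
  have : ∀ β, (a α * deg α) * (b β * deg β) =
      (if β < α then (a α * deg α) * (b β * deg β) else 0) +
      (if α < β then (a α * deg α) * (b β * deg β) else 0) +
      (if α = β then (a α * deg α) * (b β * deg β) else 0) := by
    intro β
    rcases lt_trichotomy α β with h | h | h
    · simp [h, h.not_gt, h.ne]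
    · simp [h]
    · simp [h, h.not_gt, h.ne']
  refine Eq.trans ?_ (sum_congr rfl fun β _ => (this β).symm)
  rw [sum_add_distrib, sum_add_distrib, sum_filter, sum_filter]
  simp

theorem monDeg_cast (m : ι →₀ ℕ) :
    (monDeg deg m : ZMod 2) = ((∑ α, m α * deg α : ℤ) : ZMod 2) := by
  simp only [monDeg]
  push_cast
  refine sum_congr rfl fun α _ => ?_
  have : (2 : ZMod 2) = 0 := rfl
  rw [this]
  generalize (m α : ZMod 2) = x
  generalize (deg α : ZMod 2) = y
  revert x y
  decide

/-- An odd coordinate occurs in at most one factor of a nonzero product, so the diagonal in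
`monSign_swap` does not affect the sign of an exchange. -/
theorem IsMon.mul_deg_eq_zero {a b : ι →₀ ℕ} (h : IsMon deg (a + b)) (α : ι) :
    (((a α * deg α) * (b α * deg α) : ℤ) : ZMod 2) = 0 := by
  by_cases ho : Odd (deg α)
  · have := h α ho
    rw [Finsupp.add_apply] at this
    have h' : a α = 0 ∨ b α = 0 := by omega
    rcases h' with h' | h' <;> simp [h']
  · rw [Int.not_odd_iff_even] at ho
    have : (deg α : ZMod 2) = 0 := (ZMod.intCast_zmod_eq_zero_iff_dvd _ 2).2 ho.two_dvd
    push_cast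
    simp [this]

theorem sum_antidiagonal_swap_apply (m : ι →₀ ℕ) (F : (ι →₀ ℕ) × (ι →₀ ℕ) → k) :
    ∑ x ∈ HasAntidiagonal.antidiagonal m, F x =
      ∑ x ∈ HasAntidiagonal.antidiagonal m, F (x.2, x.1) := by
  refine sum_nbij' Prod.swap Prod.swap ?_ ?_ ?_ ?_ ?_ <;> intro x hx
  · simpa [HasAntidiagonal.mem_antidiagonal, add_comm] using hx
  · simpa [HasAntidiagonal.mem_antidiagonal, add_comm] using hx
  · rfl
  · rfl
  · rfl

theorem mul_comm_graded {p q : ℤ} {f g : Functions k deg} (hf : f ∈ functionsOfDegree k deg p)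
    (hg : g ∈ functionsOfDegree k deg q) : f * g = sgn k (p * q) • (g * f) := by
  refine Functions.ext' fun m hm => ?_
  rw [coeff_smul, coeff_mul _ _ hm, coeff_mul _ _ hm, mul_sum,
    sum_antidiagonal_swap_apply]
  refine sum_congr rfl fun x hx => ?_
  simp only [ negOnePow_smul (k := k), smul_eq_mul]
  by_cases h1 : coeff f x.2 = 0
  · simp [h1]
  by_cases h2 : coeff g x.1 = 0
  · simp [h2]
  rw [← hf _ h1, ← hg _ h2, mul_comm (coeff f _), ← mul_assoc (sgn k (_ * _)), ← sgn_add]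
  congr 1
  apply sgn_congr
  have hs := congrArg (Int.cast (R := ZMod 2)) (monSign_swap (deg := deg) x.1 x.2)
  rw [← HasAntidiagonal.mem_antidiagonal.1 hx] at hm
  have h0 : ((∑ α, (x.1 α * deg α) * (x.2 α * deg α) : ℤ) : ZMod 2) = 0 := by
    rw [Int.cast_sum]
    exact sum_eq_zero fun α _ => hm.mul_deg_eq_zero α
  rw [Int.cast_add, h0, Int.cast_mul, ← monDeg_cast, ← monDeg_cast] at hs
  push_cast at hs ⊢
  generalize (monDeg deg x.1 : ZMod 2) = u at *
  generalize (monDeg deg x.2 : ZMod 2) = v at *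
  generalize (monSign deg x.1 x.2 : ZMod 2) = w at *
  generalize (monSign deg x.2 x.1 : ZMod 2) = z at *
  clear * - hs
  revert u v w z
  decide

theorem coeff_partialDeriv (α : ι) (f : Functions k deg) (m : ι →₀ ℕ) :
    coeff (partialDeriv α f) m = sgn k (deg α * ∑ β with β < α, m β * deg β) *
      ((m α + 1 : k) * coeff f (m + Finsupp.single α 1)) := by
  by_cases hm : IsMon deg m
  · exact (if_pos hm).trans (negOnePow_smul (k := k) _ _)
  · rw [coeff_of_not_isMon _ hm, coeff_of_not_isMon f fun h => hm h.of_add.1, mul_zero, mul_zero]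

/-- The partial derivative as a linear map. -/
noncomputable def partialHom (k : Type*) [Field k] (deg : ι → ℤ) (α : ι) :
    Functions k deg →ₗ[k] Functions k deg where
  toFun := partialDeriv α
  map_add' f g := Functions.ext' fun m _ => by
    simp only [coeff_partialDeriv, coeff_add]
    ring
  map_smul' c f := Functions.ext' fun m _ => by
    simp only [coeff_partialDeriv, coeff_smul, RingHom.id_apply]
    ring

theorem partialHom_apply (α : ι) (f : Functions k deg) :
    partialHom k deg α f = partialDeriv α f := rfl

theorem partialDeriv_one (α : ι) : partialDeriv α (1 : Functions k deg) = 0 := by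
  refine Functions.ext' fun m _ => ?_
  rw [coeff_partialDeriv, coeff_one, if_neg, coeff_zero, mul_zero, mul_zero]
  intro h
  simpa using DFunLike.congr_fun h α

theorem partialDeriv_mem {p : ℤ} {f : Functions k deg} (hf : f ∈ functionsOfDegree k deg p)
    (α : ι) : partialDeriv α f ∈ functionsOfDegree k deg (p + deg α - 2) := by
  intro m hm
  rw [coeff_partialDeriv] at hm
  have := hf _ (right_ne_zero_of_mul (right_ne_zero_of_mul hm))
  rw [monDeg_add, monDeg_single] at this
  omega

theorem partialDeriv_comm (α β : ι) (f : Functions k deg) :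
    partialDeriv α (partialDeriv β f) =
      sgn k (deg α * deg β) • partialDeriv β (partialDeriv α f) := by
  refine Functions.ext' fun m _ => ?_
  simp only [coeff_smul, coeff_partialDeriv]
  rw [add_right_comm m (Finsupp.single β 1)]
  by_cases h : IsMon deg (m + Finsupp.single α 1 + Finsupp.single β 1)
  swap
  · simp [coeff_of_not_isMon f h]
  have e : ∀ γ δ : ι, ∑ x with x < γ, (((m + Finsupp.single δ 1 : ι →₀ ℕ) x : ℕ) : ℤ) * deg x =
      ∑ x with x < γ, (m x : ℤ) * deg x + if δ < γ then deg δ else 0 := by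
    intro γ δ
    simp only [Finsupp.add_apply, Nat.cast_add, add_mul, sum_add_distrib]
    congr 1
    simp [Finsupp.single_apply]
  rw [e, e]
  -- For α = β odd the shifted monomial would contain t^α twice, against `h`; for α = β even there
  -- is no sign. For α ≠ β the derivative along the larger index sees the power of the smaller one
  -- change.
  rcases eq_or_ne α β with rfl | hne
  · by_cases ho : Odd (deg α)
    · have := h α ho
      simp at this
    · have : sgn k (deg α * deg α) = 1 := by
        rw [Int.not_odd_iff_even] at ho
        rw [sgn_congr (b := 0), sgn_zero]
        have : (deg α : ZMod 2) = 0 := (ZMod.intCast_zmod_eq_zero_iff_dvd _ 2).2 ho.two_dvd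
        simp [this]
      rw [this, one_mul]
  · have h1 : (((m + Finsupp.single α 1 : ι →₀ ℕ) β : ℕ) : k) = m β := by simp [hne]
    have h2 : (((m + Finsupp.single β 1 : ι →₀ ℕ) α : ℕ) : k) = m α := by simp [hne.symm]
    rw [h1, h2]
    have hs : sgn k (deg α * ∑ x with x < α, (m x : ℤ) * deg x) *
        sgn k (deg β * (∑ x with x < β, (m x : ℤ) * deg x + if α < β then deg α else 0)) =
        sgn k (deg α * deg β) * (sgn k (deg β * ∑ x with x < β, (m x : ℤ) * deg x) *
        sgn k (deg α * (∑ x with x < α, (m x : ℤ) * deg x + if β < α then deg β else 0))) := by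
      rw [← sgn_add, ← sgn_add, ← sgn_add]
      apply sgn_congr
      rcases hne.lt_or_gt with h | h
      · rw [if_pos h, if_neg h.not_gt]
        push_cast
        ring
      · rw [if_pos h, if_neg h.not_gt]
        push_cast
        generalize (∑ x with x < α, (m x : ZMod 2) * deg x) = u
        generalize (∑ x with x < β, (m x : ZMod 2) * deg x) = v
        generalize (deg α : ZMod 2) = a
        generalize (deg β : ZMod 2) = b
        revert u v a b
        decide
    linear_combination (((m α : k) + 1) * ((m β : k) + 1) *
      coeff f (m + Finsupp.single α 1 + Finsupp.single β 1)) * hs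

/-- The weights in the Leibniz rule. -/
theorem leibniz_weight (α : ι) (f g : Functions k deg) (a b : ι →₀ ℕ) :
    ((a α : k) + sgn k (deg α * (a α * deg α)) * b α) * (coeff f a * coeff g b) =
      if Odd (deg α) ∧ a α + b α = 2 then 0 else
      ((a α + b α : ℕ) : k) * (coeff f a * coeff g b) := by
  by_cases ho : Odd (deg α)
  · by_cases hfa : IsMon deg a
    swap
    · simp [coeff_of_not_isMon f hfa]
    by_cases hgb : IsMon deg b
    swap
    · simp [coeff_of_not_isMon g hgb]
    have h1 := hfa α ho
    have h2 := hgb α ho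
    have hd : (deg α : ZMod 2) = 1 := by
      obtain ⟨x, hx⟩ := ho
      have : (2 : ZMod 2) = 0 := rfl
      rw [hx]
      push_cast
      rw [this]
      ring
    have hs : sgn k (deg α * deg α) = -1 := by
      rw [sgn_congr (b := 1), sgn_one]
      push_cast
      rw [hd]
      decide
    interval_cases a α <;> interval_cases b α <;> simp [ho, hs]
  · rw [if_neg fun h => ho h.1]
    have : (deg α : ZMod 2) = 0 :=
      (ZMod.intCast_zmod_eq_zero_iff_dvd _ 2).2 (Int.not_odd_iff_even.1 ho).two_dvd
    rw [sgn_congr (b := 0) (by push_cast; rw [this]; simp)]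
    push_cast
    simp

/-- The decompositions missed by the shift are those without t^α in the first factor, where `F`
vanishes. In the Leibniz rule `F` carries the exponent of t^α as a weight. -/
theorem sum_antidiagonal_add_single (α : ι) (m : ι →₀ ℕ) (F : (ι →₀ ℕ) × (ι →₀ ℕ) → k)
    (h0 : ∀ x, x.1 α = 0 → F x = 0) :
    ∑ x ∈ HasAntidiagonal.antidiagonal m, F (x.1 + Finsupp.single α 1, x.2) =
      ∑ x ∈ HasAntidiagonal.antidiagonal (m + Finsupp.single α 1), F x := by
  classical
  refine sum_of_injOn (fun x => (x.1 + Finsupp.single α 1, x.2)) ?_ ?_ ?_ ?_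
  · rintro ⟨a, b⟩ _ ⟨a', b'⟩ _ h
    simpa using h
  · rintro ⟨a, b⟩ h
    simp only [mem_coe, HasAntidiagonal.mem_antidiagonal] at h ⊢
    rw [← h]
    abel
  · rintro ⟨a, b⟩ h hn
    refine h0 _ ?_
    by_contra hne
    refine hn ⟨(a - Finsupp.single α 1, b), ?_, ?_⟩
    · rw [HasAntidiagonal.mem_antidiagonal] at h
      simp only [mem_coe, HasAntidiagonal.mem_antidiagonal]
      ext β
      have := DFunLike.congr_fun h β
      simp only [Finsupp.add_apply, Finsupp.tsub_apply, Finsupp.single_apply] at this ⊢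
      split_ifs at this ⊢ with hβ
      · subst hβ
        simp only at hne
        omega
      · omega
    · simp only [Prod.mk.injEq, and_true]
      ext β
      simp only [Finsupp.add_apply, Finsupp.tsub_apply, Finsupp.single_apply]
      split_ifs with hβ
      · subst hβ
        simp only at hne
        omega
      · omega
  · intro _ _
    rfl

/-- Both terms on the right become sums over the decompositions of `m + single α 1`, weighted by the
exponent of t^α in one factor. By `leibniz_weight` the weights add up to the total exponent. -/
theorem partialDeriv_mul (α : ι) (f g : Functions k deg) :
    partialDeriv α (f * g) =
      partialDeriv α f * g + twist k deg (deg α) f * partialDeriv α g := by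
  refine Functions.ext' fun m hm => ?_
  set c : ℤ := deg α * ∑ β with β < α, m β * deg β with hc
  have hms : ∀ x : (ι →₀ ℕ) × (ι →₀ ℕ), monSign deg (x.1 + Finsupp.single α 1) x.2 =
      monSign deg x.1 x.2 + deg α * ∑ β with β < α, x.2 β * deg β := by
    intro x
    rw [monSign_add_left]
    congr 1
    rw [monSign, sum_eq_single α (fun b _ hb => ?_) (by simp), mul_sum]
    · simp
    · simp [hb.symm]
  have hms' : ∀ x : (ι →₀ ℕ) × (ι →₀ ℕ), monSign deg x.1 (x.2 + Finsupp.single α 1) =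
      monSign deg x.1 x.2 + deg α * ∑ β with α < β, x.1 β * deg β := by
    intro x
    rw [monSign_add_right]
    congr 1
    simp only [monSign, sum_filter]
    rw [sum_comm, sum_eq_single α (fun b _ hb => ?_) (by simp), mul_sum]
    · refine sum_congr rfl fun β _ => ?_
      split_ifs <;> simp [mul_comm]
    · simp [hb.symm]
  have h1 : coeff (partialDeriv α f * g) m = ∑ x ∈ HasAntidiagonal.antidiagonal m,
      (fun y : (ι →₀ ℕ) × (ι →₀ ℕ) => sgn k (c + monSign deg y.1 y.2) *
        ((y.1 α : k) * (coeff f y.1 * coeff g y.2))) (x.1 + Finsupp.single α 1, x.2) := by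
    rw [coeff_mul _ _ hm]
    refine sum_congr rfl fun x hx => ?_
    rw [← HasAntidiagonal.mem_antidiagonal.1 hx] at hc
    have : sgn k (c + monSign deg (x.1 + Finsupp.single α 1) x.2) =
        sgn k (monSign deg x.1 x.2) * sgn k (deg α * ∑ β with β < α, x.1 β * deg β) := by
      rw [hms, ← sgn_add, hc]
      apply sgn_congr
      simp only [Finsupp.add_apply, Nat.cast_add, add_mul, sum_add_distrib]
      push_cast
      generalize (∑ β with β < α, (x.1 β : ZMod 2) * deg β) = u
      generalize (∑ β with β < α, (x.2 β : ZMod 2) * deg β) = v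
      generalize (monSign deg x.1 x.2 : ZMod 2) = w
      generalize (deg α : ZMod 2) = a
      revert u v w a
      decide
    simp only [this, coeff_partialDeriv, negOnePow_smul (k := k), smul_eq_mul, Finsupp.add_apply,
      Finsupp.single_eq_same, Nat.cast_add, Nat.cast_one]
    ring
  have h2 : coeff (twist k deg (deg α) f * partialDeriv α g) m =
      ∑ x ∈ HasAntidiagonal.antidiagonal m,
      (fun y : (ι →₀ ℕ) × (ι →₀ ℕ) => sgn k (c + monSign deg y.2 y.1) *
        (sgn k (deg α * (y.2 α * deg α)) * (y.1 α : k) * (coeff f y.2 * coeff g y.1)))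
          (x.1 + Finsupp.single α 1, x.2) := by
    rw [coeff_mul _ _ hm, sum_antidiagonal_swap_apply]
    refine sum_congr rfl fun x hx => ?_
    rw [← HasAntidiagonal.mem_antidiagonal.1 hx] at hc
    have : sgn k (c + monSign deg x.2 (x.1 + Finsupp.single α 1)) *
          sgn k (deg α * (x.2 α * deg α)) =
        sgn k (monSign deg x.2 x.1) * sgn k (deg α * ∑ β with β < α, x.1 β * deg β) *
          sgn k (deg α * monDeg deg x.2) := by
      have hm2 : (monDeg deg x.2 : ZMod 2) =
          ((∑ β with β < α, x.2 β * deg β + ∑ β with α < β, x.2 β * deg β +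
            x.2 α * deg α : ℤ) : ZMod 2) := by
        rw [monDeg_cast]
        congr 1
        have h3 : ∀ β, (x.2 β * deg β : ℤ) = (if β < α then (x.2 β * deg β : ℤ) else 0) +
            (if α < β then (x.2 β * deg β : ℤ) else 0) +
            (if α = β then (x.2 β * deg β : ℤ) else 0) := by
          intro β
          rcases lt_trichotomy α β with h | h | h
          · simp [h, h.not_gt, h.ne]
          · simp [h]
          · simp [h, h.not_gt, h.ne']
        refine (sum_congr rfl fun β _ => h3 β).trans ?_
        rw [sum_add_distrib, sum_add_distrib, sum_filter, sum_filter]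
        simp
      rw [hms' (x.2, x.1), ← sgn_add, ← sgn_add, ← sgn_add, hc]
      apply sgn_congr
      simp only [Finsupp.add_apply, Nat.cast_add, add_mul, sum_add_distrib]
      push_cast at hm2 ⊢
      rw [hm2]
      generalize (∑ β with β < α, (x.1 β : ZMod 2) * deg β) = u
      generalize (∑ β with β < α, (x.2 β : ZMod 2) * deg β) = v
      generalize (∑ β with α < β, (x.2 β : ZMod 2) * deg β) = z
      generalize (monSign deg x.2 x.1 : ZMod 2) = w
      generalize (deg α : ZMod 2) = a
      generalize (x.2 α : ZMod 2) = b
      ring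
    simp only [coeff_partialDeriv, coeff_twist, negOnePow_smul (k := k),
      smul_eq_mul, Finsupp.add_apply, Finsupp.single_eq_same, Nat.cast_add, Nat.cast_one]
    linear_combination (-((x.1 α : k) + 1) * (coeff f x.2 *
      coeff g (x.1 + Finsupp.single α 1))) * this
  replace h1 := h1.trans (sum_antidiagonal_add_single α m
    (fun y => sgn k (c + monSign deg y.1 y.2) * ((y.1 α : k) * (coeff f y.1 * coeff g y.2)))
    (by intro x hx; simp [hx]))
  replace h2 := h2.trans (sum_antidiagonal_add_single α m
    (fun y => sgn k (c + monSign deg y.2 y.1) *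
      (sgn k (deg α * (y.2 α * deg α)) * (y.1 α : k) * (coeff f y.2 * coeff g y.1)))
    (by intro x hx; simp [hx]))
  rw [sum_antidiagonal_swap_apply] at h2
  rw [coeff_add, h1, h2, ← sum_add_distrib, coeff_partialDeriv, ← hc]
  have h3 : ∀ x ∈ HasAntidiagonal.antidiagonal (m + Finsupp.single α 1),
      sgn k (c + monSign deg x.1 x.2) * ((x.1 α : k) * (coeff f x.1 * coeff g x.2)) +
      sgn k (c + monSign deg x.1 x.2) *
        (sgn k (deg α * (x.1 α * deg α)) * (x.2 α : k) * (coeff f x.1 * coeff g x.2)) =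
      if Odd (deg α) ∧ m α = 1 then 0 else
      sgn k (c + monSign deg x.1 x.2) * ((m α + 1 : k) * (coeff f x.1 * coeff g x.2)) := by
    intro x hx
    have hw := leibniz_weight α f g x.1 x.2
    have hx' : x.1 α + x.2 α = m α + 1 := by
      have := DFunLike.congr_fun (HasAntidiagonal.mem_antidiagonal.1 hx) α
      simpa using this
    rw [hx'] at hw
    simp only [Nat.reduceEqDiff] at hw
    split_ifs at hw ⊢ with h
    · linear_combination sgn k (c + monSign deg x.1 x.2) * hw
    · push_cast at hw
      linear_combination sgn k (c + monSign deg x.1 x.2) * hw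
  rw [sum_congr rfl h3]
  -- In this case t^m t^α = 0: the left side vanishes, and on the right the two odd contributions
  -- have cancelled.
  by_cases h : Odd (deg α) ∧ m α = 1
  · simp only [h, and_self, if_true, sum_const_zero]
    rw [coeff_of_not_isMon _ fun h' => ?_, mul_zero, mul_zero]
    have := h' α h.1
    simp [h.2] at this
  · simp only [h, if_false]
    by_cases hm' : IsMon deg (m + Finsupp.single α 1)
    · rw [coeff_mul _ _ hm', mul_sum, mul_sum]
      refine sum_congr rfl fun x _ => ?_
      rw [negOnePow_smul (k := k), smul_eq_mul, sgn_add]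
      ring
    · exfalso
      apply hm'
      intro β hβ
      have := hm β hβ
      rcases eq_or_ne α β with rfl | hne
      · rw [not_and] at h
        have := h hβ
        simp
        omega
      · simpa [Finsupp.single_apply, hne] using this

end Functions

/-! ### Subsets of `Fin (N + 1)` -/

section Subsets

variable {N : ℕ}

theorem sum_finset_fin_succ {M : Type*} [AddCommMonoid M] (F : Finset (Fin (N + 1)) → M) :
    ∑ S, F S = ∑ S : Finset (Fin N), F (insert 0 (S.map (Fin.succEmb N))) +
      ∑ S : Finset (Fin N), F (S.map (Fin.succEmb N)) := by
  classical
  rw [← sum_filter_add_sum_filter_not univ (fun S : Finset (Fin (N + 1)) => 0 ∈ S)]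
  congr 1
  · refine sum_nbij' (fun S => univ.filter fun i => i.succ ∈ S)
      (fun S => insert 0 (S.map (Fin.succEmb N))) ?_ ?_ ?_ ?_ ?_
    · simp
    · simp
    · intro S hS
      ext i
      refine Fin.cases ?_ (fun i => ?_) i
      · simpa using hS
      · simp
    · intro S _
      ext i
      simp
    · intro S hS
      congr 1
      ext i
      refine Fin.cases ?_ (fun i => ?_) i
      · simpa using hS
      · simp
  · refine sum_nbij' (fun S => univ.filter fun i => i.succ ∈ S)
      (fun S => S.map (Fin.succEmb N)) ?_ ?_ ?_ ?_ ?_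
    · simp
    · simp
    · intro S hS
      ext i
      refine Fin.cases ?_ (fun i => ?_) i
      · simpa using hS
      · simp
    · intro S _
      ext i
      simp
    · intro S hS
      congr 1
      ext i
      refine Fin.cases ?_ (fun i => ?_) i
      · simpa using hS
      · simp

theorem compl_map_succ (S : Finset (Fin N)) :
    (S.map (Fin.succEmb N))ᶜ = insert 0 (Sᶜ.map (Fin.succEmb N)) := by
  ext i
  refine Fin.cases ?_ (fun i => ?_) i <;> simp

theorem compl_insert_map_succ (S : Finset (Fin N)) :
    (insert 0 (S.map (Fin.succEmb N)))ᶜ = Sᶜ.map (Fin.succEmb N) := by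
  ext i
  refine Fin.cases ?_ (fun i => ?_) i <;> simp

/-- The type of `sub b S` depends on `S.card`. Passing to lists allows subfamilies with different
index types to be compared. -/
theorem ofFn_sub {A : Type*} (b : Fin N → A) (S : Finset (Fin N)) :
    List.ofFn (sub b S) = S.sort.map b := by
  rw [← listMap_orderEmbOfFin_finRange S rfl, List.map_map, List.ofFn_eq_map]
  rfl

theorem ofFn_sub_map_succ {A : Type*} (b : Fin (N + 1) → A) (S : Finset (Fin N)) :
    List.ofFn (sub b (S.map (Fin.succEmb N))) = List.ofFn (sub (Fin.tail b) S) := by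
  rw [ofFn_sub, ofFn_sub, ← (Fin.strictMono_succ.strictMonoOn _).map_finsetSort, List.map_map]
  · rfl

theorem ofFn_sub_insert {A : Type*} (b : Fin (N + 1) → A) (S : Finset (Fin N)) :
    List.ofFn (sub b (insert 0 (S.map (Fin.succEmb N)))) =
      b 0 :: List.ofFn (sub (Fin.tail b) S) := by
  rw [← ofFn_sub_map_succ, ofFn_sub, ofFn_sub, sort_insert, List.map_cons]
  · exact fun _ _ => Fin.zero_le _
  · simp

theorem sum_sub {M : Type*} [AddCommMonoid M] (d : Fin N → M) (S : Finset (Fin N)) :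
    ∑ i, sub d S i = ∑ i ∈ S, d i := by
  conv_rhs => rw [← map_orderEmbOfFin_univ S rfl, sum_map]
  rfl

theorem sum_map_succ (d : Fin (N + 1) → ℤ) (S : Finset (Fin N)) :
    ∑ i ∈ S.map (Fin.succEmb N), d i = ∑ i ∈ S, Fin.tail d i := by
  rw [sum_map]
  rfl

theorem sum_insert_map_succ (d : Fin (N + 1) → ℤ) (S : Finset (Fin N)) :
    ∑ i ∈ insert 0 (S.map (Fin.succEmb N)), d i = d 0 + ∑ i ∈ S, Fin.tail d i := by
  rw [sum_insert (by simp), sum_map_succ]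

theorem unshuffle_insert (d : Fin (N + 1) → ℤ) (S : Finset (Fin N)) :
    unshuffle d (insert 0 (S.map (Fin.succEmb N))) = unshuffle (Fin.tail d) S := by
  rw [unshuffle, compl_insert_map_succ, sum_insert (by simp), sum_map]
  simp only [Fin.not_lt_zero, filter_false, sum_empty, zero_add]
  refine sum_congr rfl fun i _ => ?_
  rw [sum_filter, sum_map, sum_filter]
  refine sum_congr rfl fun j _ => ?_
  simp [Fin.tail]

/-- Here 0 lies in the complement, so every member of b_S has to pass b_0. -/
theorem unshuffle_map_succ (d : Fin (N + 1) → ℤ) (S : Finset (Fin N)) :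
    unshuffle d (S.map (Fin.succEmb N)) =
      unshuffle (Fin.tail d) S + d 0 * ∑ i ∈ S, Fin.tail d i := by
  rw [unshuffle, compl_map_succ, sum_map, mul_sum, unshuffle, ← sum_add_distrib]
  refine sum_congr rfl fun i _ => ?_
  rw [sum_filter, sum_insert (by simp), sum_map, sum_filter, add_comm]
  congr 1
  · refine sum_congr rfl fun j _ => ?_
    simp [Fin.tail]
  · simp [Fin.tail, mul_comm]

end Subsets

/-! ### Derivatives along vectors -/

section Derivatives

variable {ι k V : Type*} [Field k] [AddCommGroup V] [Module k V] [Fintype ι] [LinearOrder ι]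
  {𝒱 : ℤ → Submodule k V} [DirectSum.Decomposition 𝒱] (e : Module.Basis ι k V) (deg : ι → ℤ)

-- The component of `v` in degree `deg α` is zero, and it is also the sum of the basis terms of `v`
-- of that degree; the coefficient at `e α` is read off from this.
variable {deg} in
theorem repr_eq_zero_of_mem (he : ∀ α, e α ∈ 𝒱 (deg α)) {d : ℤ} {v : V} (hv : v ∈ 𝒱 d) {α : ι}
    (h : deg α ≠ d) : e.repr v α = 0 := by
  have h1 : ((DirectSum.decompose 𝒱 v (deg α) : 𝒱 (deg α)) : V) = 0 :=
    DirectSum.decompose_of_mem_ne 𝒱 hv h.symm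
  have h2 : ((DirectSum.decompose 𝒱 v (deg α) : 𝒱 (deg α)) : V) =
      ∑ β, e.repr v β • if deg β = deg α then e β else 0 := by
    conv_lhs => rw [← e.sum_repr v]
    rw [DirectSum.decompose_sum, DFinsupp.finsetSum_apply, AddSubmonoidClass.coe_finsetSum]
    refine sum_congr rfl fun β _ => ?_
    rw [DirectSum.decompose_smul, DFinsupp.smul_apply, Submodule.coe_smul]
    split_ifs with hβ
    · rw [← hβ, DirectSum.decompose_of_mem_same 𝒱 (he β)]
    · rw [DirectSum.decompose_of_mem_ne 𝒱 (he β) hβ]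
  have h3 := congrArg (fun w => e.repr w α) (h2.symm.trans h1)
  simp only [map_sum, map_smul, map_zero, Finsupp.coe_finsetSum, Finset.sum_apply, Finsupp.smul_apply,
    smul_eq_mul, Finsupp.coe_zero, Pi.zero_apply] at h3
  rw [sum_eq_single α] at h3
  · simpa using h3
  · intro β _ hβ
    split_ifs
    · simp [hβ.symm]
    · simp
  · simp

variable {deg} in
theorem mem_of_repr (he : ∀ α, e α ∈ 𝒱 (deg α)) {d : ℤ} {v : V}
    (h : ∀ α, e.repr v α ≠ 0 → deg α = d) : v ∈ 𝒱 d := by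
  rw [← e.sum_repr v]
  refine Submodule.sum_mem _ fun α _ => ?_
  by_cases h0 : e.repr v α = 0
  · simp [h0]
  · exact Submodule.smul_mem _ _ (h α h0 ▸ he α)

/-- The derivative of functions along a constant vector. -/
noncomputable def dirDeriv : V →ₗ[k] Module.End k (Functions k deg) :=
  e.constr k fun α => partialHom k deg α

theorem dirDeriv_apply (v : V) (f : Functions k deg) :
    dirDeriv e deg v f = ∑ α, e.repr v α • partialDeriv α f := by
  rw [dirDeriv, Module.Basis.constr_apply_fintype]
  simp [partialHom_apply]

theorem dirDeriv_basis (α : ι) (f : Functions k deg) :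
    dirDeriv e deg (e α) f = partialDeriv α f := by
  rw [dirDeriv, Module.Basis.constr_basis, partialHom_apply]

variable {e deg} (he : ∀ α, e α ∈ 𝒱 (deg α))
include he

theorem dirDeriv_mem {v : V} {d p : ℤ} (hv : v ∈ 𝒱 d) {f : Functions k deg}
    (hf : f ∈ functionsOfDegree k deg p) :
    dirDeriv e deg v f ∈ functionsOfDegree k deg (p + d - 2) := by
  rw [dirDeriv_apply]
  refine Submodule.sum_mem _ fun α _ => ?_
  by_cases h : deg α = d
  · exact Submodule.smul_mem _ _ (h ▸ partialDeriv_mem hf α)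
  · simp [repr_eq_zero_of_mem e he hv h]

theorem dirDeriv_mul {v : V} {d p : ℤ} (hv : v ∈ 𝒱 d) {f : Functions k deg}
    (hf : f ∈ functionsOfDegree k deg p) (g : Functions k deg) :
    dirDeriv e deg v (f * g) =
      dirDeriv e deg v f * g + sgn k (d * p) • (f * dirDeriv e deg v g) := by
  simp only [dirDeriv_apply, sum_mul, mul_sum, smul_sum, ← sum_add_distrib]
  refine sum_congr rfl fun α _ => ?_
  by_cases h : deg α = d
  · rw [partialDeriv_mul, twist_of_mem hf, h, smul_mul', smul_mul', mul_smul', smul_add,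
      smul_comm (sgn k _)]
  · simp [repr_eq_zero_of_mem e he hv h]

theorem dirDeriv_comm {v w : V} {c d : ℤ} (hv : v ∈ 𝒱 c) (hw : w ∈ 𝒱 d) :
    dirDeriv e deg v * dirDeriv e deg w =
      sgn k (c * d) • (dirDeriv e deg w * dirDeriv e deg v) := by
  refine LinearMap.ext fun f => ?_
  rw [Module.End.mul_apply, LinearMap.smul_apply, Module.End.mul_apply]
  rw [dirDeriv_apply e deg v, dirDeriv_apply e deg w f, dirDeriv_apply e deg w,
    dirDeriv_apply e deg v f]
  simp only [← partialHom_apply, map_sum, map_smul, smul_sum]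
  rw [sum_comm]
  refine sum_congr rfl fun β _ => sum_congr rfl fun α _ => ?_
  by_cases h : deg α = c
  swap
  · simp [repr_eq_zero_of_mem e he hv h]
  by_cases h' : deg β = d
  swap
  · simp [repr_eq_zero_of_mem e he hw h']
  rw [partialHom_apply, partialHom_apply, partialDeriv_comm, h, h', smul_smul, smul_smul,
    smul_smul, smul_smul]
  congr 1
  ring

theorem dirDeriv_twist {v : V} {d : ℤ} (hv : v ∈ 𝒱 d) (r : ℤ) (f : Functions k deg) :
    dirDeriv e deg v (twist k deg r f) = sgn k (r * d) • twist k deg r (dirDeriv e deg v f) := by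
  simp only [dirDeriv_apply, map_sum, smul_sum, map_smul]
  refine sum_congr rfl fun α _ => ?_
  by_cases h : deg α = d
  swap
  · simp [repr_eq_zero_of_mem e he hv h]
  rw [smul_comm]
  congr 1
  refine Functions.ext' fun m _ => ?_
  rw [coeff_smul, coeff_twist, coeff_partialDeriv, coeff_partialDeriv, coeff_twist, monDeg_add,
    monDeg_single, h, sgn_congr (a := r * (monDeg deg m + (2 - d))) (b := r * d + r * monDeg deg m),
    sgn_add]
  · ring
  · push_cast
    have : (2 : ZMod 2) = 0 := rfl
    linear_combination (r - r * d : ZMod 2) * this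

end Derivatives

/-! ### Iterated derivatives and their Leibniz rule -/

section IteratedDerivatives

variable {ι k V : Type*} [Field k] [AddCommGroup V] [Module k V] [Fintype ι] [LinearOrder ι]
  {𝒱 : ℤ → Submodule k V} [DirectSum.Decomposition 𝒱] (e : Module.Basis ι k V) (deg : ι → ℤ)

/-- The iterated derivative `∂_{b_1} ⋯ ∂_{b_N}`. -/
noncomputable def iterDeriv (N : ℕ) :
    MultilinearMap k (fun _ : Fin N => V) (Module.End k (Functions k deg)) :=
  (MultilinearMap.mkPiAlgebraFin k N (Module.End k (Functions k deg))).compLinearMap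
    fun _ => dirDeriv e deg

theorem iterDeriv_eq_prod {N : ℕ} (b : Fin N → V) :
    iterDeriv e deg N b = ((List.ofFn b).map (dirDeriv e deg)).prod := by
  rw [iterDeriv, MultilinearMap.compLinearMap_apply, MultilinearMap.mkPiAlgebraFin_apply,
    List.map_ofFn]
  rfl

theorem iterDeriv_zero (b : Fin 0 → V) : iterDeriv e deg 0 b = 1 := by
  simp [iterDeriv_eq_prod]

theorem iterDeriv_succ {N : ℕ} (b : Fin (N + 1) → V) :
    iterDeriv e deg (N + 1) b = dirDeriv e deg (b 0) * iterDeriv e deg N (Fin.tail b) := by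
  rw [iterDeriv_eq_prod, iterDeriv_eq_prod, List.ofFn_succ, List.map_cons, List.prod_cons]
  rfl

theorem iterDeriv_cons {N : ℕ} (v : V) (b : Fin N → V) :
    iterDeriv e deg (N + 1) (Fin.cons v b) = dirDeriv e deg v * iterDeriv e deg N b := by
  rw [iterDeriv_succ, Fin.cons_zero, Fin.tail_cons]

variable {e deg} (he : ∀ α, e α ∈ 𝒱 (deg α))
include he

theorem iterDeriv_mem {N : ℕ} {b : Fin N → V} {d : Fin N → ℤ} (hb : ∀ i, b i ∈ 𝒱 (d i)) {p : ℤ}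
    {f : Functions k deg} (hf : f ∈ functionsOfDegree k deg p) :
    iterDeriv e deg N b f ∈ functionsOfDegree k deg (p + ∑ i, d i - 2 * N) := by
  induction N with
  | zero => simpa [iterDeriv_zero] using hf
  | succ N ih =>
    rw [iterDeriv_succ, Module.End.mul_apply, Fin.sum_univ_succ]
    have := dirDeriv_mem he (hb 0) (ih (b := Fin.tail b) (d := Fin.tail d) fun i => hb i.succ)
    convert this using 2
    simp only [Fin.tail]
    push_cast
    ring

theorem iterDeriv_twist {N : ℕ} {b : Fin N → V} {d : Fin N → ℤ} (hb : ∀ i, b i ∈ 𝒱 (d i)) (r : ℤ)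
    (f : Functions k deg) : iterDeriv e deg N b (twist k deg r f) =
      sgn k (r * ∑ i, d i) • twist k deg r (iterDeriv e deg N b f) := by
  induction N with
  | zero => simp [iterDeriv_zero]
  | succ N ih =>
    rw [iterDeriv_succ, Module.End.mul_apply,
      ih (b := Fin.tail b) (d := Fin.tail d) fun i => hb i.succ, map_smul,
      dirDeriv_twist he (hb 0), smul_smul, ← sgn_add, Fin.sum_univ_succ, Module.End.mul_apply]
    congr 2
    simp only [Fin.tail]
    ring

theorem iterDeriv_swap {N : ℕ} {b : Fin N → V} {d : Fin N → ℤ} (hb : ∀ i, b i ∈ 𝒱 (d i))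
    (i j : Fin N) (hij : (j : ℕ) = i + 1) :
    iterDeriv e deg N (b ∘ Equiv.swap i j) = sgn k (d i * d j) • iterDeriv e deg N b := by
  induction N with
  | zero => exact i.elim0
  | succ N ih =>
    obtain ⟨j, rfl⟩ := Fin.exists_succ_eq.2 (show j ≠ 0 from fun h => by simp [h] at hij)
    rcases Fin.eq_zero_or_eq_succ i with rfl | ⟨i, rfl⟩
    · cases N with
      | zero => exact j.elim0
      | succ N =>
        have hj : j = 0 := by
          ext
          simpa using hij
        subst hj
        rw [iterDeriv_succ, iterDeriv_succ, iterDeriv_succ e deg b, iterDeriv_succ e deg (Fin.tail b),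
          ← mul_assoc, ← mul_assoc, ← smul_mul_assoc]
        have h1 : Fin.tail (Fin.tail (b ∘ Equiv.swap 0 (Fin.succ 0))) = Fin.tail (Fin.tail b) := by
          funext x
          simp only [Fin.tail, Function.comp_apply]
          rw [Equiv.swap_apply_of_ne_of_ne]
          · exact Fin.succ_ne_zero _
          · exact fun h => Fin.succ_ne_zero _ (Fin.succ_injective _ h)
        rw [h1]
        congr 1
        simp only [Fin.tail, Function.comp_apply, Equiv.swap_apply_left, Equiv.swap_apply_right]
        rw [dirDeriv_comm he (hb (Fin.succ 0)) (hb 0), mul_comm]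
    · rw [iterDeriv_succ, iterDeriv_succ e deg b, ← mul_smul_comm]
      have h1 : Fin.tail (b ∘ Equiv.swap i.succ j.succ) = Fin.tail b ∘ Equiv.swap i j := by
        funext x
        simp only [Fin.tail, Function.comp_apply]
        rw [(Fin.succ_injective N).swap_apply]
      rw [h1, ih (b := Fin.tail b) (d := Fin.tail d) (fun i => hb i.succ) i j (by simpa using hij)]
      simp only [Function.comp_apply, Fin.tail]
      rw [Equiv.swap_apply_of_ne_of_ne (Fin.succ_ne_zero _).symm (Fin.succ_ne_zero _).symm]

/-- The derivatives along b_S hit `f`, the others hit `g`. Moving b_S to the front costs the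
unshuffle sign, and the remaining derivatives pass `f`. The induction splits the subsets according
to whether they contain 0, that is, whether the outermost derivative falls on `f` or on `g`. -/
theorem iterDeriv_mul {N : ℕ} {b : Fin N → V} {d : Fin N → ℤ} (hb : ∀ i, b i ∈ 𝒱 (d i)) {p : ℤ}
    {f : Functions k deg} (hf : f ∈ functionsOfDegree k deg p) (g : Functions k deg) :
    iterDeriv e deg N b (f * g) =
      ∑ S : Finset (Fin N), sgn k (unshuffle d S + p * ∑ i ∈ Sᶜ, d i) •
        (iterDeriv e deg S.card (sub b S) f * iterDeriv e deg Sᶜ.card (sub b Sᶜ) g) := by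
  induction N with
  | zero =>
    rw [Fintype.sum_unique]
    simp only [iterDeriv_eq_prod, ofFn_sub]
    simp [unshuffle, Subsingleton.elim _ (∅ : Finset (Fin 0))]
  | succ N ih =>
    rw [iterDeriv_succ, Module.End.mul_apply,
      ih (b := Fin.tail b) (d := Fin.tail d) fun i => hb i.succ, map_sum, sum_finset_fin_succ,
      ← sum_add_distrib]
    refine sum_congr rfl fun S _ => ?_
    have hD := iterDeriv_mem he (b := sub (Fin.tail b) S) (d := sub (Fin.tail d) S)
      (fun i => hb _) hf
    rw [sum_sub] at hD
    rw [map_smul, dirDeriv_mul he (hb 0) hD, smul_add, smul_smul, compl_insert_map_succ,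
      compl_map_succ, sum_map_succ, sum_insert_map_succ, unshuffle_insert, unshuffle_map_succ]
    congr 1
    · congr 2
      · rw [iterDeriv_eq_prod, iterDeriv_eq_prod, ofFn_sub_insert, List.map_cons, List.prod_cons,
          Module.End.mul_apply]
      · rw [iterDeriv_eq_prod, iterDeriv_eq_prod, ofFn_sub_map_succ]
    · rw [← sgn_add]
      congr 1
      · apply sgn_congr
        push_cast
        have : (2 : ZMod 2) = 0 := rfl
        rw [this]
        ring
      · congr 1
        · rw [iterDeriv_eq_prod, iterDeriv_eq_prod, ofFn_sub_map_succ]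
        · rw [iterDeriv_eq_prod, iterDeriv_eq_prod, ofFn_sub_insert, List.map_cons, List.prod_cons,
            Module.End.mul_apply]

end IteratedDerivatives

/-! ### Homogeneous vector fields -/

section VectorFields

variable {ι k : Type*} [Field k] [Fintype ι] {deg : ι → ℤ}

theorem eq_zero_of_coeff_zero_ne_zero {p : ℤ} {f : Functions k deg}
    (hf : f ∈ functionsOfDegree k deg p) (h : coeff f 0 ≠ 0) : p = 0 := by
  rw [← hf 0 h]
  simp [monDeg]

theorem mem_vectorFieldsOfDegree {d : ℤ} {X : VectorField k deg} :
    X ∈ vectorFieldsOfDegree k deg d ↔ ∀ α, X α ∈ functionsOfDegree k deg (d - (deg α - 2)) := by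
  simp [vectorFieldsOfDegree]

variable [LinearOrder ι]

theorem coordField_mem (α : ι) :
    coordField k deg α ∈ vectorFieldsOfDegree k deg (deg α - 2) := by
  rw [mem_vectorFieldsOfDegree]
  intro β
  rcases eq_or_ne β α with rfl | h
  · rw [coordField, Pi.single_eq_same, sub_self]
    exact one_mem_functionsOfDegree
  · rw [coordField, Pi.single_eq_of_ne h]
    exact Submodule.zero_mem _

theorem smul_mem_vectorFieldsOfDegree {p d : ℤ} {f : Functions k deg} {X : VectorField k deg}
    (hf : f ∈ functionsOfDegree k deg p) (hX : X ∈ vectorFieldsOfDegree k deg d) :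
    f • X ∈ vectorFieldsOfDegree k deg (p + d) := by
  rw [mem_vectorFieldsOfDegree] at hX ⊢
  intro α
  have := mul_mem_functionsOfDegree hf (hX α)
  rwa [← add_sub_assoc] at this

theorem sum_smul_coordField (X : VectorField k deg) : ∑ γ, X γ • coordField k deg γ = X := by
  funext α
  rw [Finset.sum_apply, sum_eq_single α]
  · simp [coordField]
  · intro γ _ h
    simp [coordField, h.symm]
  · simp

end VectorFields

/-! ### Taylor coefficients of vector fields and how they compose -/

section Evaluation

variable {ι k V : Type*} [Field k] [AddCommGroup V] [Module k V] [Fintype ι] [LinearOrder ι]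
  {𝒱 : ℤ → Submodule k V} [DirectSum.Decomposition 𝒱] (e : Module.Basis ι k V) (deg : ι → ℤ)

/-- The constant vector field with value `v`. -/
noncomputable def constField : V →ₗ[k] VectorField k deg where
  toFun v α := e.repr v α • 1
  map_add' v w := by
    funext α
    simp [add_smul]
  map_smul' c v := by
    funext α
    simp [mul_smul]

theorem constField_apply (v : V) (α : ι) :
    constField e deg v α = e.repr v α • (1 : Functions k deg) := rfl

theorem constField_basis (α : ι) : constField e deg (e α) = coordField k deg α := by
  funext β
  rw [constField_apply, coordField, Module.Basis.repr_self, Finsupp.single_apply, Pi.single_apply]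
  simp only [eq_comm (a := α)]
  split_ifs <;> simp

theorem constField_eq_sum (v : V) :
    constField e deg v = ∑ γ, e.repr v γ • coordField k deg γ := by
  conv_lhs => rw [← e.sum_repr v]
  rw [map_sum]
  exact sum_congr rfl fun γ _ => by rw [map_smul, constField_basis]

/-- The value at the origin of an operator applied to the components of a vector field, twisted so
that the operator passes the odd vectors `e_α` from the right. -/
noncomputable def evalField : VectorField k deg →ₗ[k] Module.End k (Functions k deg) →ₗ[k] V :=
  LinearMap.mk₂ k
    -- Coordinates passing an operator of degree x produce the exponent x ∑ d_i. Where the value at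
    -- the origin is nonzero, ∑ d_i has the parity of |X^α|, that is of x + deg α, so this exponent
    -- agrees with (1 + deg α)|X^α| mod 2. The latter form does not mention x and is therefore
    -- linear in all `X`, homogeneous or not.
    (fun X D => ∑ α, coeff (D (twist k deg (1 + deg α) (X α))) 0 • e α)
    (fun X Y D => by
      simp [map_add, coeff_add, add_smul, sum_add_distrib])
    (fun c X D => by
      simp [map_smul, coeff_smul, mul_smul, smul_sum])
    (fun X D D' => by
      simp [coeff_add, add_smul, sum_add_distrib])
    (fun c X D => by
      simp [coeff_smul, mul_smul, smul_sum])

/-- The Taylor coefficients at the origin of a vector field, as multilinear maps. -/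
noncomputable def taylor (N : ℕ) :
    VectorField k deg →ₗ[k] MultilinearMap k (fun _ : Fin N => V) V where
  toFun X := (evalField e deg X).compMultilinearMap (iterDeriv e deg N)
  map_add' X Y := by
    ext b
    simp
  map_smul' c X := by
    ext b
    simp

theorem repr_taylor_aux {N : ℕ} (X : VectorField k deg) (b : Fin N → V) (α : ι) :
    e.repr (taylor e deg N X b) α =
      coeff (iterDeriv e deg N b (twist k deg (1 + deg α) (X α))) 0 := by
  change e.repr (∑ α, coeff (iterDeriv e deg N b (twist k deg (1 + deg α) (X α))) 0 • e α) α = _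
  simp [Finsupp.single_apply]

variable {e deg} (he : ∀ α, e α ∈ 𝒱 (deg α))
include he

theorem constField_mem {v : V} {d : ℤ} (hv : v ∈ 𝒱 d) :
    constField e deg v ∈ vectorFieldsOfDegree k deg (d - 2) := by
  rw [constField_eq_sum]
  refine Submodule.sum_mem _ fun γ _ => ?_
  by_cases h : deg γ = d
  · exact Submodule.smul_mem _ _ (h ▸ coordField_mem γ)
  · simp [repr_eq_zero_of_mem e he hv h]

theorem repr_taylor {N : ℕ} (X : VectorField k deg) {b : Fin N → V} {d : Fin N → ℤ}
    (hb : ∀ i, b i ∈ 𝒱 (d i)) (α : ι) :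
    e.repr (taylor e deg N X b) α =
      sgn k ((1 + deg α) * ∑ i, d i) * coeff (iterDeriv e deg N b (X α)) 0 := by
  rw [repr_taylor_aux, iterDeriv_twist he hb, coeff_smul, coeff_twist]
  simp [monDeg]

theorem taylor_mem {N : ℕ} {X : VectorField k deg} {b : Fin N → V} {d : Fin N → ℤ}
    (hb : ∀ i, b i ∈ 𝒱 (d i)) {x : ℤ} (hX : X ∈ vectorFieldsOfDegree k deg x) :
    taylor e deg N X b ∈ 𝒱 (x + 2 + ∑ i, d i - 2 * N) := by
  refine mem_of_repr e he fun α h => ?_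
  rw [repr_taylor he X hb] at h
  have := eq_zero_of_coeff_zero_ne_zero
    (iterDeriv_mem he hb (mem_vectorFieldsOfDegree.1 hX α)) (right_ne_zero_of_mul h)
  omega

theorem taylor_swap {N : ℕ} (X : VectorField k deg) {b : Fin N → V} {d : Fin N → ℤ}
    (hb : ∀ i, b i ∈ 𝒱 (d i)) (i j : Fin N) (hij : (j : ℕ) = i + 1) :
    taylor e deg N X (b ∘ Equiv.swap i j) = sgn k (d i * d j) • taylor e deg N X b := by
  change evalField e deg X _ = _ • evalField e deg X _
  rw [iterDeriv_swap he hb i j hij, map_smul]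

theorem dirDeriv_iterDeriv_comm {N : ℕ} {v : V} {c : ℤ} (hv : v ∈ 𝒱 c) {b : Fin N → V}
    {d : Fin N → ℤ} (hb : ∀ i, b i ∈ 𝒱 (d i)) :
    dirDeriv e deg v * iterDeriv e deg N b =
      sgn k (c * ∑ i, d i) • (iterDeriv e deg N b * dirDeriv e deg v) := by
  induction N with
  | zero => simp [iterDeriv_zero]
  | succ N ih =>
    rw [iterDeriv_succ, ← mul_assoc, dirDeriv_comm he hv (hb 0), smul_mul_assoc, mul_assoc,
      ih (b := Fin.tail b) (d := Fin.tail d) fun i => hb i.succ, mul_smul_comm, smul_smul,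
      ← sgn_add, mul_assoc, Fin.sum_univ_succ, mul_add]
    rfl

/-- A function with nonzero value at the origin that is homogeneous has degree 0. Whenever a term
survives, the degrees of the vectors can thus be traded for those of the functions; this closes most
of the sign checks below. -/
theorem coeff_iterDeriv_parity {N : ℕ} {b : Fin N → V} {d : Fin N → ℤ} (hb : ∀ i, b i ∈ 𝒱 (d i))
    {p : ℤ} {f : Functions k deg} (hf : f ∈ functionsOfDegree k deg p)
    (h : coeff (iterDeriv e deg N b f) 0 ≠ 0) : ((∑ i, d i : ℤ) : ZMod 2) = p := by
  have h0 := eq_zero_of_coeff_zero_ne_zero (iterDeriv_mem he hb hf) h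
  have h1 : ∑ i, d i = 2 * N - p := by omega
  have h2 : (2 : ZMod 2) = 0 := rfl
  rw [h1]
  push_cast
  rw [h2, zero_mul]
  generalize (p : ZMod 2) = x
  revert x
  decide

theorem sub_mem {N : ℕ} {b : Fin N → V} {d : Fin N → ℤ} (hb : ∀ i, b i ∈ 𝒱 (d i))
    (S : Finset (Fin N)) (i : Fin S.card) : sub b S i ∈ 𝒱 (sub d S i) := hb _

/-- This identifies the Lie derivative of a constant field `v` along `Q` with the Taylor
coefficients of `Q` having `v` in the first slot. -/
theorem taylor_dirDeriv {N : ℕ} {Z : VectorField k deg} {z : ℤ}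
    (hZ : Z ∈ vectorFieldsOfDegree k deg z) {v : V} {c : ℤ} (hv : v ∈ 𝒱 c) {b : Fin N → V}
    {d : Fin N → ℤ} (hb : ∀ i, b i ∈ 𝒱 (d i)) :
    taylor e deg N (fun γ => dirDeriv e deg v (Z γ)) b =
      sgn k (c * z) • taylor e deg (N + 1) Z (Fin.cons v b) := by
  refine e.repr.injective (Finsupp.ext fun α => ?_)
  rw [map_smul, Finsupp.smul_apply, repr_taylor he _ hb,
    repr_taylor he Z (b := Fin.cons v b) (d := Fin.cons c d)
      (fun i => by refine Fin.cases ?_ (fun i => ?_) i <;> simp [hv, hb]),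
    iterDeriv_cons, dirDeriv_iterDeriv_comm he hv hb, LinearMap.smul_apply, coeff_smul,
    Module.End.mul_apply, Fin.sum_univ_succ]
  simp only [Fin.cons_zero, Fin.cons_succ, smul_eq_mul]
  by_cases h0 : coeff (iterDeriv e deg N b (dirDeriv e deg v (Z α))) 0 = 0
  · simp [h0]
  have h1 := coeff_iterDeriv_parity he hb
    (dirDeriv_mem he hv (mem_vectorFieldsOfDegree.1 hZ α)) h0
  rw [← mul_assoc, ← mul_assoc, ← sgn_add, ← sgn_add]
  congr 1
  apply sgn_congr
  push_cast at h1 ⊢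
  rw [h1]
  have h2 : (2 : ZMod 2) = 0 := rfl
  rw [h2]
  generalize (c : ZMod 2) = c
  generalize (z : ZMod 2) = z
  generalize (deg α : ZMod 2) = a
  revert c z a
  decide

/-- By the Leibniz rule the derivatives along b_S turn the components of `Y` into those of a vector
w at the origin, and ∂_w joins the remaining derivatives of `Z`. This insertion of one Taylor
coefficient into another is the shape of the ν-terms in the `Gerst_∞` identities. -/
theorem taylor_act {N : ℕ} {Y Z : VectorField k deg} {y z : ℤ}
    (hY : Y ∈ vectorFieldsOfDegree k deg y) (hZ : Z ∈ vectorFieldsOfDegree k deg z)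
    {b : Fin N → V} {d : Fin N → ℤ} (hb : ∀ i, b i ∈ 𝒱 (d i)) :
    taylor e deg N (fun α => Y.act (Z α)) b =
      ∑ S : Finset (Fin N), sgn k (unshuffle d S + y * z) •
        taylor e deg (Sᶜ.card + 1) Z
          (Fin.cons (taylor e deg S.card Y (sub b S)) (sub b Sᶜ)) := by
  refine e.repr.injective (Finsupp.ext fun α => ?_)
  rw [repr_taylor he _ hb, map_sum, Finsupp.coe_finsetSum, Finset.sum_apply, VectorField.act,
    map_sum, coeff_sum, mul_sum]
  have hL : ∀ γ ∈ univ, sgn k ((1 + deg α) * ∑ i, d i) *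
      coeff (iterDeriv e deg N b (Y γ * partialDeriv γ (Z α))) 0 =
      ∑ S : Finset (Fin N), sgn k ((1 + deg α) * ∑ i, d i) *
        (sgn k (unshuffle d S + (y - (deg γ - 2)) * ∑ i ∈ Sᶜ, d i) *
        (coeff (iterDeriv e deg S.card (sub b S) (Y γ)) 0 *
          coeff (iterDeriv e deg Sᶜ.card (sub b Sᶜ) (partialDeriv γ (Z α))) 0)) := by
    intro γ _
    rw [iterDeriv_mul he hb (mem_vectorFieldsOfDegree.1 hY γ), coeff_sum, mul_sum]
    exact sum_congr rfl fun S _ => by rw [coeff_smul, coeff_zero_mul]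
  rw [sum_congr rfl hL, sum_comm]
  refine sum_congr rfl fun S _ => ?_
  set w := taylor e deg S.card Y (sub b S) with hw
  have hwm := taylor_mem he (sub_mem he hb S) hY
  rw [← hw, sum_sub] at hwm
  rw [map_smul, Finsupp.smul_apply, smul_eq_mul,
    repr_taylor he Z (b := Fin.cons w (sub b Sᶜ)) (d := Fin.cons _ (sub d Sᶜ))
      (fun i => by
        refine Fin.cases ?_ (fun i => ?_) i
        · simpa using hwm
        · rw [Fin.cons_succ, Fin.cons_succ]
          exact hb _),
    iterDeriv_cons, Module.End.mul_apply, dirDeriv_apply, coeff_sum,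
    ← mul_assoc, mul_sum univ _ (sgn k (unshuffle d S + y * z) * _)]
  refine sum_congr rfl fun γ _ => ?_
  -- On the left ∂_γ acts before the derivatives along b_{Sᶜ}; in the Taylor coefficient of `Z` it
  -- acts after them.
  have hc := LinearMap.congr_fun (dirDeriv_iterDeriv_comm he (he γ) (sub_mem he hb Sᶜ)) (Z α)
  rw [Module.End.mul_apply, LinearMap.smul_apply, Module.End.mul_apply, dirDeriv_basis,
    dirDeriv_basis] at hc
  rw [hc, coeff_smul, coeff_smul, hw, repr_taylor he Y (sub_mem he hb S), Fin.sum_univ_succ]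
  simp only [Fin.cons_zero, Fin.cons_succ, sum_sub]
  by_cases hA : coeff (iterDeriv e deg S.card (sub b S) (Y γ)) 0 = 0
  · simp [hA]
  by_cases hB : coeff (iterDeriv e deg Sᶜ.card (sub b Sᶜ) (partialDeriv γ (Z α))) 0 = 0
  · simp [hB]
  have h1 := coeff_iterDeriv_parity he (sub_mem he hb S) (mem_vectorFieldsOfDegree.1 hY γ) hA
  have h2 := coeff_iterDeriv_parity he (sub_mem he hb Sᶜ)
    (partialDeriv_mem (mem_vectorFieldsOfDegree.1 hZ α) γ) hB
  rw [sum_sub] at h1 h2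
  have hs : sgn k ((1 + deg α) * ∑ i, d i) *
      sgn k (unshuffle d S + (y - (deg γ - 2)) * ∑ i ∈ Sᶜ, d i) =
      sgn k (unshuffle d S + y * z) *
        (sgn k ((1 + deg α) * (y + 2 + ∑ i ∈ S, d i - 2 * S.card + ∑ i ∈ Sᶜ, d i)) *
          (sgn k ((1 + deg γ) * ∑ i ∈ S, d i) * sgn k (deg γ * ∑ i ∈ Sᶜ, d i))) := by
    rw [← sum_add_sum_compl S d]
    simp only [← sgn_add]
    apply sgn_congr
    push_cast at h1 h2 ⊢
    rw [h1, h2]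
    have h3 : (2 : ZMod 2) = 0 := rfl
    rw [h3]
    simp only [zero_mul, sub_zero, add_zero]
    generalize (y : ZMod 2) = y
    generalize (z : ZMod 2) = z
    generalize (deg α : ZMod 2) = a
    generalize (deg γ : ZMod 2) = c
    generalize (unshuffle d S : ZMod 2) = u
    revert y z a c u
    decide
  linear_combination (coeff (iterDeriv e deg S.card (sub b S) (Y γ)) 0 *
    coeff (iterDeriv e deg Sᶜ.card (sub b Sᶜ) (partialDeriv γ (Z α))) 0) * hs

/-- The analogue of `taylor_act` for a tensor: `F γ` stands for its value with ∂_γ in a chosen slot,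
whence the degree `r + deg γ`. -/
theorem taylor_sum_smul {N : ℕ} {W : VectorField k deg} {w : ℤ}
    (hW : W ∈ vectorFieldsOfDegree k deg w) {F : ι → VectorField k deg} {r : ℤ}
    (hF : ∀ γ, F γ ∈ vectorFieldsOfDegree k deg (r + deg γ))
    {b : Fin N → V} {d : Fin N → ℤ} (hb : ∀ i, b i ∈ 𝒱 (d i)) :
    taylor e deg N (∑ γ, W γ • F γ) b =
      ∑ S : Finset (Fin N), sgn k (unshuffle d S + (∑ i ∈ S, d i) * r) •
        ∑ γ, e.repr (taylor e deg S.card W (sub b S)) γ •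
          taylor e deg Sᶜ.card (F γ) (sub b Sᶜ) := by
  refine e.repr.injective (Finsupp.ext fun α => ?_)
  rw [repr_taylor he _ hb, map_sum, Finsupp.coe_finsetSum, Finset.sum_apply, Finset.sum_apply,
    map_sum, coeff_sum, mul_sum]
  have hL : ∀ γ ∈ univ, sgn k ((1 + deg α) * ∑ i, d i) *
      coeff (iterDeriv e deg N b ((W γ • F γ) α)) 0 =
      ∑ S : Finset (Fin N), sgn k ((1 + deg α) * ∑ i, d i) *
        (sgn k (unshuffle d S + (w - (deg γ - 2)) * ∑ i ∈ Sᶜ, d i) *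
        (coeff (iterDeriv e deg S.card (sub b S) (W γ)) 0 *
          coeff (iterDeriv e deg Sᶜ.card (sub b Sᶜ) (F γ α)) 0)) := by
    intro γ _
    rw [Pi.smul_apply, smul_eq_mul, iterDeriv_mul he hb (mem_vectorFieldsOfDegree.1 hW γ),
      coeff_sum, mul_sum]
    exact sum_congr rfl fun S _ => by rw [coeff_smul, coeff_zero_mul]
  rw [sum_congr rfl hL, sum_comm]
  refine sum_congr rfl fun S _ => ?_
  rw [map_smul, Finsupp.smul_apply, smul_eq_mul, map_sum, Finsupp.coe_finsetSum, Finset.sum_apply,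
    mul_sum univ _ (sgn k (unshuffle d S + _))]
  refine sum_congr rfl fun γ _ => ?_
  rw [map_smul, Finsupp.smul_apply, smul_eq_mul, repr_taylor he W (sub_mem he hb S),
    repr_taylor he (F γ) (sub_mem he hb Sᶜ), sum_sub, sum_sub]
  by_cases hA : coeff (iterDeriv e deg S.card (sub b S) (W γ)) 0 = 0
  · simp [hA]
  by_cases hB : coeff (iterDeriv e deg Sᶜ.card (sub b Sᶜ) (F γ α)) 0 = 0
  · simp [hB]
  have h1 := coeff_iterDeriv_parity he (sub_mem he hb S) (mem_vectorFieldsOfDegree.1 hW γ) hA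
  have h2 := coeff_iterDeriv_parity he (sub_mem he hb Sᶜ) (mem_vectorFieldsOfDegree.1 (hF γ) α) hB
  rw [sum_sub] at h1 h2
  have hs : sgn k ((1 + deg α) * ∑ i, d i) *
      sgn k (unshuffle d S + (w - (deg γ - 2)) * ∑ i ∈ Sᶜ, d i) =
      sgn k (unshuffle d S + (∑ i ∈ S, d i) * r) *
        (sgn k ((1 + deg γ) * ∑ i ∈ S, d i) * sgn k ((1 + deg α) * ∑ i ∈ Sᶜ, d i)) := by
    rw [← sum_add_sum_compl S d]
    simp only [← sgn_add]
    apply sgn_congr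
    push_cast at h1 h2 ⊢
    rw [h1, h2]
    have h3 : (2 : ZMod 2) = 0 := rfl
    rw [h3]
    simp only [sub_zero]
    generalize (w : ZMod 2) = w
    generalize (r : ZMod 2) = r
    generalize (deg α : ZMod 2) = a
    generalize (deg γ : ZMod 2) = c
    generalize (unshuffle d S : ZMod 2) = u
    revert w r a c u
    decide
  linear_combination (coeff (iterDeriv e deg S.card (sub b S) (W γ)) 0 *
    coeff (iterDeriv e deg Sᶜ.card (sub b Sᶜ) (F γ α)) 0) * hs

end Evaluation

/-- The data of a geometric `A_∞`-structure, without the quadratic identities. -/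
structure TensorStructure {ι : Type*} [Fintype ι] [LinearOrder ι] (k : Type*) [Field k]
    (deg : ι → ℤ) where
  μ : (n : ℕ) → MultilinearMap k (fun _ : Fin n => VectorField k deg) (VectorField k deg)
  μ_zero : μ 0 = 0
  μ_mem : ∀ (n : ℕ) (a : Fin n → VectorField k deg) (d : Fin n → ℤ),
    (∀ i, a i ∈ vectorFieldsOfDegree k deg (d i - 2)) →
    μ n a ∈ vectorFieldsOfDegree k deg (∑ i, d i + 2 - n - 2)
  Q : VectorField k deg
  Q_mem : Q ∈ vectorFieldsOfDegree k deg 1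
  Q_origin : ∀ α, coeff (Q α) 0 = 0
  μ_one : ∀ (d : ℤ) (X : VectorField k deg), X ∈ vectorFieldsOfDegree k deg d →
    μ 1 (fun _ => X) = bracket 1 d Q X
  μ_tensor : ∀ (n : ℕ) (X : Fin n → VectorField k deg) (d : Fin n → ℤ) (f : Functions k deg)
    (p : ℤ), 2 ≤ n → (∀ i, X i ∈ vectorFieldsOfDegree k deg (d i)) →
    f ∈ functionsOfDegree k deg p → ∀ i,
      μ n (Function.update X i (f • X i)) =
        Int.negOnePow (p * (2 - n + ∑ j with j < i, d j)) • f • μ n X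

/-- The data underlying a geometric `A_∞`-structure. -/
def GeometricAInfinityStructure.toTensorStructure {ι : Type*} [Fintype ι] [LinearOrder ι]
    {k : Type*} [Field k] {deg : ι → ℤ} (Γ : GeometricAInfinityStructure k deg) :
    TensorStructure k deg where
  __ := Γ

/-! ### Bookkeeping for a block of arguments replaced by one entry -/

section Splice

variable {A B : Type*}

theorem comp_splice (f : A → B) (a : ℕ → A) (j l : ℕ) (x : A) (i : ℕ) :
    f (splice a j l x i) = splice (fun i => f (a i)) j l (f x) i := by
  simp only [splice]
  split_ifs <;> rfl

/-- The entry `y` is a dummy that gets overwritten. In this form multilinearity in the inserted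
entry can be applied. -/
theorem splice_eq_update (a : ℕ → A) (j l q : ℕ) (hj : j < q) (x y : A) :
    (fun i : Fin q => splice a j l x i) =
      Function.update (fun i : Fin q => splice a j l y i) ⟨j, hj⟩ x := by
  funext i
  by_cases h : i = ⟨j, hj⟩
  · subst h
    simp [splice]
  · have h' : (i : ℕ) ≠ j := fun h' => h (Fin.ext h')
    rw [Function.update_of_ne h]
    simp [splice, h']

theorem splice_mem {S : Type*} [SetLike S A] (𝒜 : ℤ → S) {a : ℕ → A} {c : ℕ → ℤ}
    (ha : ∀ i, a i ∈ 𝒜 (c i)) (j l : ℕ) {x : A} {d : ℤ} (hx : x ∈ 𝒜 d) (i : ℕ) :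
    splice a j l x i ∈ 𝒜 (splice c j l d i) := by
  simp only [splice]
  split_ifs <;> simp [ha, hx]

theorem sum_fin_filter_lt {M : Type*} [AddCommMonoid M] (c : ℕ → M) (q j : ℕ) (hj : j < q) :
    ∑ i : Fin q with i < ⟨j, hj⟩, c i = ∑ i ∈ range j, c i := by
  rw [sum_filter]
  simp only [Fin.lt_def]
  rw [Fin.sum_univ_eq_sum_range (fun i => if i < j then c i else 0) q, ← sum_filter]
  congr 1
  ext i
  simp only [mem_filter, mem_range]
  omega

theorem sum_splice_filter_gt (c : ℕ → ℤ) (x : ℤ) {q j l n : ℕ} (hj : j < q)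
    (hn : q + l = n + 1) :
    ∑ i : Fin q with ⟨j, hj⟩ < i, splice c j l x i = ∑ i ∈ Ico (j + l) n, c i := by
  rw [sum_filter]
  simp only [Fin.lt_def]
  rw [Fin.sum_univ_eq_sum_range (fun i => if j < i then splice c j l x i else 0) q, ← sum_filter]
  refine sum_nbij' (fun i => i - 1 + l) (fun i => i + 1 - l) ?_ ?_ ?_ ?_ ?_ <;>
    simp only [mem_filter, mem_range, mem_Ico] <;> intro i hi
  · omega
  · omega
  · omega
  · omega
  · have h1 : ¬ i < j := by omega
    have h2 : i ≠ j := by omega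
    simp [splice, h1, h2]

theorem sum_sdiff_singleton_fin {q : ℕ} (c : Fin q → ℤ) (j : Fin q) :
    ∑ i ∈ univ \ {j}, c i = ∑ i with i < j, c i + ∑ i with j < i, c i := by
  rw [← sum_union]
  · congr 1
    ext i
    simp only [mem_sdiff, mem_univ, true_and, mem_singleton, mem_union, mem_filter]
    exact ne_iff_lt_or_gt
  · rw [disjoint_filter]
    exact fun i _ h => h.not_gt

/-- The pairs (1, n) and (n, 1), distinct for n ≥ 2, carry the terms with μ_1 outside and inside,
i.e. the Lie derivatives along `Q`. -/
theorem sum_antidiagonal_split {M : Type*} [AddCommMonoid M] {n : ℕ} (hn : 2 ≤ n)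
    (F : ℕ × ℕ → M) :
    ∑ p ∈ HasAntidiagonal.antidiagonal (n + 1) with 1 ≤ p.1 ∧ 1 ≤ p.2, F p =
      F (1, n) + (F (n, 1) +
        ∑ p ∈ HasAntidiagonal.antidiagonal (n + 1) with 2 ≤ p.1 ∧ 2 ≤ p.2, F p) := by
  have : (HasAntidiagonal.antidiagonal (n + 1)).filter (fun p => 1 ≤ p.1 ∧ 1 ≤ p.2) =
      insert (1, n) (insert (n, 1)
        ((HasAntidiagonal.antidiagonal (n + 1)).filter fun p => 2 ≤ p.1 ∧ 2 ≤ p.2)) := by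
    ext ⟨x, y⟩
    simp only [mem_filter, HasAntidiagonal.mem_antidiagonal, mem_insert, Prod.mk.injEq]
    omega
  rw [this, sum_insert, sum_insert]
  · simp
  · simp only [mem_filter, HasAntidiagonal.mem_antidiagonal, mem_insert, Prod.mk.injEq]
    omega

end Splice

/-! ### The Stasheff sum on constant fields and the mixed identities -/

namespace TensorStructure

variable {ι k V : Type*} [Field k] [AddCommGroup V] [Module k V] [Fintype ι] [LinearOrder ι]
  {𝒱 : ℤ → Submodule k V} [DirectSum.Decomposition 𝒱] {e : Module.Basis ι k V} {deg : ι → ℤ}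

/-- The left-hand side of the Stasheff identity. -/
noncomputable def stasheffSum (T : TensorStructure k deg) (n : ℕ) (a : ℕ → VectorField k deg)
    (d : ℕ → ℤ) : VectorField k deg :=
  ∑ p ∈ HasAntidiagonal.antidiagonal (n + 1) with 1 ≤ p.1 ∧ 1 ≤ p.2, ∑ j ∈ range p.1,
    Int.negOnePow (j + p.2 * (n - j - p.2) + p.2 * ∑ i ∈ range j, d i) •
      T.μ p.1 (fun i => splice a j p.2 (T.μ p.2 (fun i => a (j + i))) i)

/-- The Taylor coefficients of the vector field of a structure. -/
noncomputable def gerstν (e : Module.Basis ι k V) (T : TensorStructure k deg) (n : ℕ) :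
    MultilinearMap k (fun _ : Fin n => V) V := taylor e deg n T.Q

/-- The Taylor coefficients of the higher operations of a structure. -/
noncomputable def gerstμ (e : Module.Basis ι k V) (T : TensorStructure k deg) (n p : ℕ) :
    MultilinearMap k (fun _ : Fin n ⊕ Fin p => V) V :=
  if 2 ≤ n then ((taylor e deg p).compMultilinearMap
    ((T.μ n).compLinearMap fun _ => constField e deg)).uncurrySum else 0

theorem gerstμ_apply (T : TensorStructure k deg) {n : ℕ} (hn : 2 ≤ n) {p : ℕ} (a : Fin n → V)
    (b : Fin p → V) : T.gerstμ e n p (Sum.elim a b) =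
      taylor e deg p (T.μ n fun i => constField e deg (a i)) b := by
  rw [gerstμ, if_pos hn]
  rfl

/-- The inserted field is expanded in coordinate fields, and its components leave the tensor with
their Koszul signs. -/
theorem μ_update_sum (T : TensorStructure k deg) {n : ℕ} (hn : 2 ≤ n)
    {X : Fin n → VectorField k deg} {c : Fin n → ℤ}
    (hX : ∀ i, X i ∈ vectorFieldsOfDegree k deg (c i - 2)) (j : Fin n) {W : VectorField k deg}
    {w : ℤ} (hW : W ∈ vectorFieldsOfDegree k deg w) :
    T.μ n (Function.update X j W) =
      ∑ γ, W γ • sgn k ((w - (deg γ - 2)) * (2 - n + ∑ i with i < j, c i)) •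
        T.μ n (Function.update X j (coordField k deg γ)) := by
  conv_lhs => rw [← sum_smul_coordField W, MultilinearMap.map_update_sum]
  refine sum_congr rfl fun γ _ => ?_
  have h := T.μ_tensor n (Function.update X j (coordField k deg γ))
    (Function.update (fun i => c i - 2) j (deg γ - 2)) (W γ) (w - (deg γ - 2)) hn
    (fun i => by
      rcases eq_or_ne i j with rfl | h
      · simpa using coordField_mem γ
      · simpa [h] using hX i) (mem_vectorFieldsOfDegree.1 hW γ) j
  rw [Function.update_idem, Function.update_self] at h
  rw [h, negOnePow_smul (k := k), smul_comm]
  congr 2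
  apply sgn_congr
  rw [sum_congr rfl (g := fun i => c i - 2)]
  · push_cast
    have h2 : (2 : ZMod 2) = 0 := rfl
    rw [h2]
    simp
  · intro i hi
    rw [Function.update_of_ne (mem_filter.1 hi).2.ne]

theorem stasheffSum_eq (T : TensorStructure k deg) {n : ℕ} (hn : 2 ≤ n)
    {a : ℕ → VectorField k deg} {d : ℕ → ℤ}
    (ha : ∀ i, a i ∈ vectorFieldsOfDegree k deg (d i - 2)) :
    T.stasheffSum n a d =
      bracket 1 (∑ i ∈ range n, d i + 2 - n - 2) T.Q (T.μ n fun i => a i) +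
      (∑ j ∈ range n, sgn k (n - 1 + ∑ i ∈ range j, d i) •
        T.μ n (fun i => splice a j 1 (bracket 1 (d j - 2) T.Q (a j)) i) +
      ∑ p ∈ HasAntidiagonal.antidiagonal (n + 1) with 2 ≤ p.1 ∧ 2 ≤ p.2, ∑ j ∈ range p.1,
        sgn k (j + p.2 * (n - j - p.2) + p.2 * ∑ i ∈ range j, d i) •
          T.μ p.1 (fun i => splice a j p.2 (T.μ p.2 (fun i => a (j + i))) i)) := by
  rw [stasheffSum]
  simp only [negOnePow_smul (k := k)]
  rw [sum_antidiagonal_split hn]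
  congr 1
  · rw [range_one, sum_singleton, range_zero, sum_empty]
    have h1 : ∀ x : VectorField k deg,
        (fun i : Fin 1 => splice a 0 n x i) = fun _ => x := by
      intro x
      funext i
      simp [splice]
    have h2 := T.μ_mem n (fun i => a i) (fun i => d i) fun i => ha i
    rw [Fin.sum_univ_eq_sum_range] at h2
    rw [h1]
    simp only [zero_add]
    rw [T.μ_one _ _ h2]
    simp
  · congr 1
    refine sum_congr rfl fun j _ => ?_
    have h1 : T.μ 1 (fun i => a (j + i)) = bracket 1 (d j - 2) T.Q (a j) := by
      rw [← T.μ_one _ _ (ha j)]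
      congr 1
      funext i
      simp
    rw [h1]
    congr 2
    push_cast
    ring

variable (he : ∀ α, e α ∈ 𝒱 (deg α))
include he

/-- Since μ_n is a tensor, `W` enters only through its components. So the derivatives along b_S that
hit `W` produce a constant field in slot j, and the others act on the resulting value of μ_n. The
sign arises because b_S passes the arguments after slot j. -/
theorem taylor_μ_update (T : TensorStructure k deg) {n : ℕ} (hn : 2 ≤ n)
    {X : Fin n → VectorField k deg} {c : Fin n → ℤ}
    (hX : ∀ i, X i ∈ vectorFieldsOfDegree k deg (c i - 2)) (j : Fin n) {W : VectorField k deg}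
    {w : ℤ} (hW : W ∈ vectorFieldsOfDegree k deg w) {N : ℕ} {b : Fin N → V} {d : Fin N → ℤ}
    (hb : ∀ i, b i ∈ 𝒱 (d i)) :
    taylor e deg N (T.μ n (Function.update X j W)) b =
      ∑ S : Finset (Fin N), sgn k (unshuffle d S + (∑ i with j < i, c i) * ∑ i ∈ S, d i) •
        taylor e deg Sᶜ.card (T.μ n (Function.update X j
          (constField e deg (taylor e deg S.card W (sub b S))))) (sub b Sᶜ) := by
  -- With ∂_γ in slot j, the value of μ_n has vector field degree `r + deg γ` for this `r`.
  rw [T.μ_update_sum hn hX j hW, taylor_sum_smul he hW (r := ∑ i ∈ univ \ {j}, c i - n) _ hb]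
  · refine sum_congr rfl fun S _ => ?_
    have h1 : ∀ γ ∈ univ, e.repr (taylor e deg S.card W (sub b S)) γ •
        taylor e deg Sᶜ.card
          (sgn k ((w - (deg γ - 2)) * (2 - n + ∑ i with i < j, c i)) •
            T.μ n (Function.update X j (coordField k deg γ))) (sub b Sᶜ) =
        sgn k ((∑ i ∈ S, d i) * (n + ∑ i with i < j, c i)) •
          e.repr (taylor e deg S.card W (sub b S)) γ •
          taylor e deg Sᶜ.card (T.μ n (Function.update X j (coordField k deg γ))) (sub b Sᶜ) := by
      intro γ _
      rw [map_smul, smul_apply, smul_comm]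
      by_cases h0 : e.repr (taylor e deg S.card W (sub b S)) γ = 0
      · simp [h0]
      congr 1
      apply sgn_congr
      rw [repr_taylor he W (sub_mem he hb S)] at h0
      have := coeff_iterDeriv_parity he (sub_mem he hb S) (mem_vectorFieldsOfDegree.1 hW γ)
        (right_ne_zero_of_mul h0)
      rw [sum_sub] at this
      rw [Int.cast_mul, Int.cast_mul, this]
      push_cast
      have h2 : (2 : ZMod 2) = 0 := rfl
      rw [h2, zero_sub, CharTwo.neg_eq]
    rw [sum_congr rfl h1, ← smul_sum, smul_smul, ← sgn_add]
    congr 1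
    · apply sgn_congr
      rw [sum_sdiff_singleton_fin]
      push_cast
      generalize (unshuffle d S : ZMod 2) = u
      generalize (∑ i ∈ S, (d i : ZMod 2)) = s
      generalize (∑ i with i < j, (c i : ZMod 2)) = x
      generalize (∑ i with j < i, (c i : ZMod 2)) = y
      generalize (n : ZMod 2) = m
      revert u s x y m
      decide
    · rw [constField_eq_sum, MultilinearMap.map_update_sum, map_sum, _root_.sum_apply]
      refine sum_congr rfl fun γ _ => ?_
      rw [MultilinearMap.map_update_smul, map_smul, smul_apply]
  · intro γ
    refine Submodule.smul_mem _ _ ?_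
    have := T.μ_mem n (Function.update X j (coordField k deg γ)) (Function.update c j (deg γ))
      (fun i => by
        rcases eq_or_ne i j with rfl | h
        · simpa using coordField_mem γ
        · simpa [h] using hX i)
    rw [sum_update_of_mem (mem_univ j)] at this
    convert this using 2
    ring

theorem taylor_μ_splice (T : TensorStructure k deg) {q j l n : ℕ} (hq : 2 ≤ q) (hj : j < q)
    (hn : q + l = n + 1) {a : ℕ → V} {c : ℕ → ℤ} (ha : ∀ i, a i ∈ 𝒱 (c i))
    {W : VectorField k deg} {w : ℤ} (hW : W ∈ vectorFieldsOfDegree k deg w) {N : ℕ}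
    {b : Fin N → V} {d : Fin N → ℤ} (hb : ∀ i, b i ∈ 𝒱 (d i)) :
    taylor e deg N (T.μ q fun i => splice (fun i => constField e deg (a i)) j l W i) b =
      ∑ S : Finset (Fin N),
        sgn k (unshuffle d S + (∑ i ∈ Ico (j + l) n, c i) * ∑ i ∈ S, d i) •
        T.gerstμ e q Sᶜ.card (Sum.elim
          (fun i => splice a j l (taylor e deg S.card W (sub b S)) i) (sub b Sᶜ)) := by
  rw [splice_eq_update _ j l q hj W 0,
    T.taylor_μ_update he hq (c := fun i : Fin q => splice c j l 0 i) (fun i => ?_) ⟨j, hj⟩ hW hb,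
    sum_splice_filter_gt c 0 hj hn]
  · refine sum_congr rfl fun S _ => ?_
    rw [T.gerstμ_apply hq]
    simp only [comp_splice (constField e deg), ← splice_eq_update]
  · exact splice_mem (fun d => vectorFieldsOfDegree k deg (d - 2))
      (fun i => constField_mem he (ha i)) j l (Submodule.zero_mem _) i

-- `Q` kills the constant components of the field, so only the derivative of `Q` along `v` is left.
omit he in
theorem bracket_constField (Q : VectorField k deg) (v : V) (c : ℤ) :
    bracket 1 c Q (constField e deg v) = -(sgn k c • fun γ => dirDeriv e deg v (Q γ)) := by
  funext α
  rw [bracket, negOnePow_smul (k := k), one_mul]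
  have h1 : Q.act (constField e deg v α) = 0 := by
    rw [VectorField.act]
    refine sum_eq_zero fun γ _ => ?_
    rw [constField_apply, ← partialHom_apply, map_smul, partialHom_apply, partialDeriv_one,
      smul_zero, mul_zero]
  have h2 : (constField e deg v).act (Q α) = dirDeriv e deg v (Q α) := by
    rw [VectorField.act, dirDeriv_apply]
    exact sum_congr rfl fun γ _ => by rw [constField_apply, smul_mul', one_mul]
  rw [h1, h2, zero_sub]
  rfl

theorem taylor_bracket {Q M : VectorField k deg} {y : ℤ} (hQ : Q ∈ vectorFieldsOfDegree k deg 1)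
    (hM : M ∈ vectorFieldsOfDegree k deg y) {N : ℕ}
    {b : Fin N → V} {d : Fin N → ℤ} (hb : ∀ i, b i ∈ 𝒱 (d i)) :
    taylor e deg N (bracket 1 y Q M) b =
      -∑ S : Finset (Fin N), sgn k (unshuffle d S) •
        (taylor e deg (Sᶜ.card + 1) Q (Fin.cons (taylor e deg S.card M (sub b S)) (sub b Sᶜ)) -
          sgn k y • taylor e deg (Sᶜ.card + 1) M
            (Fin.cons (taylor e deg S.card Q (sub b S)) (sub b Sᶜ))) := by
  have h : bracket 1 y Q M =
      (fun α => Q.act (M α)) - sgn k y • fun α => M.act (Q α) := by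
    funext α
    rw [bracket, negOnePow_smul (k := k), one_mul]
    rfl
  rw [h, map_sub, map_smul, sub_apply, smul_apply,
    taylor_act he hQ hM hb, taylor_act he hM hQ hb, smul_sum, ← sum_sub_distrib,
    ← sum_neg_distrib]
  refine sum_congr rfl fun S _ => ?_
  rw [one_mul, mul_one, smul_smul, sgn_add, mul_left_comm, sgn_mul_self, mul_one, smul_sub,
    smul_smul, neg_sub]

/-- The outer Lie derivative gives the terms ν(μ, …) and μ(…; ν, …), the inner ones give ν inserted
into a tensor slot, and the terms without μ_1 give the right-hand side of the mixed identity. All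
Taylor coefficients of the Stasheff sum on constant fields therefore vanish exactly when that
identity holds. -/
theorem taylor_stasheffSum (T : TensorStructure k deg) {n : ℕ} (hn : 2 ≤ n) {a : ℕ → V}
    {c : ℕ → ℤ} (ha : ∀ i, a i ∈ 𝒱 (c i)) {N : ℕ} {b : Fin N → V} {d : Fin N → ℤ}
    (hb : ∀ i, b i ∈ 𝒱 (d i)) :
    taylor e deg N (T.stasheffSum n (fun i => constField e deg (a i)) c) b =
    ∑ p ∈ HasAntidiagonal.antidiagonal (n + 1) with 2 ≤ p.1 ∧ 2 ≤ p.2, ∑ j ∈ range p.1,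
      ∑ S : Finset (Fin N), Int.negOnePow (unshuffle d S) •
        Int.negOnePow (j + p.2 * (n - j - p.2) + p.2 * ∑ i ∈ range j, c i
            + (∑ i ∈ Ico (j + p.2) n, c i) * (∑ i ∈ S, d i)) •
          T.gerstμ e p.1 Sᶜ.card
            (Sum.elim
              (fun i => splice a j p.2
                (T.gerstμ e p.2 S.card (Sum.elim (fun i => a (j + i)) (sub b S))) i)
              (sub b Sᶜ)) -
    ∑ S : Finset (Fin N), Int.negOnePow (unshuffle d S) •
      (T.gerstν e (Sᶜ.card + 1)
          (Fin.cons (T.gerstμ e n S.card (Sum.elim (fun i => a i) (sub b S))) (sub b Sᶜ))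
        - Int.negOnePow (∑ i ∈ range n, c i - n) •
            T.gerstμ e n (Sᶜ.card + 1)
              (Sum.elim (fun i => a i) (Fin.cons (T.gerstν e S.card (sub b S)) (sub b Sᶜ)))
        - ∑ j ∈ range n,
            Int.negOnePow (∑ i ∈ range j, c i
                + (∑ i ∈ Ico (j + 1) n, c i) * (∑ i ∈ S, d i) - n) •
              T.gerstμ e n Sᶜ.card
                (Sum.elim (fun i => splice a j 1
                    (T.gerstν e (S.card + 1) (Fin.cons (a j) (sub b S))) i)
                  (sub b Sᶜ))) := by
  simp only [negOnePow_smul (k := k)]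
  have hX : ∀ i, constField e deg (a i) ∈ vectorFieldsOfDegree k deg (c i - 2) :=
    fun i => constField_mem he (ha i)
  have hμ : ∀ l j : ℕ, T.μ l (fun i => constField e deg (a (j + i))) ∈
      vectorFieldsOfDegree k deg (∑ i : Fin l, c (j + i) + 2 - l - 2) :=
    fun l j => T.μ_mem l _ _ fun i => hX _
  have hM := hμ n 0
  simp only [zero_add, Fin.sum_univ_eq_sum_range] at hM
  rw [T.stasheffSum_eq hn hX, map_add, map_add, add_apply, add_apply,
    taylor_bracket he T.Q_mem hM hb]
  simp only [smul_sub, sum_sub_distrib]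
  have h1 : ∀ S : Finset (Fin N), sgn k (unshuffle d S) •
      sgn k (∑ i ∈ range n, c i + 2 - n - 2) • taylor e deg (Sᶜ.card + 1)
          (T.μ n fun i => constField e deg (a i))
            (Fin.cons (taylor e deg S.card T.Q (sub b S)) (sub b Sᶜ)) =
      sgn k (unshuffle d S) • sgn k (∑ i ∈ range n, c i - n) •
            T.gerstμ e n (Sᶜ.card + 1)
              (Sum.elim (fun i => a i) (Fin.cons (T.gerstν e S.card (sub b S)) (sub b Sᶜ))) := by
    intro S
    rw [T.gerstμ_apply hn]
    congr 3
    ring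
  have h1' : ∀ S : Finset (Fin N), sgn k (unshuffle d S) • taylor e deg (Sᶜ.card + 1) T.Q
      (Fin.cons (taylor e deg S.card (T.μ n fun i => constField e deg (a i)) (sub b S))
        (sub b Sᶜ)) =
      sgn k (unshuffle d S) • T.gerstν e (Sᶜ.card + 1)
          (Fin.cons (T.gerstμ e n S.card (Sum.elim (fun i => a i) (sub b S))) (sub b Sᶜ)) := by
    intro S
    rw [T.gerstμ_apply hn]
    rfl
  have h2 : taylor e deg N (∑ j ∈ range n, sgn k (n - 1 + ∑ i ∈ range j, c i) •
        T.μ n (fun i => splice (fun i => constField e deg (a i)) j 1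
          (bracket 1 (c j - 2) T.Q (constField e deg (a j))) i)) b =
      ∑ S : Finset (Fin N), sgn k (unshuffle d S) • ∑ j ∈ range n,
            sgn k (∑ i ∈ range j, c i
                + (∑ i ∈ Ico (j + 1) n, c i) * (∑ i ∈ S, d i) - n) •
              T.gerstμ e n Sᶜ.card
                (Sum.elim (fun i => splice a j 1
                    (T.gerstν e (S.card + 1) (Fin.cons (a j) (sub b S))) i)
                  (sub b Sᶜ)) := by
    simp only [smul_sum]
    rw [map_sum, _root_.sum_apply, sum_comm]
    refine sum_congr rfl fun j hj => ?_
    have hW : (fun γ => dirDeriv e deg (a j) (T.Q γ)) ∈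
        vectorFieldsOfDegree k deg (1 + c j - 2) := by
      rw [mem_vectorFieldsOfDegree]
      intro γ
      have := dirDeriv_mem he (ha j) (mem_vectorFieldsOfDegree.1 T.Q_mem γ)
      convert this using 2
      ring
    rw [bracket_constField, ← neg_smul, map_smul, smul_apply,
      T.taylor_μ_splice he hn (mem_range.1 hj) rfl ha (Submodule.smul_mem _ _ hW) hb, smul_sum]
    refine sum_congr rfl fun S _ => ?_
    have hx : taylor e deg S.card (-sgn k (c j - 2) • fun γ => dirDeriv e deg (a j) (T.Q γ))
        (sub b S) = (-1 : k) • T.gerstν e (S.card + 1) (Fin.cons (a j) (sub b S)) := by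
      rw [map_smul, smul_apply, taylor_dirDeriv he T.Q_mem (ha j) (sub_mem he hb S), smul_smul,
        mul_one, sgn_congr (a := c j - 2) (b := c j), neg_mul, sgn_mul_self]
      · rfl
      · push_cast
        generalize (c j : ZMod 2) = x
        revert x
        decide
    rw [hx, T.gerstμ_apply hn, T.gerstμ_apply hn]
    simp only [comp_splice (constField e deg)]
    rw [splice_eq_update _ j 1 n (mem_range.1 hj) _ 0,
      splice_eq_update _ j 1 n (mem_range.1 hj) (constField e deg (T.gerstν e _ _)) 0, map_smul,
      MultilinearMap.map_update_smul, map_smul, smul_apply, smul_smul, smul_smul, smul_smul]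
    congr 1
    rw [mul_neg_one, ← sgn_add, ← sgn_add, eq_comm]
    apply sgn_eq_neg
    push_cast
    generalize (unshuffle d S : ZMod 2) = u
    generalize (∑ i ∈ S, (d i : ZMod 2)) = s
    generalize (∑ i ∈ range j, (c i : ZMod 2)) = x
    generalize (∑ i ∈ Ico (j + 1) n, (c i : ZMod 2)) = y
    generalize (n : ZMod 2) = m
    revert u s x y m
    decide
  have h3 : taylor e deg N (∑ p ∈ HasAntidiagonal.antidiagonal (n + 1) with 2 ≤ p.1 ∧ 2 ≤ p.2,
      ∑ j ∈ range p.1, sgn k (j + p.2 * (n - j - p.2) + p.2 * ∑ i ∈ range j, c i) •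
        T.μ p.1 (fun i => splice (fun i => constField e deg (a i)) j p.2
          (T.μ p.2 (fun i => constField e deg (a (j + i)))) i)) b =
      ∑ p ∈ HasAntidiagonal.antidiagonal (n + 1) with 2 ≤ p.1 ∧ 2 ≤ p.2, ∑ j ∈ range p.1,
      ∑ S : Finset (Fin N), sgn k (unshuffle d S) •
        sgn k (j + p.2 * (n - j - p.2) + p.2 * ∑ i ∈ range j, c i
            + (∑ i ∈ Ico (j + p.2) n, c i) * (∑ i ∈ S, d i)) •
          T.gerstμ e p.1 Sᶜ.card
            (Sum.elim
              (fun i => splice a j p.2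
                (T.gerstμ e p.2 S.card (Sum.elim (fun i => a (j + i)) (sub b S))) i)
              (sub b Sᶜ)) := by
    rw [map_sum, _root_.sum_apply]
    refine sum_congr rfl fun p hp => ?_
    rw [mem_filter, HasAntidiagonal.mem_antidiagonal] at hp
    rw [map_sum, _root_.sum_apply]
    refine sum_congr rfl fun j hj => ?_
    rw [map_smul, smul_apply,
      T.taylor_μ_splice he hp.2.1 (mem_range.1 hj) hp.1 ha (hμ p.2 j) hb, smul_sum]
    refine sum_congr rfl fun S _ => ?_
    rw [T.gerstμ_apply hp.2.2, smul_smul, smul_smul, ← sgn_add, ← sgn_add]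
    congr 2
    ring
  simp only [h1, h1']
  rw [h2, h3]
  abel

end TensorStructure

/-! ### Taylor's theorem for formal graded functions -/

section TaylorCoefficients

variable {ι k : Type*} [Field k] [Fintype ι] [LinearOrder ι] {deg : ι → ℤ}

/-- The value at the origin of `∂_{β_n} ⋯ ∂_{β_1} f`. -/
noncomputable def taylorCoeff : (n : ℕ) → (Fin n → ι) → Functions k deg → k
  | 0, _, f => coeff f 0
  | n + 1, β, f => taylorCoeff n (Fin.tail β) (partialDeriv (β 0) f)

/-- One coordinate of t^m is stripped off at a time. Each step divides by a sign and an exponent,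
which is nonzero in characteristic 0; neither `β` nor `c` depends on `f`. -/
theorem exists_coeff_eq_mul_taylorCoeff [CharZero k] (n : ℕ) (m : ι →₀ ℕ) (hm : m.degree = n) :
    ∃ (β : Fin n → ι) (c : k), ∀ f : Functions k deg, coeff f m = c * taylorCoeff n β f := by
  induction n generalizing m with
  | zero =>
    rw [Finsupp.degree_eq_zero_iff] at hm
    subst hm
    exact ⟨Fin.elim0, 1, fun f => (one_mul _).symm⟩
  | succ n ih =>
    obtain ⟨α, hα⟩ : ∃ α, m α ≠ 0 := by
      by_contra h
      push Not at h
      have : m = 0 := Finsupp.ext h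
      simp [this] at hm
    obtain ⟨m', rfl⟩ : ∃ m', m = m' + Finsupp.single α 1 := by
      refine ⟨m - Finsupp.single α 1, (tsub_add_cancel_of_le ?_).symm⟩
      rw [Finsupp.single_le_iff]
      omega
    obtain ⟨β, c, h⟩ := ih m' (by simpa using hm)
    refine ⟨Fin.cons α β, (sgn k (deg α * ∑ β with β < α, m' β * deg β) * (m' α + 1 : k))⁻¹ * c,
      fun f => ?_⟩
    have h0 : sgn k (deg α * ∑ β with β < α, m' β * deg β) * (m' α + 1 : k) ≠ 0 :=
      mul_ne_zero (sgn_ne_zero _) (Nat.cast_add_one_ne_zero _)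
    rw [taylorCoeff, Fin.cons_zero, Fin.tail_cons, mul_assoc, ← h, coeff_partialDeriv,
      ← mul_assoc (sgn k _), inv_mul_cancel_left₀ h0]

theorem taylorCoeff_congr {n : ℕ} (β : Fin n → ι) {f g : Functions k deg}
    (h : ∀ m, m.degree = n → coeff f m = coeff g m) : taylorCoeff n β f = taylorCoeff n β g := by
  induction n generalizing f g with
  | zero => exact h 0 (by simp)
  | succ n ih =>
    refine ih _ fun m hm => ?_
    rw [coeff_partialDeriv, coeff_partialDeriv, h _ (by simp [hm])]

theorem taylorCoeff_smul {n : ℕ} (β : Fin n → ι) (c : k) (f : Functions k deg) :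
    taylorCoeff n β (c • f) = c * taylorCoeff n β f := by
  induction n generalizing f with
  | zero => rfl
  | succ n ih =>
    simp only [taylorCoeff, ← partialHom_apply, map_smul, ih]

/-- Graded symmetry of a function of `n` indices. -/
def IsGradedSymm (deg : ι → ℤ) {n : ℕ} (ψ : (Fin n → ι) → k) : Prop :=
  ∀ (β : Fin n → ι) (i j : Fin n), (j : ℕ) = i + 1 →
    ψ (β ∘ Equiv.swap i j) = sgn k (deg (β i) * deg (β j)) * ψ β

theorem tail_comp_swap_succ {A : Type*} {n : ℕ} (β : Fin (n + 1) → A) (i j : Fin n) :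
    Fin.tail (β ∘ Equiv.swap i.succ j.succ) = Fin.tail β ∘ Equiv.swap i j := by
  funext x
  simp only [Fin.tail, Function.comp_apply]
  rw [(Fin.succ_injective n).swap_apply]

theorem IsGradedSymm.cons {n : ℕ} {ψ : (Fin (n + 1) → ι) → k} (h : IsGradedSymm deg ψ) (α : ι) :
    IsGradedSymm deg fun β => ψ (Fin.cons α β) := by
  intro β i j hij
  have := h (Fin.cons α β) i.succ j.succ (by simpa using hij)
  rw [Fin.cons_succ, Fin.cons_succ] at this
  refine Eq.trans (congrArg ψ ?_) this
  funext x
  refine Fin.cases ?_ (fun x => ?_) x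
  · rw [Function.comp_apply,
      Equiv.swap_apply_of_ne_of_ne (Fin.succ_ne_zero _).symm (Fin.succ_ne_zero _).symm]
    rfl
  · rw [Function.comp_apply, (Fin.succ_injective n).swap_apply]
    rfl

theorem IsGradedSymm.cons_cons {n : ℕ} {ψ : (Fin (n + 2) → ι) → k} (h : IsGradedSymm deg ψ)
    (α γ : ι) (β : Fin n → ι) :
    ψ (Fin.cons γ (Fin.cons α β)) =
      sgn k (deg α * deg γ) * ψ (Fin.cons α (Fin.cons γ β)) := by
  have := h (Fin.cons α (Fin.cons γ β)) 0 (Fin.succ 0) rfl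
  rw [Fin.cons_zero, Fin.cons_succ, Fin.cons_zero] at this
  rw [← this]
  congr 1
  funext x
  refine Fin.cases ?_ (fun x => Fin.cases ?_ (fun x => ?_) x) x
  · simp
  · simp
  · rw [Function.comp_apply, Equiv.swap_apply_of_ne_of_ne (Fin.succ_ne_zero _)
      fun h => Fin.succ_ne_zero _ (Fin.succ_injective _ h)]
    rfl

theorem isGradedSymm_taylorCoeff (n : ℕ) (f : Functions k deg) :
    IsGradedSymm deg fun β : Fin n → ι => taylorCoeff n β f := by
  intro β i j hij
  induction n generalizing f with
  | zero => exact i.elim0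
  | succ n ih =>
    obtain ⟨j, rfl⟩ := Fin.exists_succ_eq.2 (show j ≠ 0 from fun h => by simp [h] at hij)
    rcases Fin.eq_zero_or_eq_succ i with rfl | ⟨i, rfl⟩
    · cases n with
      | zero => exact j.elim0
      | succ n =>
        have hj : j = 0 := by
          ext
          simpa using hij
        subst hj
        have h1 : Fin.tail (Fin.tail (β ∘ Equiv.swap 0 (Fin.succ 0))) = Fin.tail (Fin.tail β) := by
          funext x
          simp only [Fin.tail, Function.comp_apply]
          rw [Equiv.swap_apply_of_ne_of_ne]
          · exact Fin.succ_ne_zero _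
          · exact fun h => Fin.succ_ne_zero _ (Fin.succ_injective _ h)
        simp only [taylorCoeff, h1]
        simp only [Fin.tail, Function.comp_apply, Equiv.swap_apply_left, Equiv.swap_apply_right]
        rw [partialDeriv_comm, taylorCoeff_smul]
    · have := ih (partialDeriv (β 0) f) (Fin.tail β) i j (by simpa using hij)
      simp only [taylorCoeff, tail_comp_swap_succ]
      simp only [Function.comp_apply]
      rw [Equiv.swap_apply_of_ne_of_ne (Fin.succ_ne_zero _).symm (Fin.succ_ne_zero _).symm]
      exact this

theorem coordProd_cons {n : ℕ} (α : ι) (β : Fin n → ι) :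
    coordProd k deg (Fin.cons α β : Fin (n + 1) → ι) = coord k deg α * coordProd k deg β := by
  simp [coordProd, List.ofFn_succ]

theorem coeff_coord (α : ι) (m : ι →₀ ℕ) :
    coeff (coord k deg α) m = if m = Finsupp.single α 1 then 1 else 0 := by
  classical
  have h : IsMon deg (Finsupp.single α 1) := by
    intro β _
    rw [Finsupp.single_apply]
    split_ifs <;> simp
  simp [coord, coeff, monomial, h]

theorem coord_mem (α : ι) : coord k deg α ∈ functionsOfDegree k deg (2 - deg α) := by
  intro m hm
  rw [coeff_coord] at hm
  have : m = Finsupp.single α 1 := by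
    by_contra h
    simp [h] at hm
  rw [this, monDeg_single]

theorem coordProd_mem {n : ℕ} (β : Fin n → ι) :
    coordProd k deg β ∈ functionsOfDegree k deg (2 * n - ∑ i, deg (β i)) := by
  induction n with
  | zero => simpa [coordProd] using one_mem_functionsOfDegree
  | succ n ih =>
    rw [← Fin.cons_self_tail β, coordProd_cons, Fin.sum_univ_succ]
    have := mul_mem_functionsOfDegree (coord_mem (k := k) (β 0)) (ih (Fin.tail β))
    convert this using 2
    simp only [Fin.cons_zero, Fin.cons_succ]
    push_cast
    ring

theorem coeff_coordProd {n : ℕ} (β : Fin n → ι) {m : ι →₀ ℕ} (h : m.degree ≠ n) :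
    coeff (coordProd k deg β) m = 0 := by
  induction n generalizing m with
  | zero =>
    have : m ≠ 0 := by
      rintro rfl
      simp at h
    simp [coordProd, coeff_one, this]
  | succ n ih =>
    rw [← Fin.cons_self_tail β, coordProd_cons]
    by_cases hm : IsMon deg m
    swap
    · exact coeff_of_not_isMon _ hm
    rw [coeff_mul _ _ hm]
    refine sum_eq_zero fun x hx => ?_
    rw [coeff_coord]
    split_ifs with h1
    · rw [ih, mul_zero, smul_zero]
      rw [← HasAntidiagonal.mem_antidiagonal.1 hx, h1] at h
      intro h2
      apply h
      simp [h2, add_comm]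
    · rw [zero_mul, smul_zero]

theorem partialDeriv_coord (α γ : ι) :
    partialDeriv α (coord k deg γ) = if γ = α then 1 else 0 := by
  refine Functions.ext' fun m _ => ?_
  rw [coeff_partialDeriv, coeff_coord]
  by_cases h : γ = α
  · subst h
    rw [if_pos rfl, coeff_one]
    by_cases hm : m = 0
    · simp [hm]
    · simp [hm]
  · rw [if_neg, if_neg h, coeff_zero, mul_zero, mul_zero]
    intro h'
    have := DFunLike.congr_fun h' α
    simp [h] at this

/-- The polynomial function with given Taylor coefficients of order `n`. -/
noncomputable def polyTerm (deg : ι → ℤ) (n : ℕ) (ψ : (Fin n → ι) → k) : Functions k deg :=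
  (n.factorial : k)⁻¹ • ∑ β : Fin n → ι, ψ β • coordProd k deg β

theorem sum_fin_succ_fun {M : Type*} [AddCommMonoid M] {n : ℕ} (F : (Fin (n + 1) → ι) → M) :
    ∑ β, F β = ∑ γ, ∑ β : Fin n → ι, F (Fin.cons γ β) := by
  rw [← (Fin.consEquiv fun _ => ι).sum_comp, Fintype.sum_prod_type]
  rfl

/-- By graded symmetry each of the n + 1 factors contributes the same amount: the first factor gives
1, and the induction hypothesis applied behind it gives n. -/
theorem partialDeriv_sum_coordProd {n : ℕ} {ψ : (Fin (n + 1) → ι) → k} (h : IsGradedSymm deg ψ)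
    (α : ι) :
    partialDeriv α (∑ β : Fin (n + 1) → ι, ψ β • coordProd k deg β) =
      (n + 1 : k) • ∑ β : Fin n → ι, ψ (Fin.cons α β) • coordProd k deg β := by
  induction n generalizing α with
  | zero =>
    rw [sum_fin_succ_fun, ← partialHom_apply]
    simp only [Fintype.sum_unique, map_sum, map_smul, coordProd_cons]
    rw [sum_eq_single α]
    · simp [coordProd, partialHom_apply, partialDeriv_coord]
    · intro γ _ hγ
      simp [coordProd, partialHom_apply, partialDeriv_coord, hγ]
    · simp
  | succ n ih =>
    rw [sum_fin_succ_fun, ← partialHom_apply, map_sum]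
    have h1 : ∀ γ ∈ univ, partialHom k deg α (∑ β : Fin (n + 1) → ι,
        ψ (Fin.cons γ β) • coordProd k deg (Fin.cons γ β : Fin (n + 2) → ι)) =
        (if γ = α then ∑ β : Fin (n + 1) → ι, ψ (Fin.cons γ β) • coordProd k deg β else 0) +
        (n + 1 : k) • ∑ β : Fin n → ι, ψ (Fin.cons α (Fin.cons γ β)) •
          coordProd k deg (Fin.cons γ β : Fin (n + 1) → ι) := by
      intro γ _
      have h2 : ∑ β : Fin (n + 1) → ι,
          ψ (Fin.cons γ β) • coordProd k deg (Fin.cons γ β : Fin (n + 2) → ι) =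
          coord k deg γ * ∑ β : Fin (n + 1) → ι, ψ (Fin.cons γ β) • coordProd k deg β := by
        rw [mul_sum]
        exact sum_congr rfl fun β _ => by rw [coordProd_cons, mul_smul']
      rw [h2, partialHom_apply, partialDeriv_mul, partialDeriv_coord, twist_of_mem (coord_mem γ),
        ih (h.cons γ)]
      congr 1
      · split_ifs <;> simp
      · rw [smul_mul', mul_smul', smul_comm, mul_sum, smul_sum]
        congr 1
        refine sum_congr rfl fun β _ => ?_
        -- Moving ∂_α past t^γ and exchanging the first two indices of ψ cost the same sign, which
        -- cancels.
        rw [mul_smul', ← coordProd_cons, smul_smul, h.cons_cons, ← mul_assoc, ← sgn_add,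
          sgn_congr (b := 0), sgn_zero, one_mul]
        push_cast
        have h3 : (2 : ZMod 2) = 0 := rfl
        rw [h3]
        ring
    rw [sum_congr rfl h1, sum_add_distrib, sum_ite_eq' univ α, if_pos (mem_univ _), ← smul_sum,
      ← sum_fin_succ_fun (fun β => ψ (Fin.cons α β) • coordProd k deg β)]
    push_cast
    module

theorem taylorCoeff_polyTerm [CharZero k] {n : ℕ} {ψ : (Fin n → ι) → k} (h : IsGradedSymm deg ψ)
    (β : Fin n → ι) : taylorCoeff n β (polyTerm deg n ψ) = ψ β := by
  induction n with
  | zero =>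
    rw [taylorCoeff, polyTerm, Fintype.sum_unique, coeff_smul, coeff_smul]
    simp [coordProd, coeff_one, Subsingleton.elim β default]
  | succ n ih =>
    rw [taylorCoeff]
    have : partialDeriv (β 0) (polyTerm deg (n + 1) ψ) =
        polyTerm deg n fun γ => ψ (Fin.cons (β 0) γ) := by
      rw [polyTerm, ← partialHom_apply, map_smul, partialHom_apply, partialDeriv_sum_coordProd h,
        smul_smul, polyTerm]
      congr 1
      rw [Nat.factorial_succ, Nat.cast_mul, mul_inv]
      have : ((n + 1 : ℕ) : k) ≠ 0 := Nat.cast_ne_zero.2 (Nat.succ_ne_zero n)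
      push_cast at this ⊢
      field_simp
    rw [this, ih (h.cons _), Fin.cons_self_tail]

theorem coeff_polyTerm {n : ℕ} (ψ : (Fin n → ι) → k) {m : ι →₀ ℕ} (h : m.degree ≠ n) :
    coeff (polyTerm deg n ψ) m = 0 := by
  rw [polyTerm, coeff_smul, coeff_sum, sum_eq_zero, mul_zero]
  intro β _
  rw [coeff_smul, coeff_coordProd β h, mul_zero]

/-- Only the term of order |m| reaches t^m, and there both sides have the same Taylor coefficients.
-/
theorem coeff_eq_coeff_sum_polyTerm [CharZero k] (f : Functions k deg) (m : ι →₀ ℕ) :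
    coeff f m = coeff (∑ n ∈ range (m.degree + 1),
      polyTerm deg n fun β => taylorCoeff n β f) m := by
  rw [coeff_sum, sum_eq_single m.degree]
  · obtain ⟨β, c, h⟩ := exists_coeff_eq_mul_taylorCoeff (k := k) (deg := deg) m.degree m rfl
    rw [h, h, taylorCoeff_polyTerm (isGradedSymm_taylorCoeff _ f)]
  · exact fun n _ hn => coeff_polyTerm _ hn.symm
  · simp

/-- The polynomials of the various orders are summed formally: the coefficient at t^m is taken from
the one of order |m|. Homogeneity, from `hp`, supplies the finiteness of degrees demanded of a
function. -/
theorem exists_taylorCoeff_eq [CharZero k] (p : ℤ) (ψ : (n : ℕ) → (Fin n → ι) → k)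
    (h : ∀ n, IsGradedSymm deg (ψ n))
    (hp : ∀ n β, ψ n β ≠ 0 → 2 * (n : ℤ) - ∑ i, deg (β i) = p) :
    ∃ f ∈ functionsOfDegree k deg p, ∀ n β, taylorCoeff n β f = ψ n β := by
  have hT : ∀ n, polyTerm deg n (ψ n) ∈ functionsOfDegree k deg p := by
    intro n
    refine Submodule.smul_mem _ _ (Submodule.sum_mem _ fun β _ => ?_)
    by_cases h0 : ψ n β = 0
    · simp [h0]
    · exact Submodule.smul_mem _ _ (hp n β h0 ▸ coordProd_mem β)
  refine ⟨⟨fun m => coeff (polyTerm deg m.degree (ψ m.degree)) m,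
    fun m hm => coeff_of_not_isMon _ hm, (Set.finite_singleton p).subset ?_⟩, ?_, fun n β => ?_⟩
  · rintro d ⟨m, hm, rfl⟩
    exact hT _ m hm
  · exact fun m hm => hT _ m hm
  · rw [← taylorCoeff_polyTerm (h n) β]
    refine taylorCoeff_congr β fun m hm => ?_
    subst hm
    rfl

theorem Functions.ext_taylorCoeff [CharZero k] {f g : Functions k deg}
    (h : ∀ n (β : Fin n → ι), taylorCoeff n β f = taylorCoeff n β g) : f = g := by
  refine Functions.ext' fun m _ => ?_
  obtain ⟨β, c, hc⟩ := exists_coeff_eq_mul_taylorCoeff (k := k) (deg := deg) m.degree m rfl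
  rw [hc, hc, h]

/-- Twice the double sum is the square of the sum minus the sum of squares, hence invariant under
permutations. Multiplying by this sign thus preserves graded symmetry. -/
theorem pullSign_comp_equiv {n : ℕ} (r : ℤ) (β : Fin n → ι) (σ : Equiv.Perm (Fin n)) :
    pullSign deg r (β ∘ σ) = pullSign deg r β := by
  have key : ∀ β : Fin n → ι, 2 * ∑ i, ∑ j with j < i, deg (β i) * deg (β j) =
      (∑ i, deg (β i)) ^ 2 - ∑ i, deg (β i) ^ 2 := by
    intro β
    have h1 : ∑ i, ∑ j with j < i, deg (β i) * deg (β j) =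
        ∑ i, ∑ j with i < j, deg (β i) * deg (β j) := by
      simp only [sum_filter]
      rw [sum_comm]
      exact sum_congr rfl fun i _ => sum_congr rfl fun j _ => by rw [mul_comm]
    have h2 : (∑ i, deg (β i)) ^ 2 = ∑ i, (deg (β i) ^ 2 + ∑ j with j < i, deg (β i) * deg (β j) +
        ∑ j with i < j, deg (β i) * deg (β j)) := by
      rw [sq, sum_mul]
      refine sum_congr rfl fun i _ => ?_
      rw [mul_sum, ← add_sum_erase univ _ (mem_univ i), add_assoc, sq]
      congr 1
      rw [← sum_union]
      · refine sum_congr ?_ fun _ _ => rfl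
        ext j
        simp only [mem_erase, mem_univ, and_true, mem_union, mem_filter, true_and]
        exact ne_iff_lt_or_gt
      · rw [disjoint_filter]
        exact fun i _ h => h.not_gt
    rw [h2, sum_add_distrib, sum_add_distrib, ← h1]
    ring
  have e1 : ∑ i, deg ((β ∘ σ) i) = ∑ i, deg (β i) := Equiv.sum_comp σ fun i => deg (β i)
  have e2 : ∑ i, deg ((β ∘ σ) i) ^ 2 = ∑ i, deg (β i) ^ 2 := Equiv.sum_comp σ fun i => deg (β i) ^ 2
  have h1 := key (β ∘ σ)
  rw [e1, e2, ← key β] at h1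
  rw [pullSign, pullSign, e1]
  omega

theorem pullSign_succ {n : ℕ} (r : ℤ) (β : Fin (n + 1) → ι) :
    pullSign deg r β = r * deg (β 0) + deg (β 0) * ∑ i, deg (Fin.tail β i) +
      pullSign deg r (Fin.tail β) := by
  simp only [pullSign, sum_filter, Fin.sum_univ_succ, Fin.tail]
  simp only [Fin.not_lt_zero, if_false, sum_const_zero, add_zero, zero_add, Fin.succ_pos, if_true,
    Fin.succ_lt_succ_iff, sum_add_distrib, mul_sum, mul_add, mul_comm _ (deg (β 0))]
  ring

end TaylorCoefficients

/-! ### Vector fields as sequences of symmetric multilinear maps -/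

section Taylor

variable {ι k V : Type*} [Field k] [AddCommGroup V] [Module k V] [Fintype ι] [LinearOrder ι]
  {𝒱 : ℤ → Submodule k V} [DirectSum.Decomposition 𝒱] {e : Module.Basis ι k V} {deg : ι → ℤ}
  (he : ∀ α, e α ∈ 𝒱 (deg α))
include he

/-- `taylorCoeff` applies the derivatives in the opposite order to `iterDeriv`, and the sign is that
of reversing them. -/
theorem coeff_iterDeriv_basis {n : ℕ} (β : Fin n → ι) (f : Functions k deg) :
    coeff (iterDeriv e deg n (fun i => e (β i)) f) 0 =
      sgn k (pullSign deg 0 β) * taylorCoeff n β f := by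
  induction n generalizing f with
  | zero => simp [iterDeriv_zero, taylorCoeff, pullSign]
  | succ n ih =>
    rw [iterDeriv_succ, dirDeriv_iterDeriv_comm he (he (β 0)) (b := Fin.tail fun i => e (β i))
      (d := fun i => deg (Fin.tail β i)) (fun i => he _), LinearMap.smul_apply,
      Module.End.mul_apply, coeff_smul, dirDeriv_basis, taylorCoeff]
    have := ih (Fin.tail β) (partialDeriv (β 0) f)
    change coeff (iterDeriv e deg n (Fin.tail fun i => e (β i)) _) 0 = _ at this
    rw [this, ← mul_assoc, ← sgn_add, pullSign_succ, zero_mul, zero_add]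

/-- This compares the multilinear Taylor coefficient with plain partial derivatives. The signs
cancel because a nonzero term has ∑ deg β_i ≡ x + deg α, and (x + deg α)(x + deg α + 1) is even. -/
theorem sgn_mul_repr_taylor {X : VectorField k deg} {x r : ℤ}
    (hX : X ∈ vectorFieldsOfDegree k deg x) (hr : (r : ZMod 2) = x) {n : ℕ} (β : Fin n → ι)
    (α : ι) :
    sgn k (pullSign deg r β) * e.repr (taylor e deg n X fun i => e (β i)) α =
      taylorCoeff n β (X α) := by
  have hb : ∀ i, e (β i) ∈ 𝒱 (deg (β i)) := fun i => he _
  rw [repr_taylor he X hb]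
  have h := coeff_iterDeriv_basis he β (X α)
  by_cases h0 : coeff (iterDeriv e deg n (fun i => e (β i)) (X α)) 0 = 0
  · rw [h0] at h ⊢
    rcases mul_eq_zero.1 h.symm with h | h
    · exact absurd h (sgn_ne_zero _)
    · rw [h, mul_zero, mul_zero]
  have h1 := coeff_iterDeriv_parity he hb (mem_vectorFieldsOfDegree.1 hX α) h0
  rw [h, ← mul_assoc, ← mul_assoc, ← sgn_add, ← sgn_add, sgn_congr (b := 0), sgn_zero, one_mul]
  simp only [pullSign]
  push_cast at h1 ⊢
  rw [h1, hr]
  have h3 : (2 : ZMod 2) = 0 := rfl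
  rw [h3]
  generalize ∑ i, ∑ j with j < i, (deg (β i) : ZMod 2) * (deg (β j) : ZMod 2) = u
  generalize (x : ZMod 2) = x
  generalize (deg α : ZMod 2) = a
  revert u x a
  decide

theorem VectorField.ext_taylor [CharZero k] {X Y : VectorField k deg}
    (h : ∀ n (β : Fin n → ι), taylor e deg n X (fun i => e (β i)) =
      taylor e deg n Y fun i => e (β i)) : X = Y := by
  funext α
  refine Functions.ext_taylorCoeff fun n β => ?_
  have hb : ∀ i, e (β i) ∈ 𝒱 (deg (β i)) := fun i => he _
  have h1 := congrArg (fun v => e.repr v α) (h n β)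
  simp only [repr_taylor he _ hb, coeff_iterDeriv_basis he] at h1
  exact mul_left_cancel₀ (sgn_ne_zero _) (mul_left_cancel₀ (sgn_ne_zero _) h1)

theorem exists_taylor_eq [CharZero k] (x : ℤ)
    (φ : (n : ℕ) → MultilinearMap k (fun _ : Fin n => V) V)
    (hφ : ∀ (n : ℕ) (b : Fin n → V) (d : Fin n → ℤ), (∀ i, b i ∈ 𝒱 (d i)) →
      φ n b ∈ 𝒱 (x + 2 + ∑ i, d i - 2 * n))
    (hs : ∀ (n : ℕ) (b : Fin n → V) (d : Fin n → ℤ), (∀ i, b i ∈ 𝒱 (d i)) →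
      ∀ i j : Fin n, (j : ℕ) = i + 1 →
        φ n (b ∘ Equiv.swap i j) = Int.negOnePow (d i * d j) • φ n b) :
    ∃ X ∈ vectorFieldsOfDegree k deg x, ∀ n, taylor e deg n X = φ n := by
  have h1 : ∀ α, ∃ f ∈ functionsOfDegree k deg (x - (deg α - 2)), ∀ n β, taylorCoeff n β f =
      sgn k (pullSign deg x β) * e.repr (φ n fun i => e (β i)) α := by
    intro α
    refine exists_taylorCoeff_eq _
      (fun n β => sgn k (pullSign deg x β) * e.repr (φ n fun i => e (β i)) α)
      (fun n β i j hij => ?_) (fun n β h => ?_)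
    · have := hs n (fun i => e (β i)) (fun i => deg (β i)) (fun i => he _) i j hij
      dsimp only
      rw [pullSign_comp_equiv]
      change _ * e.repr (φ n ((fun i => e (β i)) ∘ Equiv.swap i j)) α = _
      rw [this, negOnePow_smul (k := k), map_smul, Finsupp.smul_apply, smul_eq_mul, mul_left_comm]
    · by_contra hne
      refine right_ne_zero_of_mul h (repr_eq_zero_of_mem e he
        (hφ n (fun i => e (β i)) (fun i => deg (β i)) fun i => he _) ?_)
      omega
  choose X hX hX' using h1
  have hXm : X ∈ vectorFieldsOfDegree k deg x := mem_vectorFieldsOfDegree.2 hX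
  refine ⟨X, hXm, fun n => Module.Basis.ext_multilinear (fun _ => e)
    fun β => e.repr.injective (Finsupp.ext fun α => ?_)⟩
  have := sgn_mul_repr_taylor he hXm rfl β α
  rw [hX'] at this
  exact mul_left_cancel₀ (sgn_ne_zero _) this

end Taylor

/-! ### Vector fields as derivations, the bracket and the Lie derivative -/

section Bracket

variable {ι k : Type*} [Field k] [Fintype ι] [LinearOrder ι] {deg : ι → ℤ}

instance : SMulCommClass (Functions k deg) k (VectorField k deg) :=
  ⟨fun f c X => funext fun α => mul_smul' c f (X α)⟩

instance : SMulCommClass k (Functions k deg) (VectorField k deg) :=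
  ⟨fun c f X => funext fun α => (mul_smul' c f (X α)).symm⟩

instance : IsScalarTower k (Functions k deg) (VectorField k deg) :=
  ⟨fun c f X => funext fun α => smul_mul' c f (X α)⟩

theorem VectorField.act_add (X : VectorField k deg) (f g : Functions k deg) :
    X.act (f + g) = X.act f + X.act g := by
  simp only [VectorField.act, ← partialHom_apply, map_add, mul_add, sum_add_distrib]

theorem VectorField.act_smul (X : VectorField k deg) (c : k) (f : Functions k deg) :
    X.act (c • f) = c • X.act f := by
  simp only [VectorField.act, ← partialHom_apply, map_smul, mul_smul', smul_sum]

/-- The derivative along a vector field as a linear map. -/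
noncomputable def VectorField.actHom (X : VectorField k deg) :
    Functions k deg →ₗ[k] Functions k deg where
  toFun := X.act
  map_add' := X.act_add
  map_smul' := X.act_smul

theorem VectorField.actHom_apply (X : VectorField k deg) (f : Functions k deg) :
    X.actHom f = X.act f := rfl

theorem smul_act (f : Functions k deg) (X : VectorField k deg) (g : Functions k deg) :
    (f • X).act g = f * X.act g := by
  simp only [VectorField.act, mul_sum, Pi.smul_apply, smul_eq_mul, mul_assoc]

theorem act_mem {x p : ℤ} {X : VectorField k deg} (hX : X ∈ vectorFieldsOfDegree k deg x)
    {f : Functions k deg} (hf : f ∈ functionsOfDegree k deg p) :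
    X.act f ∈ functionsOfDegree k deg (x + p) := by
  refine Submodule.sum_mem _ fun γ _ => ?_
  have := mul_mem_functionsOfDegree (mem_vectorFieldsOfDegree.1 hX γ) (partialDeriv_mem hf γ)
  convert this using 2
  ring

theorem act_mul {x p : ℤ} {X : VectorField k deg} (hX : X ∈ vectorFieldsOfDegree k deg x)
    {f : Functions k deg} (hf : f ∈ functionsOfDegree k deg p) (g : Functions k deg) :
    X.act (f * g) = X.act f * g + sgn k (x * p) • (f * X.act g) := by
  simp only [VectorField.act, sum_mul, mul_sum, smul_sum, ← sum_add_distrib]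
  refine sum_congr rfl fun γ _ => ?_
  rw [partialDeriv_mul, twist_of_mem hf, mul_add, ← mul_assoc, smul_mul', mul_smul', ← mul_assoc,
    mul_comm_graded (mem_vectorFieldsOfDegree.1 hX γ) hf, smul_mul', smul_smul, ← sgn_add,
    ← mul_assoc]
  congr 2
  apply sgn_congr
  push_cast
  have h2 : (2 : ZMod 2) = 0 := rfl
  rw [h2]
  generalize (deg γ : ZMod 2) = c
  generalize (x : ZMod 2) = x
  generalize (p : ZMod 2) = p
  revert c x p
  decide

theorem bracket_eq (p q : ℤ) (X Y : VectorField k deg) (α : ι) :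
    bracket p q X Y α = X.act (Y α) - sgn k (p * q) • Y.act (X α) := by
  rw [bracket, negOnePow_smul (k := k)]

theorem bracket_mem {p q : ℤ} {X Y : VectorField k deg} (hX : X ∈ vectorFieldsOfDegree k deg p)
    (hY : Y ∈ vectorFieldsOfDegree k deg q) :
    bracket p q X Y ∈ vectorFieldsOfDegree k deg (p + q) := by
  rw [mem_vectorFieldsOfDegree] at *
  intro α
  rw [bracket_eq]
  refine Submodule.sub_mem _ ?_ (Submodule.smul_mem _ _ ?_)
  · have := act_mem (mem_vectorFieldsOfDegree.2 hX) (hY α)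
    convert this using 2
    ring
  · have := act_mem (mem_vectorFieldsOfDegree.2 hY) (hX α)
    convert this using 2
    ring

theorem bracket_smul_right (p q : ℤ) (X Y : VectorField k deg) (c : k) :
    bracket p q X (c • Y) = c • bracket p q X Y := by
  funext α
  have h : (c • Y).act (X α) = c • Y.act (X α) := by
    simp only [VectorField.act, smul_sum, Pi.smul_apply, smul_mul']
  rw [Pi.smul_apply, bracket_eq, bracket_eq, Pi.smul_apply, VectorField.act_smul, h, smul_sub,
    smul_comm c]

theorem bracket_fun_smul {q p : ℤ} {Q X : VectorField k deg} (hQ : Q ∈ vectorFieldsOfDegree k deg 1)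
    {f : Functions k deg} (hf : f ∈ functionsOfDegree k deg p) :
    bracket 1 (p + q) Q (f • X) = Q.act f • X + sgn k p • f • bracket 1 q Q X := by
  funext α
  rw [Pi.add_apply, Pi.smul_apply, Pi.smul_apply, Pi.smul_apply, bracket_eq, bracket_eq, smul_act,
    Pi.smul_apply, smul_eq_mul, act_mul hQ hf, smul_eq_mul, smul_eq_mul, mul_sub, mul_smul',
    smul_sub, smul_smul, ← sgn_add, one_mul, one_mul, one_mul, add_sub_assoc]

theorem act_act {p q : ℤ} {X Y : VectorField k deg} (hX : X ∈ vectorFieldsOfDegree k deg p)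
    (hY : Y ∈ vectorFieldsOfDegree k deg q) (f : Functions k deg) :
    X.act (Y.act f) = ∑ γ, X.act (Y γ) * partialDeriv γ f +
      ∑ γ, ∑ δ, sgn k (p * (q - (deg γ - 2))) •
        (Y γ * (X δ * partialDeriv δ (partialDeriv γ f))) := by
  rw [VectorField.act.eq_1 Y, ← VectorField.actHom_apply, map_sum, ← sum_add_distrib]
  refine sum_congr rfl fun γ _ => ?_
  rw [VectorField.actHom_apply, act_mul hX (mem_vectorFieldsOfDegree.1 hY γ),
    VectorField.act.eq_1 X (partialDeriv γ f), mul_sum, smul_sum]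

/-- The second-order terms of the two compositions cancel, since partial derivatives commute in the
graded sense. -/
theorem bracket_act {p q : ℤ} {X Y : VectorField k deg} (hX : X ∈ vectorFieldsOfDegree k deg p)
    (hY : Y ∈ vectorFieldsOfDegree k deg q) (f : Functions k deg) :
    (bracket p q X Y).act f = X.act (Y.act f) - sgn k (p * q) • Y.act (X.act f) := by
  rw [act_act hX hY, act_act hY hX]
  have h : ∑ γ, ∑ δ, sgn k (p * (q - (deg γ - 2))) •
        (Y γ * (X δ * partialDeriv δ (partialDeriv γ f))) =
      sgn k (p * q) • ∑ γ, ∑ δ, sgn k (q * (p - (deg γ - 2))) •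
        (X γ * (Y δ * partialDeriv δ (partialDeriv γ f))) := by
    rw [sum_comm, smul_sum]
    refine sum_congr rfl fun δ _ => ?_
    rw [smul_sum]
    refine sum_congr rfl fun γ _ => ?_
    rw [← mul_assoc, ← mul_assoc, mul_comm_graded (mem_vectorFieldsOfDegree.1 hY γ)
      (mem_vectorFieldsOfDegree.1 hX δ), partialDeriv_comm, smul_mul', mul_smul', smul_smul,
      smul_smul, smul_smul, ← sgn_add, ← sgn_add, ← sgn_add]
    congr 1
    apply sgn_congr
    push_cast
    have h2 : (2 : ZMod 2) = 0 := rfl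
    rw [h2]
    generalize (deg γ : ZMod 2) = c
    generalize (deg δ : ZMod 2) = d
    generalize (q : ZMod 2) = q
    generalize (p : ZMod 2) = p
    revert c d p q
    decide
  rw [h, smul_add, add_sub_add_right_eq_sub, VectorField.act, smul_sum, ← sum_sub_distrib]
  refine sum_congr rfl fun γ _ => ?_
  rw [bracket_eq, sub_mul, smul_mul']

/-- For odd `Q` the bracket [Q, Q] acts as twice the square of `Q`, and 2 is invertible. -/
theorem act_act_self [CharZero k] {Q : VectorField k deg} (hQ : Q ∈ vectorFieldsOfDegree k deg 1)
    (h : bracket 1 1 Q Q = 0) (f : Functions k deg) : Q.act (Q.act f) = 0 := by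
  have h1 := bracket_act hQ hQ f
  rw [h, mul_one, sgn_one, neg_smul, one_smul, sub_neg_eq_add, ← two_smul k] at h1
  have h0 : (0 : VectorField k deg).act f = 0 := by simp [VectorField.act]
  rw [h0] at h1
  exact ((smul_eq_zero_iff_right two_ne_zero).1 h1.symm)

theorem bracket_self_apply (Q : VectorField k deg) :
    bracket 1 1 Q Q = (2 : k) • fun α => Q.act (Q α) := by
  funext α
  rw [bracket_eq, mul_one, sgn_one, neg_smul, one_smul, sub_neg_eq_add, Pi.smul_apply, two_smul]

theorem bracket_bracket [CharZero k] {Q X : VectorField k deg} {q : ℤ}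
    (hQ : Q ∈ vectorFieldsOfDegree k deg 1) (h : bracket 1 1 Q Q = 0)
    (hX : X ∈ vectorFieldsOfDegree k deg q) :
    bracket 1 (1 + q) Q (bracket 1 q Q X) = 0 := by
  have hQ0 : ∀ α, Q.act (Q α) = 0 := by
    intro α
    have := congrFun h α
    rw [bracket_self_apply, Pi.smul_apply] at this
    exact ((smul_eq_zero_iff_right two_ne_zero).1 this)
  have h0 : X.act 0 = 0 := X.actHom.map_zero
  funext α
  rw [bracket_eq, bracket_act hQ hX, bracket_eq, ← VectorField.actHom_apply Q (_ - _), map_sub,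
    map_smul, VectorField.actHom_apply, VectorField.actHom_apply, act_act_self hQ h, hQ0, h0,
    smul_zero, sub_zero, zero_sub, one_mul, one_mul, sgn_add, sgn_one, neg_one_mul, neg_smul,
    sub_neg_eq_add, neg_add_cancel]
  rfl

/-- The Lie derivative along a vector field of degree `1`. -/
noncomputable def lieHom (Q : VectorField k deg) : VectorField k deg →ₗ[k] VectorField k deg where
  -- The sign (-1)^|X| of the bracket is written as (-1)^(deg γ + |X^γ|), which makes sense, and is
  -- linear, for inhomogeneous `X` too.
  toFun X α := Q.act (X α) - ∑ γ, sgn k (deg γ) • (twist k deg 1 (X γ) * partialDeriv γ (Q α))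
  map_add' X Y := by
    funext α
    simp only [Pi.add_apply, VectorField.act_add, map_add, add_mul, smul_add, sum_add_distrib]
    abel
  map_smul' c X := by
    funext α
    simp only [Pi.smul_apply, VectorField.act_smul, map_smul, smul_mul', RingHom.id_apply, smul_sub,
      smul_sum, smul_comm c]

theorem lieHom_apply {Q X : VectorField k deg} {d : ℤ} (hX : X ∈ vectorFieldsOfDegree k deg d) :
    lieHom Q X = bracket 1 d Q X := by
  funext α
  rw [bracket_eq]
  change Q.act (X α) - _ = _
  congr 1
  rw [VectorField.act, smul_sum]
  refine sum_congr rfl fun γ _ => ?_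
  rw [twist_of_mem (mem_vectorFieldsOfDegree.1 hX γ), smul_mul', smul_smul, ← sgn_add]
  congr 1
  apply sgn_congr
  push_cast
  have h2 : (2 : ZMod 2) = 0 := rfl
  rw [h2]
  generalize (deg γ : ZMod 2) = c
  generalize (d : ZMod 2) = d
  revert c d
  decide

end Bracket

/-! ### Multilinear extension of tensors -/

section TensorExt

variable {ι k : Type*} [Field k] [Fintype ι] [LinearOrder ι] {deg : ι → ℤ}

/-- Multiplication of vector fields by functions. -/
noncomputable def mulHom (k : Type*) [Field k] (deg : ι → ℤ) :
    Functions k deg →ₗ[k] VectorField k deg →ₗ[k] VectorField k deg :=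
  LinearMap.mk₂ k (fun f X => f • X) (fun _ _ _ => add_smul _ _ _) (fun _ _ _ => smul_assoc _ _ _)
    (fun _ _ _ => smul_add _ _ _) (fun _ _ _ => smul_comm _ _ _)

/-- The extension of the values `M` on coordinate vector fields to a tensor of parity `r`. -/
noncomputable def tensorExt (deg : ι → ℤ) :
    (n : ℕ) → ℤ → ((Fin n → ι) → VectorField k deg) →
      MultilinearMap k (fun _ : Fin n => VectorField k deg) (VectorField k deg)
  | 0, _, M => MultilinearMap.constOfIsEmpty k _ (M default)
  -- The twist accounts for X^γ passing an operator of parity r. With ∂_γ in the first slot, what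
  -- remains is a tensor of parity r + deg γ in the other arguments.
  | n + 1, r, M => LinearMap.uncurryLeft
    { toFun := fun X => ∑ γ, (mulHom k deg (twist k deg r (X γ))).compMultilinearMap
        (tensorExt deg n (r + deg γ) fun β => M (Fin.cons γ β))
      map_add' := fun X Y => by
        refine MultilinearMap.ext fun Z => ?_
        simp only [Pi.add_apply, map_add, _root_.sum_apply, _root_.add_apply,
          LinearMap.compMultilinearMap_apply, LinearMap.add_apply, sum_add_distrib]
      map_smul' := fun c X => by
        refine MultilinearMap.ext fun Z => ?_
        simp only [Pi.smul_apply, map_smul, _root_.sum_apply, _root_.smul_apply,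
          LinearMap.compMultilinearMap_apply, LinearMap.smul_apply, smul_sum, RingHom.id_apply] }

theorem tensorExt_succ {n : ℕ} (r : ℤ) (M : (Fin (n + 1) → ι) → VectorField k deg)
    (X : Fin (n + 1) → VectorField k deg) :
    tensorExt deg (n + 1) r M X = ∑ γ, twist k deg r (X 0 γ) •
      tensorExt deg n (r + deg γ) (fun β => M (Fin.cons γ β)) (Fin.tail X) := by
  rw [tensorExt, LinearMap.uncurryLeft_apply]
  simp only [LinearMap.coe_mk, AddHom.coe_mk, _root_.sum_apply,
    LinearMap.compMultilinearMap_apply]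
  rfl

theorem tensorExt_coordField {n : ℕ} (r : ℤ) (M : (Fin n → ι) → VectorField k deg)
    (a : Fin n → ι) : tensorExt deg n r M (fun i => coordField k deg (a i)) = M a := by
  induction n generalizing r with
  | zero =>
    rw [tensorExt, MultilinearMap.constOfIsEmpty_apply, Subsingleton.elim a default]
    rfl
  | succ n ih =>
    rw [tensorExt_succ, sum_eq_single (a 0)]
    · have := ih (r + deg (a 0)) (fun β => M (Fin.cons (a 0) β)) (Fin.tail a)
      rw [Fin.cons_self_tail] at this
      rw [← this, coordField, Pi.single_eq_same, twist_one, one_smul]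
      rfl
    · intro γ _ hγ
      rw [coordField, Pi.single_eq_of_ne hγ, map_zero, zero_smul]
    · simp

theorem tensorExt_mem {n : ℕ} (r s : ℤ) {M : (Fin n → ι) → VectorField k deg}
    (hM : ∀ a, M a ∈ vectorFieldsOfDegree k deg (s + ∑ i, deg (a i)))
    {X : Fin n → VectorField k deg} {d : Fin n → ℤ}
    (hX : ∀ i, X i ∈ vectorFieldsOfDegree k deg (d i - 2)) :
    tensorExt deg n r M X ∈ vectorFieldsOfDegree k deg (s + ∑ i, d i) := by
  induction n generalizing r s with
  | zero => simpa [tensorExt] using hM default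
  | succ n ih =>
    rw [tensorExt_succ]
    refine Submodule.sum_mem _ fun γ _ => ?_
    have h0 := mem_vectorFieldsOfDegree.1 (hX 0) γ
    have h1 := ih (r + deg γ) (s + deg γ) (M := fun β => M (Fin.cons γ β))
      (fun a => by
        have := hM (Fin.cons γ a)
        rw [Fin.sum_univ_succ] at this
        simpa [add_assoc] using this) (X := Fin.tail X) (d := Fin.tail d) (fun i => hX i.succ)
    rw [twist_of_mem h0]
    have := smul_mem_vectorFieldsOfDegree (Submodule.smul_mem _ (sgn k (r * (d 0 - 2 - (deg γ - 2))))
      h0) h1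
    convert this using 2
    rw [Fin.sum_univ_succ]
    simp only [Fin.tail]
    ring

theorem tensorExt_smul {n : ℕ} (r : ℤ) (M : (Fin n → ι) → VectorField k deg)
    {X : Fin n → VectorField k deg} {d : Fin n → ℤ}
    (hX : ∀ i, X i ∈ vectorFieldsOfDegree k deg (d i)) {f : Functions k deg} {p : ℤ}
    (hf : f ∈ functionsOfDegree k deg p) (i : Fin n) :
    tensorExt deg n r M (Function.update X i (f • X i)) =
      sgn k (p * (r + ∑ j with j < i, d j)) • f • tensorExt deg n r M X := by
  induction n generalizing r with
  | zero => exact i.elim0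
  | succ n ih =>
    rw [tensorExt_succ, tensorExt_succ, smul_sum, smul_sum]
    refine sum_congr rfl fun γ _ => ?_
    rcases Fin.eq_zero_or_eq_succ i with rfl | ⟨i, rfl⟩
    · have h1 : Fin.tail (Function.update X 0 (f • X 0)) = Fin.tail X := by
        funext j
        simp [Fin.tail]
      rw [h1, Function.update_self, Pi.smul_apply, smul_eq_mul, twist_mul, twist_of_mem hf,
        smul_mul', mul_comm p, smul_assoc, mul_smul]
      simp
    · have h1 : Fin.tail (Function.update X i.succ (f • X i.succ)) =
          Function.update (Fin.tail X) i (f • Fin.tail X i) := by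
        funext j
        rcases eq_or_ne j i with rfl | h
        · simp [Fin.tail]
        · simp [Fin.tail, h]
      have h0 := mem_vectorFieldsOfDegree.1 (hX 0) γ
      rw [h1, ih (r + deg γ) _ (X := Fin.tail X) (d := Fin.tail d) (fun i => hX i.succ),
        Function.update_of_ne (Fin.succ_ne_zero _).symm, smul_comm (twist k deg r (X 0 γ)),
        smul_smul (twist k deg r (X 0 γ)), smul_smul f, twist_of_mem h0, smul_mul', mul_smul',
        mul_comm_graded h0 hf, smul_assoc, smul_assoc, smul_assoc, smul_smul, smul_smul, smul_smul,
        ← sgn_add, ← sgn_add, ← sgn_add]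
      congr 1
      apply sgn_congr
      have h2 : ∑ j with j < i.succ, d j = d 0 + ∑ j with j < i, Fin.tail d j := by
        rw [sum_filter, Fin.sum_univ_succ, sum_filter]
        simp [Fin.tail]
      rw [h2]
      push_cast
      have h3 : (2 : ZMod 2) = 0 := rfl
      rw [h3]
      generalize (∑ j with j < i, (Fin.tail d j : ZMod 2)) = c
      generalize (d 0 : ZMod 2) = d
      generalize (deg γ : ZMod 2) = g
      generalize (p : ZMod 2) = p
      generalize (r : ZMod 2) = r
      revert c d g p r
      decide

end TensorExt

/-! ### Changing one argument before, inside or after the block -/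

section SpliceUpdate

variable {A : Type*}

theorem fin_update (X : ℕ → A) {q i : ℕ} (h : i < q) (x : A) :
    (fun t : Fin q => Function.update X i x t) =
      Function.update (fun t : Fin q => X t) ⟨i, h⟩ x := by
  funext t
  simp only [Function.update_apply, Fin.ext_iff]

theorem splice_update_lt (X : ℕ → A) {i j : ℕ} (l : ℕ) (h : i < j) (x y : A) :
    splice (Function.update X i x) j l y = Function.update (splice X j l y) i x := by
  funext t
  simp only [splice, Function.update_apply]
  split_ifs <;> first | rfl | omega

theorem splice_update_mid (X : ℕ → A) {i j l : ℕ} (h : j ≤ i) (h' : i < j + l) (x y : A) :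
    splice (Function.update X i x) j l y = splice X j l y := by
  funext t
  simp only [splice, Function.update_apply]
  split_ifs <;> first | rfl | omega

/-- The block of l entries shrinks to one, so an entry behind it moves from place i to place i + 1 -
l. -/
theorem splice_update_ge (X : ℕ → A) {i j l : ℕ} (h : j + l ≤ i) (hl : 1 ≤ l) (x y : A) :
    splice (Function.update X i x) j l y = Function.update (splice X j l y) (i + 1 - l) x := by
  funext t
  simp only [splice, Function.update_apply]
  split_ifs <;> first | rfl | omega

theorem splice_eq_update_self (X : ℕ → A) (j l : ℕ) (x y : A) :
    splice X j l x = Function.update (splice X j l y) j x := by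
  funext t
  simp only [splice, Function.update_apply]
  split_ifs <;> first | rfl | omega

theorem splice_one_self (X : ℕ → A) (j : ℕ) : splice X j 1 (X j) = X := by
  funext t
  simp only [splice]
  split_ifs with h1 h2
  · rfl
  · rw [h2]
  · congr 1
    omega

theorem block_update_lt (X : ℕ → A) {i j : ℕ} (h : i < j) (x : A) (t : ℕ) :
    Function.update X i x (j + t) = X (j + t) := by
  rw [Function.update_of_ne]
  omega

theorem block_update_ge (X : ℕ → A) {i j l : ℕ} (h : j + l ≤ i) (x : A) (t : Fin l) :
    Function.update X i x (j + t) = X (j + t) := by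
  rw [Function.update_of_ne]
  omega

theorem block_update_mid (X : ℕ → A) {i j : ℕ} (h : j ≤ i) (x : A) (t : ℕ) :
    Function.update X i x (j + t) = Function.update (fun t => X (j + t)) (i - j) x t := by
  simp only [Function.update_apply]
  split_ifs <;> first | rfl | omega

theorem sum_range_splice_le (d : ℕ → ℤ) {i j : ℕ} (l : ℕ) (h : i ≤ j) (w : ℤ) :
    ∑ t ∈ range i, splice d j l w t = ∑ t ∈ range i, d t := by
  refine sum_congr rfl fun t ht => ?_
  rw [splice, if_pos ((mem_range.1 ht).trans_le h)]

theorem sum_range_splice_ge (d : ℕ → ℤ) {i j l : ℕ} (h : j + l ≤ i) (w : ℤ) :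
    ∑ t ∈ range (i + 1 - l), splice d j l w t =
      ∑ t ∈ range i, d t - ∑ t ∈ range l, d (j + t) + w := by
  obtain ⟨s, rfl⟩ := Nat.exists_eq_add_of_le h
  have : j + l + s + 1 - l = j + 1 + s := by omega
  rw [this, sum_range_add, sum_range_add, sum_range_add, sum_range_one,
    sum_range_splice_le d l le_rfl, sum_range_add]
  have h1 : ∀ t ∈ range s, splice d j l w (j + 1 + t) = d (j + l + t) := by
    intro t _
    have h1 : ¬ j + 1 + t < j := by omega
    have h2 : j + 1 + t ≠ j := by omega
    rw [splice, if_neg h1, if_neg h2]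
    congr 1
    omega
  rw [sum_congr rfl h1]
  simp [splice]
  ring

end SpliceUpdate

/-! ### The Stasheff sum is a tensor -/

namespace TensorStructure

variable {ι k : Type*} [Field k] [Fintype ι] [LinearOrder ι] {deg : ι → ℤ}
  (T : TensorStructure k deg)

theorem μ_smul {q : ℕ} (hq : 2 ≤ q) {X : ℕ → VectorField k deg} {d : ℕ → ℤ}
    (hX : ∀ i, X i ∈ vectorFieldsOfDegree k deg (d i - 2)) {f : Functions k deg} {p : ℤ}
    (hf : f ∈ functionsOfDegree k deg p) {i : ℕ} (hi : i < q) :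
    T.μ q (fun t => Function.update X i (f • X i) t) =
      sgn k (p * (q + ∑ t ∈ range i, d t)) • f • T.μ q (fun t => X t) := by
  rw [fin_update X hi]
  have := T.μ_tensor q (fun t => X t) (fun t => d t - 2) f p hq (fun t => hX t) hf ⟨i, hi⟩
  rw [this, negOnePow_smul (k := k), sum_fin_filter_lt (fun t => d t - 2)]
  congr 1
  apply sgn_congr
  push_cast
  have h2 : (2 : ZMod 2) = 0 := rfl
  rw [h2]
  simp

theorem μ_splice_smul_lt {q : ℕ} (hq : 2 ≤ q) {X : ℕ → VectorField k deg} {d : ℕ → ℤ}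
    (hX : ∀ i, X i ∈ vectorFieldsOfDegree k deg (d i - 2)) {f : Functions k deg} {p : ℤ}
    (hf : f ∈ functionsOfDegree k deg p) {i j : ℕ} (l : ℕ) (hi : i < j) (hj : j < q)
    {W : VectorField k deg} {w : ℤ} (hW : W ∈ vectorFieldsOfDegree k deg (w - 2)) :
    T.μ q (fun t => splice (Function.update X i (f • X i)) j l W t) =
      sgn k (p * (q + ∑ t ∈ range i, d t)) • f • T.μ q (fun t => splice X j l W t) := by
  have h1 : splice X j l W i = X i := by rw [splice, if_pos hi]
  have := T.μ_smul hq (splice_mem (fun d => vectorFieldsOfDegree k deg (d - 2)) hX j l hW) hf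
    (hi.trans hj)
  rw [h1, sum_range_splice_le d l hi.le] at this
  rw [splice_update_lt X l hi, this]

theorem μ_splice_smul_ge {q : ℕ} (hq : 2 ≤ q) {X : ℕ → VectorField k deg} {d : ℕ → ℤ}
    (hX : ∀ i, X i ∈ vectorFieldsOfDegree k deg (d i - 2)) {f : Functions k deg} {p : ℤ}
    (hf : f ∈ functionsOfDegree k deg p) {i j l : ℕ} (hl : 1 ≤ l) (hi : j + l ≤ i)
    (hiq : i + 1 - l < q)
    {W : VectorField k deg} {w : ℤ} (hW : W ∈ vectorFieldsOfDegree k deg (w - 2)) :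
    T.μ q (fun t => splice (Function.update X i (f • X i)) j l W t) =
      sgn k (p * (q + (∑ t ∈ range i, d t - ∑ t ∈ range l, d (j + t) + w))) •
        f • T.μ q (fun t => splice X j l W t) := by
  have h1 : splice X j l W (i + 1 - l) = X i := by
    rw [splice, if_neg (by omega), if_neg (by omega)]
    congr 1
    omega
  have := T.μ_smul hq (splice_mem (fun d => vectorFieldsOfDegree k deg (d - 2)) hX j l hW) hf hiq
  rw [h1, sum_range_splice_ge d hi] at this
  rw [splice_update_ge X hi hl, this]

theorem μ_splice_smul_self {q : ℕ} (hq : 2 ≤ q) {X : ℕ → VectorField k deg} {d : ℕ → ℤ}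
    (hX : ∀ i, X i ∈ vectorFieldsOfDegree k deg (d i - 2)) {f : Functions k deg} {p : ℤ}
    (hf : f ∈ functionsOfDegree k deg p) {j : ℕ} (l : ℕ) (hj : j < q)
    {W : VectorField k deg} {w : ℤ} (hW : W ∈ vectorFieldsOfDegree k deg (w - 2)) :
    T.μ q (fun t => splice X j l (f • W) t) =
      sgn k (p * (q + ∑ t ∈ range j, d t)) • f • T.μ q (fun t => splice X j l W t) := by
  have h1 : splice X j l W j = W := by simp [splice]
  have := T.μ_smul hq (splice_mem (fun d => vectorFieldsOfDegree k deg (d - 2)) hX j l hW) hf hj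
  rw [h1, sum_range_splice_le d l le_rfl] at this
  rw [splice_eq_update_self X j l (f • W) W, this]

/-- The composition `μ_q ∘ (1^{⊗ j} ⊗ μ_l ⊗ 1)`, without sign. -/
noncomputable def comp (q l j : ℕ) (X : ℕ → VectorField k deg) : VectorField k deg :=
  T.μ q (fun t => splice X j l (T.μ l fun t => X (j + t)) t)

/-- On its way out f passes the arguments before slot i and μ_q; it also passes μ_l unless it stands
before the block. -/
theorem comp_smul {q l j i : ℕ} (hq : 2 ≤ q) (hl : 2 ≤ l) (hj : j < q) (hi : i + 1 < q + l)
    {X : ℕ → VectorField k deg} {d : ℕ → ℤ}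
    (hX : ∀ i, X i ∈ vectorFieldsOfDegree k deg (d i - 2)) {f : Functions k deg} {p : ℤ}
    (hf : f ∈ functionsOfDegree k deg p) :
    T.comp q l j (Function.update X i (f • X i)) =
      sgn k (p * (q + ∑ t ∈ range i, d t + if i < j then 0 else (l : ℤ))) • f • T.comp q l j X := by
  have hW := T.μ_mem l (fun t => X (j + t)) (fun t => d (j + t)) fun t => hX _
  rw [Fin.sum_univ_eq_sum_range (fun t => d (j + t))] at hW
  unfold comp
  rcases lt_or_ge i j with h | h
  · simp only [block_update_lt X h]
    rw [T.μ_splice_smul_lt hq hX hf l h hj hW, if_pos h, add_zero]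
  rw [if_neg h.not_gt]
  rcases lt_or_ge i (j + l) with h' | h'
  · simp only [block_update_mid X h]
    have h1 := T.μ_smul hl (X := fun t => X (j + t)) (d := fun t => d (j + t)) (fun t => hX _) hf
      (i := i - j) (by omega)
    rw [Nat.add_sub_cancel' h] at h1
    have h2 : ∑ t ∈ range i, d t = ∑ t ∈ range j, d t + ∑ t ∈ range (i - j), d (j + t) := by
      rw [← sum_range_add, Nat.add_sub_cancel' h]
    rw [h1, splice_update_mid X h h', smul_comm _ f, splice_eq_update _ j l q hj _ 0,
      ← splice_eq_update, T.μ_splice_smul_self hq hX hf l hj (Submodule.smul_mem _ _ hW),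
      splice_eq_update _ j l q hj _ 0, MultilinearMap.map_update_smul, ← splice_eq_update,
      smul_comm f, smul_smul, ← sgn_add, h2]
    congr 1
    apply sgn_congr
    push_cast
    ring
  · simp only [block_update_ge X h']
    rw [T.μ_splice_smul_ge hq hX hf (by omega) h' (by omega) hW]
    congr 1
    apply sgn_congr
    push_cast
    have h2 : (2 : ZMod 2) = 0 := rfl
    rw [h2]
    generalize (∑ t ∈ range i, (d t : ZMod 2)) = x
    generalize (∑ t ∈ range l, (d (j + t) : ZMod 2)) = y
    generalize (q : ZMod 2) = q
    generalize (l : ZMod 2) = l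
    generalize (p : ZMod 2) = p
    revert x y q l p
    decide

theorem comp_add {q l j i : ℕ} (hl : 1 ≤ l) (hj : j < q) (hi : i + 1 < q + l)
    (X : ℕ → VectorField k deg) (x y : VectorField k deg) :
    T.comp q l j (Function.update X i (x + y)) =
      T.comp q l j (Function.update X i x) + T.comp q l j (Function.update X i y) := by
  unfold comp
  rcases lt_or_ge i j with h | h
  · simp only [block_update_lt X h, splice_update_lt X l h, fin_update _ (h.trans hj)]
    exact MultilinearMap.map_update_add _ _ _ _ _
  rcases lt_or_ge i (j + l) with h' | h'
  · simp only [block_update_mid X h, splice_update_mid X h h']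
    have h1 : i - j < l := by omega
    simp only [fin_update _ h1, MultilinearMap.map_update_add]
    rw [splice_eq_update _ j l q hj _ 0, MultilinearMap.map_update_add, ← splice_eq_update,
      ← splice_eq_update]
  · have h1 : i + 1 - l < q := by omega
    simp only [block_update_ge X h', splice_update_ge X h' hl, fin_update _ h1]
    exact MultilinearMap.map_update_add _ _ _ _ _

theorem comp_congr {q l j : ℕ} (hj : j < q) {X Y : ℕ → VectorField k deg}
    (h : ∀ i, i + 1 < q + l → X i = Y i) (hl : 1 ≤ l) : T.comp q l j X = T.comp q l j Y := by
  unfold comp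
  have h1 : (fun t : Fin l => X (j + t)) = fun t : Fin l => Y (j + t) := by
    funext t
    exact h _ (by omega)
  rw [h1]
  congr 1
  funext t
  simp only [splice]
  split_ifs
  · exact h _ (by omega)
  · rfl
  · exact h _ (by omega)

theorem stasheffSum_eq_comp (n : ℕ) (X : ℕ → VectorField k deg) (d : ℕ → ℤ) :
    T.stasheffSum n X d =
      ∑ p ∈ HasAntidiagonal.antidiagonal (n + 1) with 1 ≤ p.1 ∧ 1 ≤ p.2, ∑ j ∈ range p.1,
        sgn k (j + p.2 * (n - j - p.2) + p.2 * ∑ i ∈ range j, d i) • T.comp p.1 p.2 j X := by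
  simp only [stasheffSum, negOnePow_smul (k := k)]
  rfl

theorem stasheffSum_add {n i : ℕ} (hi : i < n) (X : ℕ → VectorField k deg) (d : ℕ → ℤ)
    (x y : VectorField k deg) :
    T.stasheffSum n (Function.update X i (x + y)) d =
      T.stasheffSum n (Function.update X i x) d + T.stasheffSum n (Function.update X i y) d := by
  simp only [stasheffSum_eq_comp]
  rw [← sum_add_distrib]
  refine sum_congr rfl fun p hp => ?_
  rw [mem_filter, HasAntidiagonal.mem_antidiagonal] at hp
  rw [← sum_add_distrib]
  refine sum_congr rfl fun j hj => ?_
  rw [T.comp_add hp.2.2 (mem_range.1 hj) (by omega), smul_add]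

theorem stasheffSum_congr {n : ℕ} {X Y : ℕ → VectorField k deg} {c d : ℕ → ℤ}
    (h : ∀ i < n, X i = Y i) (h' : ∀ i < n, c i = d i) :
    T.stasheffSum n X c = T.stasheffSum n Y d := by
  simp only [stasheffSum_eq_comp]
  refine sum_congr rfl fun p hp => ?_
  rw [mem_filter, HasAntidiagonal.mem_antidiagonal] at hp
  refine sum_congr rfl fun j hj => ?_
  have hj' := mem_range.1 hj
  rw [T.comp_congr hj' (fun i hi => h i (by omega)) hp.2.2,
    sum_congr rfl fun i hi => h' i (by have := mem_range.1 hi; omega)]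

theorem sum_range_update (d : ℕ → ℤ) (i j : ℕ) (p : ℤ) :
    ∑ t ∈ range j, Function.update d i (p + d i) t =
      ∑ t ∈ range j, d t + if i < j then p else 0 := by
  have : ∀ t ∈ range j, Function.update d i (p + d i) t = d t + if t = i then p else 0 := by
    intro t _
    rcases eq_or_ne t i with rfl | h
    · simp [add_comm]
    · simp [h]
  rw [sum_congr rfl this, sum_add_distrib, sum_ite_eq']
  simp

/-! ### Pulling a function out of each kind of Stasheff term -/

section StasheffSmul

variable {n i : ℕ} (hn : 2 ≤ n) (hi : i < n) {X : ℕ → VectorField k deg} {d : ℕ → ℤ}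
  (hX : ∀ i, X i ∈ vectorFieldsOfDegree k deg (d i - 2)) {f : Functions k deg} {p : ℤ}
  (hf : f ∈ functionsOfDegree k deg p)
include hn hi hX hf

/-- The Leibniz rule for the outer Lie derivative leaves one extra term containing Q(f). -/
theorem bracket_μ_smul :
    bracket 1 (∑ t ∈ range n, Function.update d i (p + d i) t + 2 - n - 2) T.Q
      (T.μ n fun t => Function.update X i (f • X i) t) =
      sgn k (p * (n + 1 + ∑ t ∈ range i, d t)) • f •
        bracket 1 (∑ t ∈ range n, d t + 2 - n - 2) T.Q (T.μ n fun t => X t) +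
      sgn k (p * (n + ∑ t ∈ range i, d t)) • T.Q.act f • T.μ n (fun t => X t) := by
  have e : ∑ t ∈ range n, Function.update d i (p + d i) t + 2 - n - 2 =
      p + (∑ t ∈ range n, d t + 2 - n - 2) := by
    rw [sum_range_update, if_pos hi]
    ring
  have h : p * (n + ∑ t ∈ range i, d t) + p = p * (n + 1 + ∑ t ∈ range i, d t) := by ring
  rw [T.μ_smul hn hX hf hi, e, bracket_smul_right, bracket_fun_smul T.Q_mem hf, smul_add,
    smul_smul, ← sgn_add, add_comm, h]

/-- The inner Lie derivative at the slot of f produces the Q(f)-term of `bracket_μ_smul` with the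
opposite sign. -/
theorem splice_bracket_smul_self :
    sgn k (n - 1 + ∑ t ∈ range i, d t) •
      T.μ n (fun t => splice X i 1 (bracket 1 (p + d i - 2) T.Q (f • X i)) t) =
    sgn k (p * (n + 1 + ∑ t ∈ range i, d t)) • f • sgn k (n - 1 + ∑ t ∈ range i, d t) •
      T.μ n (fun t => splice X i 1 (bracket 1 (d i - 2) T.Q (X i)) t) -
    sgn k (p * (n + ∑ t ∈ range i, d t)) • T.Q.act f • T.μ n (fun t => X t) := by
  have hB := bracket_mem T.Q_mem (hX i)
  rw [← add_sub_assoc] at hB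
  rw [add_sub_assoc, bracket_fun_smul T.Q_mem hf,
    splice_eq_update _ i 1 n hi _ 0, MultilinearMap.map_update_add,
    MultilinearMap.map_update_smul, ← splice_eq_update, ← splice_eq_update,
    T.μ_splice_smul_self hn hX (act_mem T.Q_mem hf) 1 hi (hX i),
    splice_one_self, T.μ_splice_smul_self hn hX hf 1 hi hB]
  generalize ∑ t ∈ range i, d t = s
  generalize T.μ n (fun t => splice X i 1 (bracket 1 (d i - 2) T.Q (X i)) t) = Y
  rw [smul_add, smul_comm f (sgn k _) Y, smul_smul, smul_smul, smul_smul, smul_smul, ← sgn_add,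
    ← sgn_add, ← sgn_add, ← sgn_add]
  have h1 : sgn k (n - 1 + s + (1 + p) * (n + s)) = -sgn k (p * (n + s)) := by
    apply sgn_eq_neg
    push_cast
    generalize (s : ZMod 2) = s
    generalize (n : ZMod 2) = n
    generalize (p : ZMod 2) = p
    revert s n p
    decide
  have h2 : n - 1 + s + p + p * (n + s) = p * (n + 1 + s) + (n - 1 + s) := by ring
  rw [h1, neg_smul, h2, add_comm, ← sub_eq_add_neg]

theorem splice_bracket_smul {j : ℕ} (hj : j < n) :
    sgn k (n - 1 + ∑ t ∈ range j, Function.update d i (p + d i) t) •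
      T.μ n (fun t => splice (Function.update X i (f • X i)) j 1
        (bracket 1 (Function.update d i (p + d i) j - 2) T.Q
          (Function.update X i (f • X i) j)) t) =
      sgn k (p * (n + 1 + ∑ t ∈ range i, d t)) • f • sgn k (n - 1 + ∑ t ∈ range j, d t) •
        T.μ n (fun t => splice X j 1 (bracket 1 (d j - 2) T.Q (X j)) t) -
      if j = i then sgn k (p * (n + ∑ t ∈ range i, d t)) • T.Q.act f • T.μ n (fun t => X t)
        else 0 := by
  have hB := bracket_mem T.Q_mem (hX j)
  rw [← add_sub_assoc] at hB
  rw [sum_range_update]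
  rcases lt_trichotomy i j with h | h | h
  · rw [if_neg h.ne', sub_zero, if_pos h, Function.update_of_ne h.ne',
      Function.update_of_ne h.ne', T.μ_splice_smul_lt hn hX hf 1 h hj hB, smul_comm f,
      smul_smul, smul_smul, ← sgn_add, ← sgn_add]
    congr 1
    apply sgn_congr
    push_cast
    ring
  · subst h
    rw [if_pos rfl, if_neg (lt_irrefl _), Function.update_self, Function.update_self,
      splice_update_mid X le_rfl (by omega), add_zero]
    exact T.splice_bracket_smul_self hn hi hX hf
  · rw [if_neg h.ne, sub_zero, if_neg h.not_gt, Function.update_of_ne h.ne,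
      Function.update_of_ne h.ne, T.μ_splice_smul_ge hn hX hf le_rfl h (by omega) hB,
      smul_comm f, smul_smul, smul_smul, ← sgn_add, ← sgn_add, sum_range_one, add_zero j]
    congr 1
    apply sgn_congr
    push_cast
    ring

/-- For i < j the function does not pass μ_l, but the Stasheff sign then contains the changed degree
multiplied by l. Either way the total parity is q + l = n + 1, independent of the term. -/
theorem sum_comp_smul :
    ∑ x ∈ HasAntidiagonal.antidiagonal (n + 1) with 2 ≤ x.1 ∧ 2 ≤ x.2, ∑ j ∈ range x.1,
      sgn k (j + x.2 * (n - j - x.2) +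
        x.2 * ∑ t ∈ range j, Function.update d i (p + d i) t) •
      T.comp x.1 x.2 j (Function.update X i (f • X i)) =
    sgn k (p * (n + 1 + ∑ t ∈ range i, d t)) • f •
      ∑ x ∈ HasAntidiagonal.antidiagonal (n + 1) with 2 ≤ x.1 ∧ 2 ≤ x.2, ∑ j ∈ range x.1,
      sgn k (j + x.2 * (n - j - x.2) + x.2 * ∑ t ∈ range j, d t) • T.comp x.1 x.2 j X := by
  rw [smul_sum, smul_sum]
  refine sum_congr rfl fun x hx => ?_
  rw [mem_filter, HasAntidiagonal.mem_antidiagonal] at hx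
  rw [smul_sum, smul_sum]
  refine sum_congr rfl fun j hj => ?_
  rw [mem_range] at hj
  rw [T.comp_smul hx.2.1 hx.2.2 hj (by omega) hX hf, smul_comm f, smul_smul, smul_smul,
    ← sgn_add, ← sgn_add, sum_range_update]
  congr 1
  apply sgn_congr
  have h5 : (n : ZMod 2) + 1 = x.1 + x.2 := by exact_mod_cast congrArg _ hx.1.symm
  split_ifs
  · push_cast
    linear_combination (-p : ZMod 2) * h5
  · push_cast
    linear_combination (-p : ZMod 2) * h5

/-- The Q(f)-terms of the outer Lie derivative and of the inner one at slot i cancel, and all other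
terms release f with one common sign. -/
theorem stasheffSum_smul :
    T.stasheffSum n (Function.update X i (f • X i)) (Function.update d i (p + d i)) =
      sgn k (p * (n + 1 + ∑ t ∈ range i, d t)) • f • T.stasheffSum n X d := by
  have hX' : ∀ t, Function.update X i (f • X i) t ∈
      vectorFieldsOfDegree k deg (Function.update d i (p + d i) t - 2) := by
    intro t
    rcases eq_or_ne t i with rfl | h
    · rw [Function.update_self, Function.update_self, add_sub_assoc]
      exact smul_mem_vectorFieldsOfDegree hf (hX t)
    · rw [Function.update_of_ne h, Function.update_of_ne h]
      exact hX t
  have h1 := sum_congr rfl fun j hj => T.splice_bracket_smul hn hi hX hf (mem_range.1 hj)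
  rw [sum_sub_distrib, sum_ite_eq', if_pos (mem_range.2 hi), ← smul_sum, ← smul_sum] at h1
  have h2 := T.sum_comp_smul hn hi hX hf
  unfold comp at h2
  rw [T.stasheffSum_eq hn hX', T.stasheffSum_eq hn hX, T.bracket_μ_smul hn hi hX hf, h1, h2,
    smul_add f, smul_add f, smul_add (sgn k _), smul_add (sgn k _), add_assoc, add_assoc,
    ← add_assoc (_ • _ • T.μ n _), add_sub_cancel]

end StasheffSmul

/-- Expand the arguments one after another in coordinate fields and pull out their components. The
degrees are an argument of `E` because the signs of the Stasheff sum depend on them. -/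
theorem eq_zero_of_coordField {n : ℕ} (E : (ℕ → VectorField k deg) → (ℕ → ℤ) → VectorField k deg)
    (hadd : ∀ X d i x y, i < n → E (Function.update X i (x + y)) d =
      E (Function.update X i x) d + E (Function.update X i y) d)
    (hsmul : ∀ (X : ℕ → VectorField k deg) d i f p, i < n →
      (∀ t, X t ∈ vectorFieldsOfDegree k deg (d t - 2)) →
      f ∈ functionsOfDegree k deg p → E X d = 0 →
        E (Function.update X i (f • X i)) (Function.update d i (p + d i)) = 0)
    (hcoord : ∀ (X : ℕ → VectorField k deg) d,
      (∀ i < n, ∃ α, X i = coordField k deg α ∧ d i = deg α) → E X d = 0)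
    (X : ℕ → VectorField k deg) (d : ℕ → ℤ)
    (hX : ∀ i, X i ∈ vectorFieldsOfDegree k deg (d i - 2)) : E X d = 0 := by
  -- Induction on the number s of leading slots that may still be arbitrary; from slot s on, the
  -- arguments are coordinate fields.
  suffices h : ∀ (s : ℕ) (X : ℕ → VectorField k deg) (d : ℕ → ℤ),
      (∀ i, X i ∈ vectorFieldsOfDegree k deg (d i - 2)) →
      (∀ i < n, s ≤ i → ∃ α, X i = coordField k deg α ∧ d i = deg α) → E X d = 0 from
    h n X d hX fun i hi hi' => absurd hi hi'.not_gt
  intro s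
  induction s with
  | zero => exact fun X d _ h => hcoord X d fun i hi => h i hi (Nat.zero_le _)
  | succ s ih =>
    intro X d hX h
    rcases le_or_gt n s with hs | hs
    · exact ih X d hX fun i hi hi' => by omega
    have h1 : E X d = ∑ γ, E (Function.update X s (X s γ • coordField k deg γ)) d := by
      conv_lhs => rw [← Function.update_eq_self s X, ← sum_smul_coordField (X s)]
      exact map_sum (AddMonoidHom.mk' (fun x => E (Function.update X s x) d)
        fun x y => hadd X d s x y hs) _ _
    rw [h1]
    refine sum_eq_zero fun γ _ => ?_
    have h2 := hsmul (Function.update X s (coordField k deg γ)) (Function.update d s (deg γ)) s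
      (X s γ) _ hs ?_ (mem_vectorFieldsOfDegree.1 (hX s) γ) (ih _ _ ?_ ?_)
    · rw [Function.update_idem, Function.update_idem, Function.update_self, Function.update_self]
        at h2
      have h3 : d s - 2 - (deg γ - 2) + deg γ = d s := by ring
      rwa [h3, Function.update_eq_self] at h2
    all_goals
      intro t
      rcases eq_or_ne t s with rfl | ht
    · simpa using coordField_mem γ
    · simpa [ht] using hX t
    · simpa using coordField_mem γ
    · simpa [ht] using hX t
    · exact fun _ _ => ⟨γ, by simp, by simp⟩
    · intro h3 h4
      simpa [ht] using h t h3 (by omega)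

end TensorStructure

/-! ### Homogeneous vector fields span -/

section Span

variable {ι k : Type*} [Field k] [Fintype ι] {deg : ι → ℤ}

/-- Only finitely many degrees occur in a function, so it is the sum of its homogeneous parts. -/
theorem mem_iSup_functionsOfDegree (f : Functions k deg) : f ∈ ⨆ d, functionsOfDegree k deg d := by
  have h : ∀ d, ∃ g ∈ functionsOfDegree k deg d,
      ∀ m, coeff g m = if monDeg deg m = d then coeff f m else 0 := by
    intro d
    refine ⟨⟨fun m => if monDeg deg m = d then coeff f m else 0, fun m hm => ?_,
      (Set.finite_singleton d).subset ?_⟩, fun m hm => ?_, fun m => rfl⟩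
    · dsimp only
      rw [coeff_of_not_isMon f hm, ite_self]
    · rintro _ ⟨m, hm, rfl⟩
      exact (ite_ne_right_iff.1 hm).1
    · exact (ite_ne_right_iff.1 hm).1
  choose g hg hg' using h
  have hfin : (degrees deg (coeff f)).Finite := f.2.2
  have h1 : f = ∑ d ∈ hfin.toFinset, g d := by
    refine Functions.ext' fun m _ => ?_
    rw [coeff_sum]
    simp only [hg']
    rw [sum_ite_eq]
    by_cases h0 : coeff f m = 0
    · rw [h0, ite_self]
    · rw [if_pos (hfin.mem_toFinset.2 ⟨m, h0, rfl⟩)]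
  rw [h1]
  exact Submodule.sum_mem _ fun d _ => Submodule.mem_iSup_of_mem d (hg d)

variable [LinearOrder ι]

theorem span_homogeneous_vectorField :
    Submodule.span k {X : VectorField k deg | ∃ d, X ∈ vectorFieldsOfDegree k deg d} = ⊤ := by
  rw [eq_top_iff]
  intro X _
  rw [← sum_smul_coordField X]
  refine Submodule.sum_mem _ fun γ _ => ?_
  refine Submodule.iSup_induction (functionsOfDegree k deg)
    (motive := fun f => f • coordField k deg γ ∈ _) (mem_iSup_functionsOfDegree (X γ))
    (fun d f hf => Submodule.subset_span
      ⟨_, smul_mem_vectorFieldsOfDegree hf (coordField_mem γ)⟩) ?_ fun f g hf hg => ?_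
  · rw [zero_smul]
    exact Submodule.zero_mem _
  · rw [add_smul]
    exact Submodule.add_mem _ hf hg

/-- The conditions on μ_1 and on the tensors constrain homogeneous arguments only; by spanning, this
determines the operations. -/
theorem multilinearMap_ext_homogeneous {n : ℕ} {M : Type*} [AddCommGroup M] [Module k M]
    {F G : MultilinearMap k (fun _ : Fin n => VectorField k deg) M}
    (h : ∀ (X : Fin n → VectorField k deg) (d : Fin n → ℤ),
      (∀ i, X i ∈ vectorFieldsOfDegree k deg (d i - 2)) → F X = G X) : F = G := by
  refine MultilinearMap.ext_of_span_eq_top (g := fun _ (X : {X : VectorField k deg |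
    ∃ d, X ∈ vectorFieldsOfDegree k deg d}) => (X : VectorField k deg)) (fun _ => ?_) fun X => ?_
  · rw [Subtype.range_coe]
    exact span_homogeneous_vectorField
  · choose d hd using fun i => (X i).2
    exact h _ (fun i => d i + 2) fun i => by simpa using hd i

end Span

/-! ### The correspondence: injectivity and surjectivity of taking Taylor coefficients -/

namespace TensorStructure

variable {ι k V : Type*} [Field k] [AddCommGroup V] [Module k V] [Fintype ι] [LinearOrder ι]
  {𝒱 : ℤ → Submodule k V} [DirectSum.Decomposition 𝒱] {e : Module.Basis ι k V} {deg : ι → ℤ}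

theorem μ_ext_coordField (T U : TensorStructure k deg) {n : ℕ} (hn : 2 ≤ n)
    (h : ∀ a : Fin n → ι, T.μ n (fun i => coordField k deg (a i)) =
      U.μ n fun i => coordField k deg (a i)) : T.μ n = U.μ n := by
  refine multilinearMap_ext_homogeneous fun X d hX => ?_
  have := eq_zero_of_coordField (n := n) (k := k) (deg := deg)
    (fun X _ => T.μ n (fun t => X t) - U.μ n (fun t => X t))
    (fun X d i x y hi => ?_) (fun X d i f p hi hX hf h0 => ?_) (fun X d hX => ?_)
    -- The tuple is padded with the zero field, which is homogeneous of every degree.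
    (fun t => if ht : t < n then X ⟨t, ht⟩ else 0) (fun t => if ht : t < n then d ⟨t, ht⟩ else 0)
    (fun t => ?_)
  · simpa [sub_eq_zero] using this
  · simp only [fin_update _ hi, MultilinearMap.map_update_add]
    abel
  · rw [T.μ_smul hn hX hf hi, U.μ_smul hn hX hf hi, ← smul_sub, ← smul_sub, h0, smul_zero,
      smul_zero]
  · choose a ha _ using fun i : Fin n => hX i i.2
    simp only [ha, h, sub_self]
  · split_ifs with ht
    · exact hX _
    · exact Submodule.zero_mem _

theorem μ_ext (T U : TensorStructure k deg) (hQ : T.Q = U.Q)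
    (h : ∀ (n : ℕ) (a : Fin n → ι), 2 ≤ n → T.μ n (fun i => coordField k deg (a i)) =
      U.μ n fun i => coordField k deg (a i)) : T.μ = U.μ := by
  funext n
  match n with
  | 0 => rw [T.μ_zero, U.μ_zero]
  | 1 =>
    refine multilinearMap_ext_homogeneous fun X d hX => ?_
    have hX' : X = fun _ => X 0 := funext fun i => by rw [Subsingleton.elim i 0]
    rw [hX', T.μ_one _ _ (hX 0), U.μ_one _ _ (hX 0), hQ]
  | n + 2 => exact T.μ_ext_coordField U (by omega) fun a => h _ a (by omega)

/-- The Lie derivative along `Q` together with the tensors with components `M`. -/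
noncomputable def tensorOps (Q : VectorField k deg)
    (M : (n : ℕ) → (Fin n → ι) → VectorField k deg) :
    (n : ℕ) → MultilinearMap k (fun _ : Fin n => VectorField k deg) (VectorField k deg)
  | 0 => 0
  | 1 => MultilinearMap.ofSubsingleton k _ _ 0 (lieHom Q)
  | n + 2 => tensorExt deg (n + 2) (2 - (n + 2 : ℕ)) (M (n + 2))

theorem tensorOps_of_le (Q : VectorField k deg) (M : (n : ℕ) → (Fin n → ι) → VectorField k deg)
    {n : ℕ} (hn : 2 ≤ n) : tensorOps Q M n = tensorExt deg n (2 - n) (M n) := by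
  obtain ⟨n, rfl⟩ := Nat.exists_eq_add_of_le' hn
  rfl

/-- The structure with vector field `Q` and tensors with components `M`. -/
noncomputable def ofComponents (Q : VectorField k deg) (hQ : Q ∈ vectorFieldsOfDegree k deg 1)
    (hQ0 : ∀ α, coeff (Q α) 0 = 0) (M : (n : ℕ) → (Fin n → ι) → VectorField k deg)
    (hM : ∀ (n : ℕ) (a : Fin n → ι), M n a ∈ vectorFieldsOfDegree k deg (-n + ∑ i, deg (a i))) :
    TensorStructure k deg where
  μ := tensorOps Q M
  μ_zero := rfl
  μ_mem n X d hX := by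
    match n with
    | 0 => exact Submodule.zero_mem _
    | 1 =>
      change lieHom Q (X 0) ∈ _
      rw [lieHom_apply (hX 0)]
      have := bracket_mem hQ (hX 0)
      convert this using 2
      simp
      ring
    | n + 2 =>
      have := tensorExt_mem (2 - (n + 2 : ℕ)) _ (hM (n + 2)) hX
      rwa [show (-(n + 2 : ℕ) + ∑ i, d i : ℤ) = ∑ i, d i + 2 - (n + 2 : ℕ) - 2 by ring] at this
  Q := Q
  Q_mem := hQ
  Q_origin := hQ0
  μ_one d X hX := lieHom_apply hX
  μ_tensor n X d f p hn hX hf i := by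
    rw [tensorOps_of_le Q M hn, tensorExt_smul _ _ hX hf, negOnePow_smul (k := k)]

theorem stasheffSum_one [CharZero k] (T : TensorStructure k deg) (hQ : bracket 1 1 T.Q T.Q = 0)
    (X : ℕ → VectorField k deg) (d : ℕ → ℤ)
    (hX : ∀ i, X i ∈ vectorFieldsOfDegree k deg (d i - 2)) : T.stasheffSum 1 X d = 0 := by
  have h1 : (HasAntidiagonal.antidiagonal (1 + 1)).filter
      (fun p : ℕ × ℕ => 1 ≤ p.1 ∧ 1 ≤ p.2) = {(1, 1)} := by decide
  have h2 : (fun t : Fin 1 => X (0 + t)) = fun _ => X 0 := funext fun t => by simp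
  have h3 : ∀ Y, (fun t : Fin 1 => splice X 0 1 Y t) = fun _ => Y :=
    fun Y => funext fun t => by simp [splice]
  rw [stasheffSum_eq_comp, h1, sum_singleton, sum_range_one, comp, h2, T.μ_one _ _ (hX 0), h3,
    T.μ_one _ _ (bracket_mem T.Q_mem (hX 0)), bracket_bracket T.Q_mem hQ (hX 0), smul_zero]

variable (he : ∀ α, e α ∈ 𝒱 (deg α))
include he

/-- The coefficient of order zero is the value at the distinguished point, where `Q` vanishes. -/
theorem gerstν_zero (T : TensorStructure k deg) : T.gerstν e 0 = 0 := by
  refine MultilinearMap.ext fun b => e.repr.injective (Finsupp.ext fun α => ?_)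
  rw [gerstν, repr_taylor he _ (d := fun _ => 0) (fun i => i.elim0), iterDeriv_zero,
    Module.End.one_apply, T.Q_origin]
  simp

theorem taylor_act_self (T : TensorStructure k deg) {N : ℕ} {b : Fin N → V} {d : Fin N → ℤ}
    (hb : ∀ i, b i ∈ 𝒱 (d i)) :
    taylor e deg N (fun α => T.Q.act (T.Q α)) b =
      -∑ S : Finset (Fin N), Int.negOnePow (unshuffle d S) •
        T.gerstν e (Sᶜ.card + 1) (Fin.cons (T.gerstν e S.card (sub b S)) (sub b Sᶜ)) := by
  rw [taylor_act he T.Q_mem T.Q_mem hb, ← sum_neg_distrib]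
  refine sum_congr rfl fun S _ => ?_
  rw [negOnePow_smul (k := k), mul_one, sgn_add, sgn_one, mul_neg_one, neg_smul]
  rfl

theorem gerstν_mem (T : TensorStructure k deg) (n : ℕ) (b : Fin n → V) (d : Fin n → ℤ)
    (hb : ∀ i, b i ∈ 𝒱 (d i)) : T.gerstν e n b ∈ 𝒱 (∑ i, d i + 3 - 2 * n) := by
  have := taylor_mem he hb T.Q_mem
  rwa [show (1 + 2 + ∑ i, d i - 2 * n : ℤ) = ∑ i, d i + 3 - 2 * n by ring] at this

theorem gerstμ_mem (T : TensorStructure k deg) (n p : ℕ) (a : Fin n → V) (b : Fin p → V)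
    (c : Fin n → ℤ) (d : Fin p → ℤ) (ha : ∀ i, a i ∈ 𝒱 (c i)) (hb : ∀ i, b i ∈ 𝒱 (d i)) :
    T.gerstμ e n p (Sum.elim a b) ∈ 𝒱 (∑ i, c i + ∑ i, d i + 2 - n - 2 * p) := by
  by_cases hn : 2 ≤ n
  · rw [T.gerstμ_apply hn]
    have := taylor_mem he hb (T.μ_mem n _ _ fun i => constField_mem he (ha i))
    rwa [show (∑ i, c i + 2 - n - 2 + 2 + ∑ i, d i - 2 * p : ℤ) =
      ∑ i, c i + ∑ i, d i + 2 - n - 2 * p by ring] at this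
  · rw [gerstμ, if_neg hn]
    exact Submodule.zero_mem _

theorem gerstμ_swap (T : TensorStructure k deg) (n p : ℕ) (a : Fin n → V) (b : Fin p → V)
    (d : Fin p → ℤ) (hb : ∀ i, b i ∈ 𝒱 (d i)) (i j : Fin p) (hij : (j : ℕ) = i + 1) :
    T.gerstμ e n p (Sum.elim a (b ∘ Equiv.swap i j)) =
      Int.negOnePow (d i * d j) • T.gerstμ e n p (Sum.elim a b) := by
  rw [negOnePow_smul (k := k)]
  by_cases hn : 2 ≤ n
  · rw [T.gerstμ_apply hn, T.gerstμ_apply hn, taylor_swap he _ hb i j hij]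
  · rw [gerstμ, if_neg hn]
    exact (smul_zero _).symm

/-- The `Gerst_∞`-structure of the Taylor coefficients of a geometric `A_∞`-structure. -/
noncomputable def _root_.GerstInf.GeometricAInfinityStructure.toGerst [CharZero k]
    (Γ : GeometricAInfinityStructure k deg) : GerstInfinityStructure 𝒱 where
  ν := Γ.toTensorStructure.gerstν e
  μ := Γ.toTensorStructure.gerstμ e
  ν_zero := Γ.toTensorStructure.gerstν_zero he
  μ_low n p hn := if_neg (by omega)
  ν_mem := Γ.toTensorStructure.gerstν_mem he
  μ_mem := Γ.toTensorStructure.gerstμ_mem he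
  ν_symm n b d hb i j hij := by
    rw [negOnePow_smul (k := k)]
    exact taylor_swap he _ hb i j hij
  μ_symm := Γ.toTensorStructure.gerstμ_swap he
  ν_ν N b d _ hb := by
    have h := Γ.Q_homological
    rw [bracket_self_apply, smul_eq_zero_iff_right two_ne_zero] at h
    have h1 := Γ.toTensorStructure.taylor_act_self he hb
    change taylor e deg N (fun α => Γ.Q.act (Γ.Q α)) b = _ at h1
    rw [h, map_zero] at h1
    exact neg_eq_zero.1 h1.symm
  ν_μ n N a b c d hn ha hb := by
    have h1 := Γ.toTensorStructure.taylor_stasheffSum he hn ha hb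
    have h2 : Γ.toTensorStructure.stasheffSum n (fun i => constField e deg (a i)) c = 0 :=
      Γ.stasheff n _ c (by omega) fun i => constField_mem he (ha i)
    rw [h2, map_zero] at h1
    exact (sub_eq_zero.1 h1.symm).symm

theorem toGerst_injective [CharZero k] :
    Function.Injective (GeometricAInfinityStructure.toGerst he (k := k)) := by
  intro Γ Δ h
  have hQ : Γ.Q = Δ.Q := VectorField.ext_taylor he fun n β =>
    congrArg (fun G : GerstInfinityStructure 𝒱 => G.ν n fun i => e (β i)) h
  have hμ : Γ.μ = Δ.μ := by
    refine Γ.toTensorStructure.μ_ext Δ.toTensorStructure hQ fun n a hn => ?_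
    refine VectorField.ext_taylor he fun p β => ?_
    have h1 := congrArg (fun G : GerstInfinityStructure 𝒱 =>
      G.μ n p (Sum.elim (fun i => e (a i)) fun i => e (β i))) h
    change Γ.toTensorStructure.gerstμ e n p _ = Δ.toTensorStructure.gerstμ e n p _ at h1
    simpa only [gerstμ_apply _ hn, constField_basis] using h1
  exact GeometricAInfinityStructure.ext hμ hQ

theorem isTaylorSum_fieldTerm [CharZero k] (Γ : GeometricAInfinityStructure k deg) :
    IsTaylorSum Γ.Q ((Γ.toGerst he).fieldTerm e deg) := by
  intro α m
  rw [coeff_eq_coeff_sum_polyTerm]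
  congr 2
  refine funext fun n => ?_
  rw [polyTerm, GerstInfinityStructure.fieldTerm]
  congr 1
  refine sum_congr rfl fun β _ => ?_
  rw [negOnePow_smul (k := k), smul_smul,
    -- The Koszul sign uses the degree 3 - 2n of ν_n; only its parity matters, which is that of |Q|
    -- = 1.
    ← sgn_mul_repr_taylor he Γ.Q_mem (r := 3 - 2 * n) ?_ β α]
  · rfl
  · push_cast
    generalize (n : ZMod 2) = n
    revert n
    decide

theorem isTaylorSum_tensorTerm [CharZero k] (Γ : GeometricAInfinityStructure k deg) {n : ℕ}
    (hn : 2 ≤ n) (a : Fin n → ι) :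
    IsTaylorSum (Γ.μ n fun i => coordField k deg (a i)) ((Γ.toGerst he).tensorTerm e deg n a) := by
  intro α m
  rw [coeff_eq_coeff_sum_polyTerm]
  congr 2
  refine funext fun p => ?_
  rw [polyTerm, GerstInfinityStructure.tensorTerm]
  congr 1
  refine sum_congr rfl fun β _ => ?_
  have h1 : (Γ.toGerst he).μ n p (Sum.elim (fun i => e (a i)) fun i => e (β i)) =
      taylor e deg p (Γ.μ n fun i => coordField k deg (a i)) fun i => e (β i) := by
    change Γ.toTensorStructure.gerstμ e n p _ = _
    simp only [gerstμ_apply _ hn, constField_basis]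
    rfl
  rw [negOnePow_smul (k := k), smul_smul, h1, ← sgn_mul_repr_taylor he
    (Γ.μ_mem n _ (fun i => deg (a i)) fun i => coordField_mem (a i))
    (r := 2 - n - 2 * p + ∑ i, deg (a i)) ?_ β α]
  push_cast
  generalize ∑ i, (deg (a i) : ZMod 2) = x
  generalize (n : ZMod 2) = n
  generalize (p : ZMod 2) = p
  revert n p x
  decide

/-- Only degrees, graded symmetry, `ν_zero` and `μ_low` of `G` enter here: `Q` and the components of
the tensors are constructed from their Taylor coefficients, and the tensors are extended from
coordinate fields. -/
theorem exists_gerst_eq [CharZero k] (G : GerstInfinityStructure 𝒱) :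
    ∃ T : TensorStructure k deg, T.gerstν e = G.ν ∧ T.gerstμ e = G.μ := by
  obtain ⟨Q, hQ, hQ'⟩ := exists_taylor_eq he 1 G.ν (fun n b d hb => by
    have := G.ν_mem n b d hb
    rwa [show (∑ i, d i + 3 - 2 * n : ℤ) = 1 + 2 + ∑ i, d i - 2 * n by ring] at this) G.ν_symm
  have h1 : ∀ (n : ℕ) (a : Fin n → ι),
      ∃ X ∈ vectorFieldsOfDegree k deg (-n + ∑ i, deg (a i)),
        ∀ p, taylor e deg p X = (G.μ n p).currySum fun i => e (a i) := by
    intro n a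
    refine exists_taylor_eq he _ (fun p => (G.μ n p).currySum fun i => e (a i))
      (fun p b d hb => ?_) fun p b d hb => ?_
    · have := G.μ_mem n p _ b (fun i => deg (a i)) d (fun i => he (a i)) hb
      rwa [show (∑ i, deg (a i) + ∑ i, d i + 2 - n - 2 * p : ℤ) =
        -n + ∑ i, deg (a i) + 2 + ∑ i, d i - 2 * p by ring] at this
    · exact G.μ_symm n p _ b d hb
  choose M hM hM' using h1
  have hQ0 : ∀ α, coeff (Q α) 0 = 0 := by
    intro α
    have h := repr_taylor he Q (b := Fin.elim0) (d := fun _ => 0) (fun i => i.elim0) α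
    rw [hQ' 0, G.ν_zero, iterDeriv_zero, Module.End.one_apply] at h
    simpa using h.symm
  refine ⟨ofComponents Q hQ hQ0 M hM, funext hQ', funext fun n => funext fun p => ?_⟩
  rcases lt_or_ge n 2 with hn | hn
  · rw [G.μ_low n p hn, gerstμ, if_neg hn.not_ge]
  refine Module.Basis.ext_multilinear (fun _ => e) fun β => ?_
  have hβ : (fun i => e (β i)) =
      Sum.elim (fun i => e (β (Sum.inl i))) fun i => e (β (Sum.inr i)) := by
    funext i
    rcases i with i | i <;> rfl
  rw [hβ, gerstμ_apply _ hn]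
  simp only [constField_basis]
  change taylor e deg p (tensorOps Q M n _) _ = _
  rw [tensorOps_of_le Q M hn, tensorExt_coordField _ _ fun i => β (Sum.inl i), hM']
  rfl

theorem act_self_eq_zero [CharZero k] {T : TensorStructure k deg} {G : GerstInfinityStructure 𝒱}
    (hν : T.gerstν e = G.ν) : (fun α => T.Q.act (T.Q α)) = 0 := by
  refine VectorField.ext_taylor he fun N β => ?_
  rw [T.taylor_act_self he fun i => he (β i), map_zero, _root_.zero_apply, neg_eq_zero, hν]
  -- The ν-identities start at N = 1. For N = 0 the sole term has ν_0 = 0 inserted.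
  rcases Nat.eq_zero_or_pos N with rfl | hN
  · refine sum_eq_zero fun S _ => ?_
    have hS : S = ∅ := Subsingleton.elim _ _
    subst hS
    rw [MultilinearMap.map_coord_zero _ 0, smul_zero]
    change G.ν 0 _ = 0
    rw [G.ν_zero]
    rfl
  · exact G.ν_ν N _ _ hN fun i => he (β i)

/-- As a tensor the Stasheff sum may be tested on coordinate fields. These are constant, so all its
Taylor coefficients vanish by the mixed identities. -/
theorem stasheffSum_eq_zero [CharZero k] {T : TensorStructure k deg}
    {G : GerstInfinityStructure 𝒱} (hν : T.gerstν e = G.ν) (hμ : T.gerstμ e = G.μ) {n : ℕ}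
    (hn : 2 ≤ n) (X : ℕ → VectorField k deg) (d : ℕ → ℤ)
    (hX : ∀ i, X i ∈ vectorFieldsOfDegree k deg (d i - 2)) : T.stasheffSum n X d = 0 := by
  refine eq_zero_of_coordField (n := n) (T.stasheffSum n)
    (fun X d i x y hi => T.stasheffSum_add hi X d x y)
    (fun X d i f p hi hX hf h => ?_) (fun X d hX => ?_) X d hX
  · rw [T.stasheffSum_smul hn hi hX hf, h, smul_zero, smul_zero]
  -- Only the first n entries are known to be coordinate fields. The irrelevant later ones are
  -- replaced by 0, to obtain a sequence that is homogeneous throughout.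
  have h1 : ∀ i, ∃ v c, v ∈ 𝒱 c ∧ (i < n → X i = constField e deg v ∧ d i = c) := by
    intro i
    by_cases hi : i < n
    · obtain ⟨α, h1, h2⟩ := hX i hi
      exact ⟨e α, deg α, he α, fun _ => ⟨by rw [h1, constField_basis], h2⟩⟩
    · exact ⟨0, 0, Submodule.zero_mem _, fun h => absurd h hi⟩
  choose a c ha hac using h1
  rw [T.stasheffSum_congr (fun i hi => (hac i hi).1) fun i hi => (hac i hi).2]
  refine VectorField.ext_taylor he fun N β => ?_
  rw [T.taylor_stasheffSum he hn ha fun i => he (β i), hν, hμ,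
    G.ν_μ n N a _ c _ hn ha fun i => he (β i), sub_self, map_zero]
  rfl

theorem toGerst_surjective [CharZero k] :
    Function.Surjective (GeometricAInfinityStructure.toGerst he (k := k)) := by
  intro G
  obtain ⟨T, hν, hμ⟩ := exists_gerst_eq (deg := deg) he G
  have hQ : bracket 1 1 T.Q T.Q = 0 := by
    rw [bracket_self_apply, act_self_eq_zero he hν, smul_zero]
  refine ⟨{ T with
    stasheff := fun n X d hn hX => ?_
    Q_homological := hQ }, GerstInfinityStructure.ext hν hμ⟩
  rcases hn.eq_or_lt with rfl | hn
  · exact T.stasheffSum_one hQ X d hX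
  · exact stasheffSum_eq_zero he hν hμ hn X d hX

end TensorStructure

end GerstInf

theorem theorem3p8p2 {k V ι : Type*} [Field k] [CharZero k] [AddCommGroup V] [Module k V]
    (𝒱 : ℤ → Submodule k V) [DirectSum.Decomposition 𝒱] [Fintype ι] [LinearOrder ι]
    (e : Module.Basis ι k V) (deg : ι → ℤ) (he : ∀ α, e α ∈ 𝒱 (deg α)) :
    ∃ Φ : GerstInf.GerstInfinityStructure 𝒱 ≃ GerstInf.GeometricAInfinityStructure k deg,
      ∀ G : GerstInf.GerstInfinityStructure 𝒱,
        GerstInf.IsTaylorSum (Φ G).Q (G.fieldTerm e deg) ∧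
        ∀ (n : ℕ) (a : Fin n → ι), 2 ≤ n →
          GerstInf.IsTaylorSum ((Φ G).μ n fun i => GerstInf.coordField k deg (a i))
            (G.tensorTerm e deg n a) := by
  let Ψ := Equiv.ofBijective (GerstInf.GeometricAInfinityStructure.toGerst he)
    ⟨GerstInf.TensorStructure.toGerst_injective he,
      GerstInf.TensorStructure.toGerst_surjective he⟩
  -- The map sought is inverse to taking Taylor coefficients. Every `G` consists of the Taylor
  -- coefficients of some `Γ`, so the required formulas are Taylor expansions of the vector field of
  -- `Γ` and of its tensor components.
  refine ⟨Ψ.symm, fun G => ?_⟩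
  obtain ⟨Γ, rfl⟩ := Ψ.surjective G
  rw [Ψ.symm_apply_apply]
  exact ⟨GerstInf.TensorStructure.isTaylorSum_fieldTerm he Γ,
    fun n a hn => GerstInf.TensorStructure.isTaylorSum_tensorTerm he Γ hn a⟩
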